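/- **Machines.** All machines are Turing machines with finitely many states, a two-way read-only input tape holding $x\in\{0,1\}^n$ between end markers, and one-way infinite binary read-write tapes with a left-end marker; the output is one bit, given on halting. A machine has $m$ bits of space on a tape if it only ever visits the first $m$ cells of it. $\mathsf{SPACE}(S)$ is the class of languages $L\subseteq\{0,1\}^*$ decided by a deterministic such machine that halts on every input and uses one work tape (initially all $0$) with $S(n)$ bits of space on inputs of length $n$, and $\mathsf{PSPACE}=\bigcup_{k\in\mathbb N}\mathsf{SPACE}(n^k)$. For $0<\epsilon\le\frac12$, $0\le\delta<1$ and $s,c:\mathbb N\to\mathbb N$, a language $L$ is in $\mathsf{BP}_{\epsilon,\delta}\mathsf{CSPACE}(s,c)$ if there is a machine $M$ with a work tape (initially all $0$), a catalytic tape, and read-only, read-once access to a string $r$ of $2^{c(n)}$ random bits, such that for every $n$, every input $x\in\{0,1\}^n$ and every initial content $\tau\in\{0,1\}^{c(n)}$ of the catalytic tape: - for every $r\in\{0,1\}^{2^{c(n)}}$, $M$ halts, uses at most $s(n)$ bits of work space and $c(n)$ bits of catalytic space, and never asks for more than $2^{c(n)}$ random bits; - with probability at least $\frac12+\epsilon$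 over uniform $r$, $M$ outputs $L(x)$; - with probability at least $1-\delta$ over uniform $r$, $M$ halts with $\tau$ on the catalytic tape. Let $\mathsf{BP}_{\epsilon,\delta}\mathsf{CL}=\bigcup_{k\in\mathbb N}\mathsf{BP}_{\epsilon,\delta}\mathsf{CSPACE}(k\lceil\log_2 n\rceil,\,n^k)$, where $\lceil \log_2 0\rceil:=0$. **Theorem.** Let $\epsilon>0$ and $\delta<1$ be real constants with $\delta>2\epsilon$. 1. For all functions $s,c:\mathbb N\to\mathbb N$ with $\lceil\log_2 n\rceil\le s(n)\le c(n)\le 2^{s(n)}$ for all $n$, $$\bigcup_{k\in\mathbb N}\mathsf{BP}_{\epsilon,\delta}\mathsf{CSPACE}\big(k\cdot s,\;c^k\big)\;=\;\bigcup_{k\in\mathbb N}\mathsf{SPACE}\big((s+c)^k\big),$$ that is, $\mathsf{BP}_{\epsilon,\delta}\mathsf{CSPACE}(O(s),\mathrm{poly}(c))=\mathsf{SPACE}(\mathrm{poly}(s,c))$. In particular $\mathsf{BP}_{\epsilon,\delta}\mathsf{CSPACE}(s,c)\subseteq\mathsf{SPACE}(\mathrm{poly}(s,c))$. 2. $\mathsf{BP}_{\epsilon,\delta}\mathsf{CL}=\mathsf{PSPACE}$.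 -/

import Mathlib

namespace Catalytic

/-- What a head sees: a left-end marker, a right-end marker (input tape only), or a bit. -/
inductive Sym where
  | leftEnd
  | rightEnd
  | bit (b : Bool)

/-- Head movements. -/
inductive Dir where
  | left
  | stay
  | right

/-- A Turing machine with a two-way read-only input tape, binary read-write tapes indexed by `ι`
(each infinite to the right, with a left-end marker) and a one-way read-once tape of random bits.

* `output q = some b` means that `q` is a halting state in which the machine outputs the bit `b`.
* In a state with `tosses q = true` a step consumes the next random bit `b`, and the coin argument
  of `next` is `some b`; in all other states no random bit is consumed and the argument is `none`.
* `next` gets the state, the scanned input symbol, the scanned symbols of the read-write tapes and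
  the coin. It returns the new state, the input head movement and, for each read-write tape, the
  bit to be written and the head movement. -/
structure Machine (ι : Type) where
  State : Type
  finite_state : Finite State
  start : State
  output : State → Option Bool
  tosses : State → Bool
  next : State → Sym → (ι → Sym) → Option Bool → State × Dir × (ι → Bool × Dir)

namespace Machine

variable {ι : Type}

/-- Configurations. A head at position `0` is on the left-end marker, a head at position `p + 1`
is on cell number `p`. `coins` is the unread part of the random tape. -/
structure Config (M : Machine ι) where
  state : M.State
  inputHead : ℕ
  head : ι → ℕ
  tape : ι → ℕ → Bool
  coins : List Bool

/-- The scanned symbol of the input tape, on which `x` stands between two end markers. -/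
def readInput (x : List Bool) : ℕ → Sym
  | 0 => Sym.leftEnd
  | p + 1 => if h : p < x.length then Sym.bit x[p] else Sym.rightEnd

/-- The scanned symbol of a read-write tape. -/
def readTape (t : ℕ → Bool) : ℕ → Sym
  | 0 => Sym.leftEnd
  | p + 1 => Sym.bit (t p)

/-- Writing a bit; the left-end marker cannot be overwritten. -/
def writeTape (t : ℕ → Bool) (b : Bool) : ℕ → ℕ → Bool
  | 0 => t
  | p + 1 => Function.update t p b

/-- Moving a head; on the left-end marker a move to the left has no effect. -/
def move (p : ℕ) : Dir → ℕ
  | Dir.left => p - 1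
  | Dir.stay => p
  | Dir.right => p + 1

/-- The effect of one transition, with coin `o` and `rest` as the new unread part of the random
tape. The input head does not leave the segment delimited by the two end markers. -/
def applyNext (M : Machine ι) (x : List Bool) (C : M.Config) (o : Option Bool)
    (rest : List Bool) : M.Config :=
  let a := M.next C.state (readInput x C.inputHead) (fun i => readTape (C.tape i) (C.head i)) o
  { state := a.1
    inputHead := min (move C.inputHead a.2.1) (x.length + 1)
    head := fun i => move (C.head i) (a.2.2 i).2
    tape := fun i => writeTape (C.tape i) (a.2.2 i).1 (C.head i)
    coins := rest }

/-- One step on input `x`. There is no next configuration if the machine has halted, or if it asks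
for a random bit after the random tape is used up (in which case it has not halted). -/
def step (M : Machine ι) (x : List Bool) (C : M.Config) : Option M.Config :=
  if (M.output C.state).isSome then none
  else if M.tosses C.state then
    match C.coins with
    | [] => none
    | b :: rest => some (M.applyNext x C (some b) rest)
  else some (M.applyNext x C none C.coins)

/-- The start configuration with initial tape contents `t` and random string `r`. -/
def init (M : Machine ι) (t : ι → ℕ → Bool) (r : List Bool) : M.Config where
  state := M.start
  inputHead := 0
  head := fun _ => 0
  tape := t
  coins := r

/-- `D` is reachable from `C` in finitely many steps on input `x`. -/
def Reaches (M : Machine ι) (x : List Bool) (C D : M.Config) : Prop :=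
  Relation.ReflTransGen (fun A B => M.step x A = some B) C D

/-- Started in `C` on input `x`, the machine halts in the configuration `D`, with output `b`. -/
def HaltsIn (M : Machine ι) (x : List Bool) (C D : M.Config) (b : Bool) : Prop :=
  M.Reaches x C D ∧ M.output D.state = some b

/-- Started in `C` on input `x`, the machine only ever visits the first `m i` cells of tape `i`. -/
def InSpace (M : Machine ι) (x : List Bool) (C : M.Config) (m : ι → ℕ) : Prop :=
  ∀ D, M.Reaches x C D → ∀ i, D.head i ≤ m i

end Machine

/-- The bit `b` is the answer to the question whether `x` belongs to `L`. -/
def IsAnswer (L : Language Bool) (x : List Bool) (b : Bool) : Prop :=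
  b = true ↔ x ∈ L

/-- The class `SPACE(S)`: languages decided by a deterministic machine that has one binary work
tape, halts on every input, and visits at most `S n` cells on inputs of length `n`. -/
def SPACE (S : ℕ → ℕ) : Set (Language Bool) :=
  {L | ∃ M : Machine Unit, (∀ q, M.tosses q = false) ∧ ∀ x : List Bool,
    (∃ D b, M.HaltsIn x (M.init (fun _ _ => false) []) D b ∧ IsAnswer L x b) ∧
    M.InSpace x (M.init (fun _ _ => false) []) (fun _ => S x.length)}

/-- The class `PSPACE`. -/
def PSPACE : Set (Language Bool) :=
  ⋃ k : ℕ, SPACE (fun n => n ^ k)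

/-- The two read-write tapes of a catalytic machine. -/
inductive CatTape where
  | work
  | cat

/-- The initial tapes of a catalytic machine: an empty work tape, and `τ` on the catalytic tape. -/
def catTapes {c : ℕ} (τ : Fin c → Bool) : CatTape → ℕ → Bool
  | CatTape.work, _ => false
  | CatTape.cat, i => if h : i < c then τ ⟨i, h⟩ else false

/-- The space bounds of a catalytic machine: `s` work cells and `c` catalytic cells. -/
def catSpace (s c : ℕ) : CatTape → ℕ
  | CatTape.work => s
  | CatTape.cat => c

/-- The start configuration with catalytic tape `τ` and random string `r`. -/
def catInit (M : Machine CatTape) {c m : ℕ} (τ : Fin c → Bool) (r : Fin m → Bool) : M.Config :=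
  M.init (catTapes τ) (List.ofFn r)

/-- The probability of the event `P` for a uniformly random bit string of length `m`. -/
noncomputable def prob {m : ℕ} (P : (Fin m → Bool) → Prop) : ℝ :=
  (Nat.card {r : Fin m → Bool // P r} : ℝ) / (2 : ℝ) ^ m

/-- The class `BP_{ε,δ}CSPACE(s, c)`: on inputs `x` of length `n`, for every initial catalytic tape
`τ ∈ {0,1}^c`, the machine halts for every `r ∈ {0,1}^(2^c)`, within `s` work cells and `c`
catalytic cells; with probability at least `1/2 + ε` over `r` its output is correct, and with
probability at least `1 - δ` over `r` it halts with `τ` on the catalytic tape. -/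
def BPCSPACE (ε δ : ℝ) (s c : ℕ → ℕ) : Set (Language Bool) :=
  {L | ∃ M : Machine CatTape, ∀ (x : List Bool) (τ : Fin (c x.length) → Bool),
    (∀ r : Fin (2 ^ c x.length) → Bool,
      (∃ D b, M.HaltsIn x (catInit M τ r) D b) ∧
      M.InSpace x (catInit M τ r) (catSpace (s x.length) (c x.length))) ∧
    1 / 2 + ε ≤ prob (fun r : Fin (2 ^ c x.length) → Bool =>
      ∃ D b, M.HaltsIn x (catInit M τ r) D b ∧ IsAnswer L x b) ∧
    1 - δ ≤ prob (fun r : Fin (2 ^ c x.length) → Bool =>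
      ∃ D b, M.HaltsIn x (catInit M τ r) D b ∧
        ∀ i : Fin (c x.length), D.tape CatTape.cat i = τ i)}

/-- The class `BP_{ε,δ}CL`, with work space `k log n` and catalytic space `n ^ k`. -/
def BPCL (ε δ : ℝ) : Set (Language Bool) :=
  ⋃ k : ℕ, BPCSPACE ε δ (fun n => k * Nat.clog 2 n) (fun n => n ^ k)

end Catalytic

/-! ### Composable programs for one read-write tape -/

namespace Catalytic

open Machine

/-! From catalytic to ordinary space, the restoring condition is simply dropped and the catalytic
tape is fixed to zeros. What remains is a randomized machine confined to `g` cells per tape. Its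
configurations, without the unread coins, have numerical codes below some N = 2^O(g) and form a
Markov chain in which every step uses a fair coin, possibly ignoring it. No configuration repeats in
a run that halts, so there are at most (number of codes) * (number of coins + 1) ≤ 2^T steps, with T
polynomial because there are only 2^c coins. The probability of output `b` is therefore an entry of
the 2^T-th power of the transition matrix.

This entry is computed by repeated squaring, a recursion of depth T. Entries are multiples of
1/(2l), rounded down after each squaring. Rounding down never overestimates (`sum_entry_le`), and it
loses at most 2^T * N out of 2l in total (`le_sum_entry`). With l = 2^(T+e) * N and 2^e * ε > 1 the
loss cannot hide the advantage ε.

Nothing says that `s` or `c` is computable, so g, T and l cannot be computed from the input. Instead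
`verdict` tries all parameters below Z, for Z = 0, 1, 2, .... This is sound for every choice:
configurations outside the bound go to an absorbing trash code, so an accepted `b` really has
probability above 1/2 (`half_lt_prob_of_accept`) and is the right answer. It is complete because
suitable parameters occur with polynomially many bits (`accept_of_le_prob`, `demand_le`).

The space of this computation is controlled by `LinSpace`: functions computed by register programs
whose numbers stay below a power of the size of the arguments. Such a program gets its scratch
registers as zeros and returns them as zeros. The class is closed under composition
(`LinSpace.comp`) and under primitive recursion with polynomially bounded values (`LinSpace.prec`);
running time plays no role. The squaring recursion is run as an iteration on numbers that encode a
stack (`Recursion.Good.result_eq`), and all numbers are cut off at Z, so that `verdict` is in the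
class as a function of Z.

Conversely, choose a dyadic p with 2ε ≤ p ≤ δ. With probability p, run the deterministic decider on
the catalytic tape and destroy its content; otherwise leave the tape alone and answer with a coin
flip. The answer is right with probability p + (1 - p)/2 ≥ 1/2 + ε, and the tape survives with
probability at least 1 - p ≥ 1 - δ. The decider works on arbitrary initial content because
`simulate` erases cells when it first enters them (`exec_simulate`). In both directions very short
inputs, where powers of the space bound need not grow, are answered from a finite table. -/

instance : Finite Sym :=
  Finite.of_injective (β := Option (Option Bool))
    (fun s => match s with | .leftEnd => none | .rightEnd => some none | .bit b => some (some b))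
    (by rintro (_ | _ | a) (_ | _ | b) h <;> simp_all)

/-- The bit shown by a symbol (`false` for the end markers). -/
def Sym.toBool : Sym → Bool
  | .bit b => b
  | _ => false

/-- The memory of a machine that uses one read-write tape. -/
structure Mem where
  inputHead : ℕ
  head : ℕ
  tape : ℕ → Bool
  coins : List Bool

/-- The effect on the memory of head movements and of writing a bit. -/
def Mem.act (x : List Bool) (A : Mem) (a : Dir × Bool × Dir) (rest : List Bool) : Mem :=
  ⟨min (move A.inputHead a.1) (x.length + 1), move A.head a.2.2,
    writeTape A.tape a.2.1 A.head, rest⟩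

/-- A program for one read-write tape, that may exit with a value in `X`. -/
structure Prog (X : Type) where
  State : Type
  finite_state : Finite State
  start : State
  tosses : State → Bool
  next : State → Sym → Sym → Option Bool → (State ⊕ X) × Dir × Bool × Dir

namespace Prog

variable {X Y S : Type}

/-- One step of a program. -/
def Step (P : Prog X) (x : List Bool) (q : P.State) (A : Mem) (e : P.State ⊕ X) (B : Mem) : Prop :=
  ∃ o rest, ((P.tosses q = false ∧ o = none ∧ rest = A.coins) ∨
      (P.tosses q = true ∧ ∃ b, o = some b ∧ A.coins = b :: rest)) ∧
    e = (P.next q (readInput x A.inputHead) (readTape A.tape A.head) o).1 ∧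
    B = A.act x (P.next q (readInput x A.inputHead) (readTape A.tape A.head) o).2 rest

/-- A run of a program from state `q` to its exit with value `y`, in which the head does not get
past position `m`. -/
inductive Run (P : Prog X) (x : List Bool) (m : ℕ) : P.State → Mem → X → Mem → Prop
  | exit {q A y B} : P.Step x q A (.inr y) B → A.head ≤ m → B.head ≤ m → Run P x m q A y B
  | cons {q A q' A' y B} : P.Step x q A (.inl q') A' → A.head ≤ m → Run P x m q' A' y B →
      Run P x m q A y B

/-- Started with memory `A`, the program exits with value `y` and memory `B`. -/
def Exec (P : Prog X) (x : List Bool) (m : ℕ) (A : Mem) (y : X) (B : Mem) : Prop :=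
  P.Run x m P.start A y B

theorem Exec.mono {P : Prog X} {x : List Bool} {m m' : ℕ} {A B : Mem} {y : X}
    (h : P.Exec x m A y B) (hm : m ≤ m') : P.Exec x m' A y B := by
  unfold Exec at h ⊢
  revert h
  generalize P.start = q
  intro h
  induction h with
  | exit h hA hB => exact .exit h (hA.trans hm) (hB.trans hm)
  | cons h hA _ ih => exact .cons h (hA.trans hm) ih

/-- The program that makes one step. -/
def act (f : Sym → Sym → X × Dir × Bool × Dir) : Prog X where
  State := Unit
  finite_state := inferInstance
  start := ()
  tosses _ := false
  next _ a b _ := (.inr (f a b).1, (f a b).2)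

theorem exec_act {f : Sym → Sym → X × Dir × Bool × Dir} {x m A}
    (h : A.head ≤ m)
    (h' : move A.head (f (readInput x A.inputHead) (readTape A.tape A.head)).2.2.2 ≤ m) :
    (act f).Exec x m A (f (readInput x A.inputHead) (readTape A.tape A.head)).1
      (A.act x (f (readInput x A.inputHead) (readTape A.tape A.head)).2 A.coins) :=
  .exit ⟨none, A.coins, .inl ⟨rfl, rfl, rfl⟩, rfl, rfl⟩ h h'

/-- The program that reads a random bit. -/
def toss : Prog Bool where
  State := Unit
  finite_state := inferInstance
  start := ()
  tosses _ := true
  next _ _ b o := (.inr (o.getD false), .stay, b.toBool, .stay)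

/-- Every step has to write something, so a step that only moves writes back what it sees. On the
left-end marker the default `false` is harmless, since writing there has no effect. -/
theorem writeTape_self (t : ℕ → Bool) (h : ℕ) : writeTape t (readTape t h).toBool h = t := by
  cases h <;> simp [writeTape, readTape, Sym.toBool]

theorem exec_toss {x m ih h t b cs} (hm : h ≤ m) (hi : ih ≤ x.length + 1) :
    toss.Exec x m ⟨ih, h, t, b :: cs⟩ b ⟨ih, h, t, cs⟩ := by
  refine .exit ⟨some b, cs, .inr ⟨rfl, b, rfl, rfl⟩, rfl, ?_⟩ hm hm
  simp [toss, Mem.act, move, writeTape_self, hi]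

/-- Sequential composition. -/
def bind (P : Prog X) [Finite X] (G : X → Prog Y) : Prog Y where
  State := P.State ⊕ Σ y, (G y).State
  finite_state := by
    have := P.finite_state
    have := fun y => (G y).finite_state
    infer_instance
  start := .inl P.start
  tosses := Sum.elim P.tosses (fun q => (G q.1).tosses q.2)
  next q a b o := match q with
    | .inl q => (.inl ((P.next q a b o).1.map id (fun y => ⟨y, (G y).start⟩)), (P.next q a b o).2)
    | .inr ⟨y, q⟩ => (((G y).next q a b o).1.map (fun q' => .inr ⟨y, q'⟩) id,
        ((G y).next q a b o).2)

theorem exec_bind [Finite X] {P : Prog X} {G : X → Prog Y} {x m A y B z C}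
    (h₁ : P.Exec x m A y B) (h₂ : (G y).Exec x m B z C) : (P.bind G).Exec x m A z C := by
  have h₃ : (P.bind G).Run x m (.inr ⟨y, (G y).start⟩) B z C := by
    clear h₁
    unfold Exec at h₂
    revert h₂
    generalize (G y).start = q
    intro h₂
    induction h₂ with
    | exit h hA hB =>
      obtain ⟨o, rest, ho, he, rfl⟩ := h
      exact .exit ⟨o, rest, ho, by simp [bind, ← he], rfl⟩ hA hB
    | cons h hA _ ih =>
      obtain ⟨o, rest, ho, he, rfl⟩ := h
      exact .cons ⟨o, rest, ho, by simp [bind, ← he], rfl⟩ hA ih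
  clear h₂
  unfold Exec at h₁ ⊢
  change (P.bind G).Run x m (.inl P.start) A z C
  revert h₁
  generalize P.start = q
  intro h₁
  induction h₁ with
  | exit h hA hB =>
    obtain ⟨o, rest, ho, he, rfl⟩ := h
    exact .cons ⟨o, rest, ho, by simp [bind, ← he], rfl⟩ hA h₃
  | cons h hA _ ih =>
    obtain ⟨o, rest, ho, he, rfl⟩ := h
    exact .cons ⟨o, rest, ho, by simp [bind, ← he], rfl⟩ hA (ih h₃)

/-- Iteration: exits of `F s` with `inl s'` continue with `F s'`. -/
def loop [Finite S] (F : S → Prog (S ⊕ Y)) (s : S) : Prog Y where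
  State := Σ s, (F s).State
  finite_state := by
    have := fun y => (F y).finite_state
    infer_instance
  start := ⟨s, (F s).start⟩
  tosses q := (F q.1).tosses q.2
  next q a b o :=
    (match ((F q.1).next q.2 a b o).1 with
      | .inl q' => .inl ⟨q.1, q'⟩
      | .inr (.inl s') => .inl ⟨s', (F s').start⟩
      | .inr (.inr y) => .inr y, ((F q.1).next q.2 a b o).2)

theorem exec_loop_exit [Finite S] {F : S → Prog (S ⊕ Y)} {s x m A y B}
    (h : (F s).Exec x m A (.inr y) B) : (loop F s).Exec x m A y B := by
  unfold Exec at h ⊢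
  change (loop F s).Run x m ⟨s, (F s).start⟩ A y B
  revert h
  generalize (F s).start = q
  generalize hz : (Sum.inr y : S ⊕ Y) = z
  intro h
  induction h with
  | exit h hA hB =>
    subst hz
    obtain ⟨o, rest, ho, he, rfl⟩ := h
    exact .exit ⟨o, rest, ho, by simp [loop, ← he], rfl⟩ hA hB
  | cons h hA _ ih =>
    obtain ⟨o, rest, ho, he, rfl⟩ := h
    exact .cons ⟨o, rest, ho, by simp [loop, ← he], rfl⟩ hA (ih hz)

theorem exec_loop_cons [Finite S] {F : S → Prog (S ⊕ Y)} {s s' x m A y B C}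
    (h : (F s).Exec x m A (.inl s') B) (h' : (loop F s').Exec x m B y C) :
    (loop F s).Exec x m A y C := by
  unfold Exec at h ⊢
  change (loop F s).Run x m ⟨s, (F s).start⟩ A y C
  -- The loops started at `s` and at `s'` differ only in their start state, so a run of one is a run
  -- of the other.
  replace h' : (loop F s).Run x m ⟨s', (F s').start⟩ B y C := by
    have key : ∀ (q : (loop F s').State) (A B : Mem) (y : Y), (loop F s').Run x m q A y B →
        (loop F s).Run x m q A y B := by
      intro q A B y h
      induction h with
      | exit h hA hB => exact .exit h hA hB
      | cons h hA _ ih => exact .cons h hA ih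
    exact key _ _ _ _ h'
  revert h
  generalize (F s).start = q
  generalize hz : (Sum.inl s' : S ⊕ Y) = z
  intro h
  induction h with
  | exit h hA hB =>
    subst hz
    obtain ⟨o, rest, ho, he, rfl⟩ := h
    exact .cons ⟨o, rest, ho, by simp [loop, ← he], rfl⟩ hA h'
  | cons h hA _ ih =>
    obtain ⟨o, rest, ho, he, rfl⟩ := h
    exact .cons ⟨o, rest, ho, by simp [loop, ← he], rfl⟩ hA (ih h' hz)

/-! ### Programs as machines -/

variable {ι : Type} [DecidableEq ι]

/-- The machine that runs a program on its tape `i` and outputs the exit value. -/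
def toMachine (P : Prog Bool) (i : ι) : Machine ι where
  State := P.State ⊕ Bool
  finite_state := by
    have := P.finite_state
    infer_instance
  start := .inl P.start
  output := Sum.elim (fun _ => none) some
  tosses := Sum.elim P.tosses (fun _ => false)
  next q a b o := match q with
    | .inl q => ((P.next q a (b i) o).1, (P.next q a (b i) o).2.1,
        fun j => if j = i then (P.next q a (b i) o).2.2 else (false, .stay))
    | .inr y => (.inr y, .stay, fun _ => (false, .stay))

/-- The configuration with state `e` and memory `A` on tape `i`, where the other tapes hold `T`. -/
def cfg (P : Prog Bool) (i : ι) (T : ι → ℕ → Bool) (e : P.State ⊕ Bool) (A : Mem) :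
    (P.toMachine i).Config where
  state := e
  inputHead := A.inputHead
  head := fun j => if j = i then A.head else 0
  tape := Function.update T i A.tape
  coins := A.coins

theorem step_cfg {P : Prog Bool} {i : ι} {T : ι → ℕ → Bool} {x q A e B} (h : P.Step x q A e B) :
    (P.toMachine i).step x (P.cfg i T (.inl q) A) = some (P.cfg i T e B) := by
  obtain ⟨o, rest, ho, rfl, rfl⟩ := h
  have key : (P.toMachine i).applyNext x (P.cfg i T (.inl q) A) o rest =
      P.cfg i T (P.next q (readInput x A.inputHead) (readTape A.tape A.head) o).1
        (A.act x (P.next q (readInput x A.inputHead) (readTape A.tape A.head) o).2 rest) := by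
    simp only [applyNext, cfg, toMachine, Mem.act, Config.mk.injEq]
    simp only [Function.update_self, if_true]
    refine ⟨?_, ?_, ?_, ?_, ?_⟩
    · trivial
    · trivial
    · funext j
      by_cases hj : j = i <;> simp [hj, move]
    · funext j
      by_cases hj : j = i
      · subst hj; simp
      · simp [hj, writeTape]
    · trivial
  rw [← key]
  rcases ho with ⟨ht, rfl, rfl⟩ | ⟨ht, b, rfl, hc⟩
  · simp [step, cfg, toMachine, ht]
  · simp [step, cfg, toMachine, ht, hc]

theorem Run.halts {P : Prog Bool} (i : ι) (T : ι → ℕ → Bool) {x m q A y B} (h : P.Run x m q A y B)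
    {m' : ι → ℕ} (hm : m ≤ m' i) :
    (P.toMachine i).HaltsIn x (P.cfg i T (.inl q) A) (P.cfg i T (.inr y) B) y ∧
      (P.toMachine i).InSpace x (P.cfg i T (.inl q) A) m' := by
  have hd : ∀ (e : P.State ⊕ Bool) (A : Mem), A.head ≤ m → ∀ j, (P.cfg i T e A).head j ≤ m' j := by
    intro e A hA j
    by_cases hj : j = i
    · subst hj; simpa [cfg] using hA.trans hm
    · simp [cfg, hj]
  induction h with
  | exit h hA hB =>
    have hs := step_cfg (i := i) (T := T) h
    -- Steps are deterministic: a reachable configuration is the present one or is reachable from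
    -- its only successor, and a halted configuration has none.
    refine ⟨⟨.single hs, rfl⟩, fun D hD => ?_⟩
    rcases hD.cases_head with rfl | ⟨E, hE, hD⟩
    · exact hd _ _ hA
    · rw [hs] at hE
      cases hE
      rcases hD.cases_head with rfl | ⟨E, hE, hD⟩
      · exact hd _ _ hB
      · simp [step, cfg, toMachine] at hE
  | cons h hA _ ih =>
    have hs := step_cfg (i := i) (T := T) h
    refine ⟨⟨ih.1.1.head hs, rfl⟩, fun D hD => ?_⟩
    rcases hD.cases_head with rfl | ⟨E, hE, hD⟩
    · exact hd _ _ hA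
    · rw [hs] at hE
      cases hE
      exact ih.2 D hD

end Prog

end Catalytic

/-! ### Elementary tape programs -/

namespace Catalytic

open Machine

namespace Prog

variable {X Y S : Type} {x : List Bool} {m ih h : ℕ} {t : ℕ → Bool} {cs : List Bool}

/-- One step that only concerns the read-write tape. -/
def tp (f : Sym → X × Bool × Dir) : Prog X :=
  act fun _ s => ((f s).1, .stay, (f s).2)

theorem exec_tp {f : Sym → X × Bool × Dir} (hi : ih ≤ x.length + 1) (hh : h ≤ m)
    (hm : move h (f (readTape t h)).2.2 ≤ m) :
    (tp f).Exec x m ⟨ih, h, t, cs⟩ (f (readTape t h)).1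
      ⟨ih, move h (f (readTape t h)).2.2, writeTape t (f (readTape t h)).2.1 h, cs⟩ := by
  have := exec_act (f := fun _ s => ((f s).1, Dir.stay, (f s).2)) (x := x)
    (A := ⟨ih, h, t, cs⟩) hh hm
  simpa [tp, Mem.act, move, hi] using this

/-- The program that does nothing. -/
def pure (y : X) : Prog X := tp fun s => (y, s.toBool, .stay)

theorem exec_pure (y : X) (hi : ih ≤ x.length + 1) (hh : h ≤ m) :
    (pure y).Exec x m ⟨ih, h, t, cs⟩ y ⟨ih, h, t, cs⟩ := by
  have := exec_tp (f := fun s => (y, s.toBool, Dir.stay)) (t := t) (cs := cs) hi hh hh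
  simpa [pure, move, writeTape_self] using this

/-- Moving the head by `n` cells. -/
def moves (d : Dir) : ℕ → Prog Unit
  | 0 => pure ()
  | n + 1 => (tp fun s => ((), s.toBool, d)).bind fun _ => moves d n

theorem exec_right (n : ℕ) (hi : ih ≤ x.length + 1) (hh : h + n ≤ m) :
    (moves .right n).Exec x m ⟨ih, h, t, cs⟩ () ⟨ih, h + n, t, cs⟩ := by
  induction n generalizing h with
  | zero => exact exec_pure () hi hh
  | succ n IH =>
    refine exec_bind (B := ⟨ih, h + 1, t, cs⟩) (y := ()) ?_ ?_
    · have := exec_tp (f := fun s => ((), s.toBool, Dir.right)) (t := t) (cs := cs) (h := h)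
        (m := m) hi (by omega) (by simp [move]; omega)
      simpa [move, writeTape_self] using this
    · have := IH (h := h + 1) (by omega)
      rwa [show h + (n + 1) = h + 1 + n by omega]

theorem exec_left (n : ℕ) (hi : ih ≤ x.length + 1) (hh : h ≤ m) :
    (moves .left n).Exec x m ⟨ih, h, t, cs⟩ () ⟨ih, h - n, t, cs⟩ := by
  induction n generalizing h with
  | zero => exact exec_pure () hi hh
  | succ n IH =>
    refine exec_bind (B := ⟨ih, h - 1, t, cs⟩) (y := ()) ?_ ?_
    · have := exec_tp (f := fun s => ((), s.toBool, Dir.left)) (t := t) (cs := cs) (h := h)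
        (m := m) hi (by omega) (by simp [move]; omega)
      simpa [move, writeTape_self] using this
    · have := IH (h := h - 1) (by omega)
      rwa [show h - (n + 1) = h - 1 - n by omega]

/-- Moving the head to the left end. -/
def home : Prog Unit :=
  loop (fun _ : Unit => tp fun s =>
    match s with
    | .leftEnd => (.inr (), false, .stay)
    | s => (.inl (), s.toBool, .left)) ()

theorem exec_home (hi : ih ≤ x.length + 1) (hh : h ≤ m) :
    home.Exec x m ⟨ih, h, t, cs⟩ () ⟨ih, 0, t, cs⟩ := by
  induction h with
  | zero => exact exec_loop_exit (exec_tp (h := 0) hi hh hh)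
  | succ h IH =>
    refine exec_loop_cons (B := ⟨ih, h, t, cs⟩) (s' := ()) ?_ (IH (by omega))
    have := exec_tp (X := Unit ⊕ Unit) (f := fun s =>
      match s with
      | .leftEnd => (.inr (), false, .stay)
      | s => (.inl (), s.toBool, .left)) (t := t) (cs := cs) (h := h + 1) (m := m) hi hh
      (by simp [move, readTape]; omega)
    simpa [move, readTape, writeTape, Sym.toBool] using this

/-- Looking at the scanned cell. -/
def look : Prog Bool := tp fun s => (s.toBool, s.toBool, .stay)

theorem exec_look (hi : ih ≤ x.length + 1) (hh : h + 1 ≤ m) :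
    look.Exec x m ⟨ih, h + 1, t, cs⟩ (t h) ⟨ih, h + 1, t, cs⟩ := by
  have := exec_tp (f := fun s => (s.toBool, s.toBool, Dir.stay)) (t := t) (cs := cs) hi hh hh
  rw [writeTape_self] at this
  exact this

/-- Writing a bit and moving the head. -/
def write (b : Bool) (d : Dir) : Prog Unit := tp fun _ => ((), b, d)

theorem exec_write (b : Bool) (d : Dir) (hi : ih ≤ x.length + 1) (hh : h + 1 ≤ m)
    (hm : move (h + 1) d ≤ m) : (write b d).Exec x m ⟨ih, h + 1, t, cs⟩ ()
      ⟨ih, move (h + 1) d, Function.update t h b, cs⟩ :=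
  exec_tp (f := fun _ => ((), b, d)) (t := t) (cs := cs) hi hh hm

/-! ### Binary registers -/

/-- The tape on which `k` registers are interleaved, together with flags for the first `f` blocks.
Block `j` consists of its flag and bit number `j` of each register. -/
def enc (k : ℕ) (σ : ℕ → ℕ) (f p : ℕ) : Bool :=
  if p % (k + 1) = 0 then decide (p / (k + 1) < f)
  else (σ (p % (k + 1) - 1)).testBit (p / (k + 1))

theorem enc_flag (k : ℕ) (σ : ℕ → ℕ) (f j : ℕ) : enc k σ f (j * (k + 1)) = decide (j < f) := by
  simp [enc]

theorem enc_bit {k i : ℕ} (hi : i < k) (σ : ℕ → ℕ) (f j : ℕ) :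
    enc k σ f (j * (k + 1) + 1 + i) = (σ i).testBit j := by
  have h1 : (j * (k + 1) + 1 + i) % (k + 1) = i + 1 := by
    rw [show j * (k + 1) + 1 + i = (i + 1) + (k + 1) * j by ring, Nat.add_mul_mod_self_left,
      Nat.mod_eq_of_lt (by omega)]
  have h2 : (j * (k + 1) + 1 + i) / (k + 1) = j := by
    rw [show j * (k + 1) + 1 + i = (i + 1) + (k + 1) * j by ring,
      Nat.add_mul_div_left _ _ (by omega), Nat.div_eq_of_lt (by omega), zero_add]
  simp [enc, h1, h2]

/-- A program does not know how many bits the registers may have; the flags tell it where the blocks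
in use end. The condition `j ≤ f` keeps the flagged blocks an initial segment. -/
theorem update_enc_flag {k f j : ℕ} (σ : ℕ → ℕ) (hj : j ≤ f) :
    Function.update (enc k σ f) (j * (k + 1)) true = enc k σ (max f (j + 1)) := by
  funext p
  by_cases hp : p = j * (k + 1)
  · subst hp
    simp [enc]
  · rw [Function.update_of_ne hp]
    unfold enc
    split_ifs with h0
    · have : p / (k + 1) ≠ j := by
        rintro rfl
        exact hp (by rw [Nat.div_mul_cancel (Nat.dvd_of_mod_eq_zero h0)])
      simp; omega
    · rfl

theorem update_enc_bit {k i f j v : ℕ} {b : Bool} (hi : i < k) (σ : ℕ → ℕ)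
    (hv : ∀ p, v.testBit p = if p = j then b else (σ i).testBit p) :
    Function.update (enc k σ f) (j * (k + 1) + 1 + i) b = enc k (Function.update σ i v) f := by
  funext p
  by_cases hp : p = j * (k + 1) + 1 + i
  · subst hp
    rw [enc_bit hi, Function.update_self, Function.update_self, hv, if_pos rfl]
  · rw [Function.update_of_ne hp]
    unfold enc
    split_ifs with h0
    · rfl
    · by_cases hq : p % (k + 1) - 1 = i
      · have : p / (k + 1) ≠ j := by
          rintro rfl
          apply hp
          have := Nat.div_add_mod p (k + 1)
          rw [mul_comm] at this
          omega
        rw [hq, Function.update_self, hv, if_neg this]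
      · rw [Function.update_of_ne hq]

/-- Bit `j` is clear, so the addition produces no carry. -/
theorem testBit_add_two_pow {v j : ℕ} (h : v.testBit j = false) (p : ℕ) :
    (v + 2 ^ j).testBit p = if p = j then true else v.testBit p := by
  have h0 : v / 2 ^ j % 2 = 0 := by
    rw [Nat.testBit_eq_decide_div_mod_eq] at h
    simp at h; omega
  obtain ⟨a, ha⟩ : ∃ a, v / 2 ^ j = 2 * a := ⟨v / 2 ^ j / 2, by omega⟩
  have hr : v % 2 ^ j < 2 ^ j := Nat.mod_lt _ (by positivity)
  have hv : v = 2 ^ j * (2 * a) + v % 2 ^ j := by rw [← ha]; exact (Nat.div_add_mod _ _).symm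
  have hv' : v + 2 ^ j = 2 ^ j * (2 * a + 1) + v % 2 ^ j := by rw [mul_add]; omega
  rw [hv', Nat.testBit_two_pow_mul_add _ hr]
  conv_rhs => rw [hv, Nat.testBit_two_pow_mul_add _ hr]
  rcases lt_trichotomy p j with hp | rfl | hp
  · simp [hp, hp.ne]
  · simp
  · obtain ⟨d, rfl⟩ := Nat.exists_eq_add_of_lt hp
    have : ¬ j + d + 1 < j := by omega
    simp [this, show j + d + 1 - j = d + 1 by omega, Nat.testBit_succ, show j + d + 1 ≠ j by omega]
    congr 1; omega

theorem testBit_sub_two_pow {v j : ℕ} (h : v.testBit j = true) (p : ℕ) :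
    (v - 2 ^ j).testBit p = if p = j then false else v.testBit p := by
  have hle : 2 ^ j ≤ v := Nat.ge_two_pow_of_testBit h
  have h1 : (v - 2 ^ j).testBit j = false := by
    rw [Nat.testBit_eq_decide_div_mod_eq] at h ⊢
    have : (v - 2 ^ j) / 2 ^ j = v / 2 ^ j - 1 := by
      simpa using Nat.sub_mul_div v (2 ^ j) 1
    simp at h ⊢; rw [this]; omega
  have := testBit_add_two_pow h1 p
  rw [Nat.sub_add_cancel hle] at this
  split_ifs with hp
  · rw [hp, h1]
  · rw [this, if_neg hp]

/-- A bound for the head positions in computations with `k` registers of `m` bits. -/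
def span (k m : ℕ) : ℕ := (m + 1) * (k + 1) + 1

/-- `P` leads from input head position and register contents `s` to `s'`, where the registers
always have at most `m` bits. -/
def Reg (k : ℕ) (x : List Bool) (m : ℕ) (P : Prog X) (s : ℕ × (ℕ → ℕ)) (y : X)
    (s' : ℕ × (ℕ → ℕ)) : Prop :=
  s.1 ≤ x.length + 1 → ∀ f ≤ m, (∀ i < k, s.2 i < 2 ^ f) → s'.1 ≤ x.length + 1 ∧ ∃ f' ≤ m,
    (∀ i < k, s'.2 i < 2 ^ f') ∧
    P.Exec x (span k m) ⟨s.1, 0, enc k s.2 f, []⟩ y ⟨s'.1, 0, enc k s'.2 f', []⟩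

/-! ### Register programs and their specifications -/

variable {k : ℕ}

theorem reg_bind [Finite X] {P : Prog X} {G : X → Prog Y} {s s' s'' y z}
    (h₁ : P.Reg k x m s y s') (h₂ : (G y).Reg k x m s' z s'') : (P.bind G).Reg k x m s z s'' := by
  intro hs f hf hσ
  obtain ⟨hs', f', hf', hσ', e⟩ := h₁ hs f hf hσ
  obtain ⟨hs'', f'', hf'', hσ'', e'⟩ := h₂ hs' f' hf' hσ'
  exact ⟨hs'', f'', hf'', hσ'', exec_bind e e'⟩

theorem reg_pure (y : X) (s : ℕ × (ℕ → ℕ)) : (pure y).Reg k x m s y s :=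
  fun hs f hf hσ => ⟨hs, f, hf, hσ, exec_pure y hs (Nat.zero_le _)⟩

theorem reg_loop_exit [Finite S] {F : S → Prog (S ⊕ Y)} {s a y b}
    (h : (F s).Reg k x m a (.inr y) b) : (loop F s).Reg k x m a y b := by
  intro hs f hf hσ
  obtain ⟨hs', f', hf', hσ', e⟩ := h hs f hf hσ
  exact ⟨hs', f', hf', hσ', exec_loop_exit e⟩

theorem reg_loop_cons [Finite S] {F : S → Prog (S ⊕ Y)} {s s' a b y c}
    (h₁ : (F s).Reg k x m a (.inl s') b) (h₂ : (loop F s').Reg k x m b y c) :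
    (loop F s).Reg k x m a y c := by
  intro hs f hf hσ
  obtain ⟨hs', f', hf', hσ', e⟩ := h₁ hs f hf hσ
  obtain ⟨hs'', f'', hf'', hσ'', e'⟩ := h₂ hs' f' hf' hσ'
  exact ⟨hs'', f'', hf'', hσ'', exec_loop_cons e e'⟩

/-- One step that only concerns the input tape. -/
def input (f : Sym → X × Dir) : Prog X := act fun a s => ((f a).1, (f a).2, s.toBool, .stay)

theorem reg_input (f : Sym → X × Dir) (s : ℕ × (ℕ → ℕ)) :
    (input f).Reg k x m s (f (readInput x s.1)).1
      (min (move s.1 (f (readInput x s.1)).2) (x.length + 1), s.2) := by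
  intro hs g hg hσ
  refine ⟨min_le_right _ _, g, hg, hσ, ?_⟩
  have := exec_act (f := fun a s => ((f a).1, (f a).2, s.toBool, Dir.stay)) (x := x)
    (m := span k m) (A := ⟨s.1, 0, enc k s.2 g, []⟩) (Nat.zero_le _) (Nat.zero_le _)
  exact this

theorem pos_le_span {k m j i : ℕ} (hj : j ≤ m) (hi : i ≤ k) :
    j * (k + 1) + 1 + i + 1 ≤ span k m := by
  have := Nat.mul_le_mul_right (k + 1) hj
  rw [span, add_mul]; omega

/-- Going to block `0`, running `F` on the blocks, and back to the left end. -/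
def onBlocks [Finite X] (F : Prog (Unit ⊕ X)) : Prog X :=
  (moves .right 1).bind fun _ => (loop (fun _ : Unit => F) ()).bind fun y => home.bind fun _ =>
    pure y

theorem exec_onBlocks [Finite X] {F : Prog (Unit ⊕ X)} {y t' h'} (hi : ih ≤ x.length + 1)
    (hm : 1 ≤ m) (hh : h' ≤ m)
    (hF : (loop (fun _ : Unit => F) ()).Exec x m ⟨ih, 1, t, cs⟩ y ⟨ih, h', t', cs⟩) :
    (onBlocks F).Exec x m ⟨ih, 0, t, cs⟩ y ⟨ih, 0, t', cs⟩ :=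
  exec_bind (exec_right 1 hi (by omega)) (exec_bind hF (exec_bind (exec_home hi hh)
    (exec_pure y hi (Nat.zero_le _))))

/-- Incrementing register `i` by flipping bits from the lowest one on. -/
def inc (k i : ℕ) : Prog Unit :=
  onBlocks <| (write true .right).bind fun _ => (moves .right i).bind fun _ => look.bind fun b =>
    (write (!b) .stay).bind fun _ =>
      if b then (moves .right (k - i)).bind fun _ => pure (.inl ()) else pure (.inr ())

theorem reg_inc {i : ℕ} (hi : i < k) {s : ℕ × (ℕ → ℕ)} (hm : s.2 i + 1 < 2 ^ m) :
    (inc k i).Reg k x m s () (s.1, Function.update s.2 i (s.2 i + 1)) := by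
  obtain ⟨ih, σ⟩ := s
  dsimp only at hm ⊢
  intro hs f hf hσ
  refine ⟨hs, ?_⟩
  dsimp only at hs hσ ⊢
  -- Carry invariant: with bits `0, …, j - 1` flipped from one to zero, the register holds a
  -- multiple `v` of `2 ^ j` with `v + 2 ^ j = σ i + 1`. The number of flagged blocks may grow along
  -- the way. The induction is on `d = m - j`.
  suffices H : ∀ d j f v, d + j = m → f ≤ m → j ≤ f → (∀ i' < k, i' ≠ i → σ i' < 2 ^ f) →
      v < 2 ^ f → v + 2 ^ j = σ i + 1 → 2 ^ j ∣ v →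
      ∃ f' ≤ m, (∀ i' < k, Function.update σ i (σ i + 1) i' < 2 ^ f') ∧ ∃ h' ≤ span k m,
      (loop (fun _ : Unit => (write true .right).bind fun _ => (moves .right i).bind fun _ =>
        look.bind fun b => (write (!b) .stay).bind fun _ =>
        if b then (moves .right (k - i)).bind fun _ => pure (.inl ()) else pure (.inr ())) ()).Exec
        x (span k m) ⟨ih, j * (k + 1) + 1, enc k (Function.update σ i v) f, []⟩ ()
        ⟨ih, h', enc k (Function.update σ i (σ i + 1)) f', []⟩ by
    obtain ⟨f', hf', hb, h', hh', e⟩ := H m 0 f (σ i) rfl hf (Nat.zero_le _)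
      (fun i' hi' _ => hσ i' hi') (hσ i hi) rfl (by simp)
    refine ⟨f', hf', hb, exec_onBlocks hs ?_ hh' ?_⟩
    · simp [span]
    · simpa using e
  intro d
  induction d with
  | zero =>
    intro j f v hj hf hjf hσ hv hvj hd
    -- A carry that reaches bit `m` contradicts the absence of overflow.
    have : 2 ^ m ≤ σ i + 1 := by rw [← hvj, ← hj]; simp
    omega
  | succ d IH =>
    intro j f v hj hf hjf hσ hv hvj hd
    have hjm : j < m := by omega
    have hp1 := pos_le_span (m := m) hjm.le hi.le
    have hp2 := pos_le_span (k := k) (m := m) (i := k) hjm.le le_rfl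
    have e1 : (write true .right).Exec x (span k m)
        ⟨ih, j * (k + 1) + 1, enc k (Function.update σ i v) f, []⟩ ()
        ⟨ih, j * (k + 1) + 1 + 1, enc k (Function.update σ i v) (max f (j + 1)), []⟩ := by
      rw [← update_enc_flag _ hjf]
      exact exec_write true .right hs (by omega) (by simp [move]; omega)
    have e2 := exec_right (x := x) (m := span k m) (ih := ih) (h := j * (k + 1) + 1 + 1)
      (t := enc k (Function.update σ i v) (max f (j + 1))) (cs := []) i hs (by omega)
    rw [show j * (k + 1) + 1 + 1 + i = j * (k + 1) + 1 + i + 1 by omega] at e2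
    have e3 := exec_look (x := x) (m := span k m) (ih := ih) (h := j * (k + 1) + 1 + i)
      (t := enc k (Function.update σ i v) (max f (j + 1))) (cs := []) hs (by omega)
    rw [enc_bit hi, Function.update_self] at e3
    have e4 := exec_write (x := x) (m := span k m) (ih := ih) (h := j * (k + 1) + 1 + i)
      (t := enc k (Function.update σ i v) (max f (j + 1))) (cs := []) (!v.testBit j) .stay hs
      (by omega) (by simp [move]; omega)
    simp only [move] at e4
    have hfm : max f (j + 1) ≤ m := by omega
    cases hb : v.testBit j with
    | false =>
      rw [update_enc_bit (v := v + 2 ^ j) hi _ (by simpa [hb] using testBit_add_two_pow hb),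
        Function.update_idem, hvj] at e4
      refine ⟨max f (j + 1), hfm, ?_, j * (k + 1) + 1 + i + 1, hp1, ?_⟩
      · intro i' hi'
        by_cases hii : i' = i
        · subst hii
          rw [Function.update_self, ← hvj]
          have h1 : 2 ^ f ≤ 2 ^ (max f (j + 1)) := Nat.pow_le_pow_right (by omega) (by omega)
          have h2 : 2 ^ (j + 1) ≤ 2 ^ (max f (j + 1)) := Nat.pow_le_pow_right (by omega) (by omega)
          have h3 : v.testBit j = false := hb
          refine Nat.lt_pow_two_of_testBit _ fun p hp => ?_
          rw [testBit_add_two_pow hb, if_neg (by omega)]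
          exact Nat.testBit_lt_two_pow (hv.trans_le (Nat.pow_le_pow_right (by omega) (by omega)))
        · rw [Function.update_of_ne hii]
          exact (hσ i' hi' hii).trans_le (Nat.pow_le_pow_right (by omega) (by omega))
      · refine exec_loop_exit (exec_bind e1 (exec_bind e2 (exec_bind e3 ?_)))
        rw [hb] at e4 ⊢
        exact exec_bind e4 (exec_pure _ hs hp1)
    | true =>
      have hle : 2 ^ j ≤ v := Nat.ge_two_pow_of_testBit hb
      have hjv : j < f := by
        by_contra hlt
        have := Nat.pow_le_pow_right (n := 2) (by omega) (Nat.le_of_not_lt hlt)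
        omega
      rw [update_enc_bit (v := v - 2 ^ j) hi _ (by simpa [hb] using testBit_sub_two_pow hb),
        Function.update_idem] at e4
      -- Bit `j` of the multiple `v` of `2 ^ j` is set, so the cofactor is odd, and clearing the bit
      -- makes it even.
      have hmod : 2 ^ (j + 1) ∣ v - 2 ^ j := by
        obtain ⟨w, rfl⟩ := hd
        have hw : w % 2 = 1 := by
          rw [Nat.testBit_eq_decide_div_mod_eq] at hb
          simpa using hb
        refine ⟨w / 2, ?_⟩
        have : w = 2 * (w / 2) + 1 := by omega
        rw [pow_succ]
        conv_lhs => rw [this]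
        rw [mul_add, mul_one, Nat.add_sub_cancel, mul_assoc]
      obtain ⟨f', hf', hb', h', hh', e⟩ := IH (j + 1) (max f (j + 1)) (v - 2 ^ j) (by omega) hfm
        (by omega) (fun i' hi' hne => (hσ i' hi' hne).trans_le
          (Nat.pow_le_pow_right (by omega) (by omega)))
        ((Nat.sub_le _ _).trans_lt (hv.trans_le (Nat.pow_le_pow_right (by omega) (by omega))))
        (by rw [pow_succ]; omega) hmod
      refine ⟨f', hf', hb', h', hh', ?_⟩
      refine exec_loop_cons (exec_bind e1 (exec_bind e2 (exec_bind e3 ?_))) e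
      rw [hb] at e4 ⊢
      refine exec_bind e4 ?_
      have e5 := exec_right (x := x) (m := span k m) (ih := ih) (h := j * (k + 1) + 1 + i + 1)
        (t := enc k (Function.update σ i (v - 2 ^ j)) (max f (j + 1))) (cs := []) (k - i) hs
        (by omega)
      rw [show j * (k + 1) + 1 + i + 1 + (k - i) = (j + 1) * (k + 1) + 1 by
        rw [add_mul]; omega] at e5
      refine exec_bind e5 (exec_pure _ hs ?_)
      rw [add_mul]; omega

theorem add_two_pow_lt {v j f : ℕ} (hb : v.testBit j = false) (hv : v < 2 ^ f) (hj : j < f) :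
    v + 2 ^ j < 2 ^ f := by
  refine Nat.lt_pow_two_of_testBit _ fun p hp => ?_
  rw [testBit_add_two_pow hb, if_neg (by omega)]
  exact Nat.testBit_lt_two_pow (hv.trans_le (Nat.pow_le_pow_right (by omega) (by omega)))

/-- Testing whether register `i` is positive. -/
def test (k i : ℕ) : Prog Bool :=
  onBlocks <| look.bind fun b =>
    if b then (moves .right (i + 1)).bind fun _ => look.bind fun c =>
      if c then pure (.inr true) else (moves .right (k - i)).bind fun _ => pure (.inl ())
    else pure (.inr false)

theorem reg_test {i : ℕ} (hi : i < k) (s : ℕ × (ℕ → ℕ)) :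
    (test k i).Reg k x m s (decide (0 < s.2 i)) s := by
  obtain ⟨ih, σ⟩ := s
  intro hs f hf hσ
  refine ⟨hs, f, hf, hσ, ?_⟩
  dsimp only at hs hσ ⊢
  -- Divisibility by `2 ^ j` says that the bits inspected so far vanish. At the first unflagged
  -- block `j = f` this forces the register to be zero, as it is below `2 ^ f`.
  suffices H : ∀ d j, d + j = f → 2 ^ j ∣ σ i → ∃ h' ≤ span k m,
      (loop (fun _ : Unit => look.bind fun b =>
        if b then (moves .right (i + 1)).bind fun _ => look.bind fun c =>
          if c then pure (.inr true) else (moves .right (k - i)).bind fun _ => pure (.inl ())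
        else pure (.inr false)) ()).Exec x (span k m) ⟨ih, j * (k + 1) + 1, enc k σ f, []⟩
        (decide (0 < σ i)) ⟨ih, h', enc k σ f, []⟩ by
    obtain ⟨h', hh', e⟩ := H f 0 rfl (by simp)
    exact exec_onBlocks hs (by simp [span]) hh' (by simpa using e)
  intro d
  induction d with
  | zero =>
    intro j hj hd
    obtain rfl : j = f := by omega
    have h0 : σ i = 0 := Nat.eq_zero_of_dvd_of_lt hd (hσ i hi)
    have hp1 := pos_le_span (m := m) hf hi.le
    refine ⟨j * (k + 1) + 1, by omega, exec_loop_exit ?_⟩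
    have e := exec_look (x := x) (m := span k m) (ih := ih) (h := j * (k + 1))
      (t := enc k σ j) (cs := []) hs (by omega)
    rw [enc_flag] at e
    refine exec_bind e ?_
    simp only [lt_irrefl, decide_false, h0]
    exact exec_pure _ hs (by omega)
  | succ d IH =>
    intro j hj hd
    have hjm : j < f := by omega
    have hp1 := pos_le_span (k := k) (m := m) (i := k) (hjm.le.trans hf) le_rfl
    have e := exec_look (x := x) (m := span k m) (ih := ih) (h := j * (k + 1))
      (t := enc k σ f) (cs := []) hs (by omega)
    rw [enc_flag, decide_eq_true hjm] at e
    have e2 := exec_right (x := x) (m := span k m) (ih := ih) (h := j * (k + 1) + 1)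
      (t := enc k σ f) (cs := []) (i + 1) hs (by omega)
    rw [show j * (k + 1) + 1 + (i + 1) = j * (k + 1) + 1 + i + 1 by omega] at e2
    have e3 := exec_look (x := x) (m := span k m) (ih := ih) (h := j * (k + 1) + 1 + i)
      (t := enc k σ f) (cs := []) hs (by omega)
    rw [enc_bit hi] at e3
    cases hb : (σ i).testBit j with
    | true =>
      have : 0 < σ i := (Nat.two_pow_pos j).trans_le (Nat.ge_two_pow_of_testBit hb)
      refine ⟨j * (k + 1) + 1 + i + 1, by omega, exec_loop_exit (exec_bind e ?_)⟩
      rw [if_pos rfl]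
      refine exec_bind e2 (exec_bind e3 ?_)
      rw [hb, if_pos rfl, decide_eq_true this]
      exact exec_pure _ hs (by omega)
    | false =>
      have hd' : 2 ^ (j + 1) ∣ σ i := by
        obtain ⟨w, hw⟩ := hd
        rw [Nat.testBit_eq_decide_div_mod_eq, hw, Nat.mul_div_cancel_left _ (by positivity)] at hb
        refine ⟨w / 2, ?_⟩
        rw [hw, pow_succ, mul_assoc]
        congr 1
        simp at hb; omega
      obtain ⟨h', hh', e'⟩ := IH (j + 1) (by omega) hd'
      refine ⟨h', hh', exec_loop_cons (exec_bind e ?_) e'⟩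
      rw [if_pos rfl]
      refine exec_bind e2 (exec_bind e3 ?_)
      rw [hb]
      have e5 := exec_right (x := x) (m := span k m) (ih := ih) (h := j * (k + 1) + 1 + i + 1)
        (t := enc k σ f) (cs := []) (k - i) hs (by omega)
      rw [show j * (k + 1) + 1 + i + 1 + (k - i) = (j + 1) * (k + 1) + 1 by
        rw [add_mul]; omega] at e5
      refine exec_bind e5 (exec_pure _ hs ?_)
      rw [add_mul]; omega

/-- Decrementing a positive register `i`. -/
def dec (k i : ℕ) : Prog Unit :=
  onBlocks <| (moves .right (i + 1)).bind fun _ => look.bind fun b => (write (!b) .stay).bind fun _ =>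
    if b then pure (.inr ()) else (moves .right (k - i)).bind fun _ => pure (.inl ())

theorem reg_dec {i : ℕ} (hi : i < k) {s : ℕ × (ℕ → ℕ)} (hpos : 0 < s.2 i) :
    (dec k i).Reg k x m s () (s.1, Function.update s.2 i (s.2 i - 1)) := by
  obtain ⟨ih, σ⟩ := s
  intro hs f hf hσ
  dsimp only at hs hσ hpos ⊢
  refine ⟨hs, f, hf, ?_, ?_⟩
  · intro i' hi'
    by_cases hii : i' = i
    · subst hii
      simpa using (Nat.sub_le _ _).trans_lt (hσ i' hi')
    · simpa [hii] using hσ i' hi'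
  -- Borrow invariant: `σ i` is a multiple of `2 ^ j`, and its `j` low zeros have been turned into
  -- ones, giving `v = σ i + 2 ^ j - 1`. A positive register has a set bit in a flagged block, so
  -- the flags stay as they are.
  suffices H : ∀ d j v, d + j = f → v < 2 ^ f → v + 1 = σ i + 2 ^ j → 2 ^ j ∣ σ i →
      ∃ h' ≤ span k m,
      (loop (fun _ : Unit => (moves .right (i + 1)).bind fun _ => look.bind fun b =>
        (write (!b) .stay).bind fun _ =>
        if b then pure (.inr ()) else (moves .right (k - i)).bind fun _ => pure (.inl ())) ()).Exec
        x (span k m) ⟨ih, j * (k + 1) + 1, enc k (Function.update σ i v) f, []⟩ ()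
        ⟨ih, h', enc k (Function.update σ i (σ i - 1)) f, []⟩ by
    obtain ⟨h', hh', e⟩ := H f 0 (σ i) rfl (hσ i hi) rfl (by simp)
    exact exec_onBlocks hs (by simp [span]) hh' (by simpa using e)
  intro d
  induction d with
  | zero =>
    intro j v hj hv hvj hd
    obtain rfl : j = f := by omega
    exact absurd (Nat.eq_zero_of_dvd_of_lt hd (hσ i hi)) hpos.ne'
  | succ d IH =>
    intro j v hj hv hvj hd
    have hjf : j < f := by omega
    have hp1 := pos_le_span (k := k) (m := m) (i := k) (hjf.le.trans hf) le_rfl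
    have e2 := exec_right (x := x) (m := span k m) (ih := ih) (h := j * (k + 1) + 1)
      (t := enc k (Function.update σ i v) f) (cs := []) (i + 1) hs (by omega)
    rw [show j * (k + 1) + 1 + (i + 1) = j * (k + 1) + 1 + i + 1 by omega] at e2
    have e3 := exec_look (x := x) (m := span k m) (ih := ih) (h := j * (k + 1) + 1 + i)
      (t := enc k (Function.update σ i v) f) (cs := []) hs (by omega)
    rw [enc_bit hi, Function.update_self] at e3
    have e4 := exec_write (x := x) (m := span k m) (ih := ih) (h := j * (k + 1) + 1 + i)
      (t := enc k (Function.update σ i v) f) (cs := []) (!v.testBit j) .stay hs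
      (by omega) (by simp [move]; omega)
    simp only [move] at e4
    cases hb : v.testBit j with
    | true =>
      rw [update_enc_bit (v := v - 2 ^ j) hi _ (by simpa [hb] using testBit_sub_two_pow hb),
        Function.update_idem] at e4
      refine ⟨j * (k + 1) + 1 + i + 1, by omega, ?_⟩
      refine exec_loop_exit (exec_bind e2 (exec_bind e3 ?_))
      rw [hb] at e4 ⊢
      rw [show v - 2 ^ j = σ i - 1 by omega] at e4
      exact exec_bind e4 (exec_pure _ hs (by omega))
    | false =>
      rw [update_enc_bit (v := v + 2 ^ j) hi _ (by simpa [hb] using testBit_add_two_pow hb),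
        Function.update_idem] at e4
      have hd' : 2 ^ (j + 1) ∣ σ i := by
        obtain ⟨w, hw⟩ := hd
        have hj1 := Nat.two_pow_pos j
        have hv' : v = 2 ^ j * w + (2 ^ j - 1) := by omega
        rw [hv', Nat.testBit_two_pow_mul_add _ (by omega)] at hb
        refine ⟨w / 2, ?_⟩
        rw [hw, pow_succ, mul_assoc]
        congr 1
        simp at hb; omega
      obtain ⟨h', hh', e⟩ := IH (j + 1) (v + 2 ^ j) (by omega) (add_two_pow_lt hb hv hjf)
        (by rw [pow_succ]; omega) hd'
      refine ⟨h', hh', exec_loop_cons (exec_bind e2 (exec_bind e3 ?_)) e⟩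
      rw [hb] at e4 ⊢
      refine exec_bind e4 ?_
      have e5 := exec_right (x := x) (m := span k m) (ih := ih) (h := j * (k + 1) + 1 + i + 1)
        (t := enc k (Function.update σ i (v + 2 ^ j)) f) (cs := []) (k - i) hs (by omega)
      rw [show j * (k + 1) + 1 + i + 1 + (k - i) = (j + 1) * (k + 1) + 1 by
        rw [add_mul]; omega] at e5
      refine exec_bind e5 (exec_pure _ hs ?_)
      rw [add_mul]; omega

/-- Repeating `P` as often as the register `i` says, counting it down. -/
def downLoop (k i : ℕ) (P : Prog Unit) : Prog Unit :=
  loop (fun _ : Unit => (test k i).bind fun b =>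
    if b then (dec k i).bind fun _ => P.bind fun _ => pure (.inl ()) else pure (.inr ())) ()

/-- The state after `j` rounds is prescribed by `s j`, in which the counter must show `n - j`. The
body starts from `s j` with the counter already lowered. The number of rounds is exponential in the
number of bits, which is harmless since only space counts. -/
theorem reg_downLoop {i n : ℕ} (hi : i < k) {P : Prog Unit} (s : ℕ → ℕ × (ℕ → ℕ))
    (h0 : ∀ j ≤ n, (s j).2 i = n - j)
    (hP : ∀ j < n, P.Reg k x m ((s j).1, Function.update (s j).2 i (n - (j + 1))) () (s (j + 1))) :
    (downLoop k i P).Reg k x m (s 0) () (s n) := by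
  suffices H : ∀ d j, d + j = n → (downLoop k i P).Reg k x m (s j) () (s n) from H n 0 rfl
  intro d
  induction d with
  | zero =>
    intro j hj
    obtain rfl : j = n := by omega
    refine reg_loop_exit (reg_bind (reg_test hi _) ?_)
    have : ¬ 0 < (s j).2 i := by rw [h0 j le_rfl]; omega
    rw [decide_eq_false this]
    exact reg_pure _ _
  | succ d IH =>
    intro j hj
    have hjn : j < n := by omega
    have hpos : 0 < (s j).2 i := by rw [h0 j hjn.le]; omega
    refine reg_loop_cons (s' := ()) (b := s (j + 1)) ?_ (IH (j + 1) (by omega))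
    refine reg_bind (reg_test hi _) ?_
    rw [decide_eq_true hpos, if_pos rfl]
    refine reg_bind (reg_dec hi hpos) (reg_bind (y := ()) ?_ (reg_pure _ _))
    have := hP j hjn
    rwa [show n - (j + 1) = (s j).2 i - 1 by rw [h0 j hjn.le]; omega] at this

end Prog

end Catalytic

namespace Catalytic

open Machine Prog

/-! ### Basic register programs -/

namespace Prog

variable {x : List Bool} {k m : ℕ}

/-- Clearing register `i`. -/
def clear (k i : ℕ) : Prog Unit := downLoop k i (pure ())

theorem reg_clear {i : ℕ} (hi : i < k) (ih : ℕ) (σ : ℕ → ℕ) :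
    (clear k i).Reg k x m (ih, σ) () (ih, Function.update σ i 0) := by
  have := reg_downLoop (x := x) (m := m) (n := σ i) hi (P := pure ())
    (fun j => (ih, Function.update σ i (σ i - j))) (by simp) (fun j hj => by
      simpa using reg_pure (k := k) (x := x) (m := m) () (ih, Function.update σ i (σ i - (j + 1))))
  simpa [clear] using this

/-- Adding register `i` to register `o` and clearing it. -/
def transfer (k i o : ℕ) : Prog Unit := downLoop k i (inc k o)

theorem reg_transfer {i o : ℕ} (hi : i < k) (ho : o < k) (hio : i ≠ o) (ih : ℕ) (σ : ℕ → ℕ)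
    (hm : σ o + σ i < 2 ^ m) : (transfer k i o).Reg k x m (ih, σ) ()
      (ih, Function.update (Function.update σ i 0) o (σ o + σ i)) := by
  have := reg_downLoop (x := x) (m := m) (n := σ i) hi (P := inc k o)
    (fun j => (ih, Function.update (Function.update σ i (σ i - j)) o (σ o + j)))
    (by simp [hio]) (fun j hj => by
      have := reg_inc (x := x) (m := m) ho (s := (ih, Function.update (Function.update σ i
        (σ i - (j + 1))) o (σ o + j))) (by simp; omega)
      rw [Function.update_comm hio.symm, Function.update_idem, Function.update_comm hio]
      simpa [add_assoc] using this)
  simpa [transfer] using this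

/-- Copying register `i` to register `o`, with the help of register `w`. -/
def copy (k i o w : ℕ) : Prog Unit :=
  (downLoop k i ((inc k o).bind fun _ => inc k w)).bind fun _ => transfer k w i

theorem reg_copy {i o w : ℕ} (hi : i < k) (ho : o < k) (hw : w < k) (hio : i ≠ o) (hiw : i ≠ w)
    (how : o ≠ w) (ih : ℕ) (σ : ℕ → ℕ) (hσo : σ o = 0) (hσw : σ w = 0) (hm : σ i < 2 ^ m) :
    (copy k i o w).Reg k x m (ih, σ) () (ih, Function.update σ o (σ i)) := by
  -- After `j` rounds the registers `i`, `o`, `w` hold `σ i - j`, `j`, `j`. Reading a register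
  -- destroys it, so the second copy in `w` is moved back to `i` afterwards.
  let τ : ℕ → ℕ → ℕ := fun j => Function.update (Function.update (Function.update σ i (σ i - j))
    o j) w j
  have h1 : (downLoop k i ((inc k o).bind fun _ => inc k w)).Reg k x m (ih, τ 0) () (ih, τ (σ i)) := by
    refine reg_downLoop (n := σ i) hi (fun j => (ih, τ j)) (by simp [τ, hio, hiw]) ?_
    intro j hj
    refine reg_bind (s' := (ih, Function.update (Function.update (Function.update σ i
      (σ i - (j + 1))) o (j + 1)) w j)) (y := ()) ?_ ?_
    · have := reg_inc (x := x) (m := m) ho (s := (ih, Function.update (τ j) i (σ i - (j + 1))))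
        (by simp [τ, how, hio.symm]; omega)
      convert this using 2
      funext r
      simp only [τ, Function.update_apply]
      grind
    · have := reg_inc (x := x) (m := m) hw (s := (ih, Function.update (Function.update
        (Function.update σ i (σ i - (j + 1))) o (j + 1)) w j)) (by simp; omega)
      simpa [τ] using this
  have h2 := reg_transfer (x := x) (m := m) hw hi hiw.symm ih (τ (σ i)) (by simp [τ, hio, hiw, hm])
  have e0 : τ 0 = σ := by
    funext r
    simp only [τ, Function.update_apply]
    grind
  have e1 : Function.update (Function.update (τ (σ i)) w 0) i (τ (σ i) i + τ (σ i) w) =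
      Function.update σ o (σ i) := by
    funext r
    simp only [τ, Function.update_apply]
    grind
  rw [e0] at h1
  rw [e1] at h2
  exact reg_bind h1 h2

/-- Moving the input head to the left end. -/
def rewind : Prog Unit :=
  loop (fun _ : Unit => input fun s =>
    match s with
    | .leftEnd => (.inr (), .stay)
    | _ => (.inl (), .left)) ()

theorem reg_rewind (ih : ℕ) (σ : ℕ → ℕ) : rewind.Reg k x m (ih, σ) () (0, σ) := by
  induction ih with
  | zero =>
    refine reg_loop_exit ?_
    have := reg_input (k := k) (x := x) (m := m) (X := Unit ⊕ Unit) (fun s =>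
      match s with
      | .leftEnd => (.inr (), .stay)
      | _ => (.inl (), .left)) (0, σ)
    simpa [readInput, move] using this
  | succ n IH =>
    intro hn
    refine reg_loop_cons (b := (n, σ)) (s' := ()) ?_ IH hn
    have := reg_input (k := k) (x := x) (m := m) (X := Unit ⊕ Unit) (fun s =>
      match s with
      | .leftEnd => (.inr (), .stay)
      | _ => (.inl (), .left)) (n + 1, σ)
    have hn' : n ≤ x.length + 1 := by simp at hn; omega
    simp only [readInput] at this
    split_ifs at this <;> simpa [move, hn'] using this

theorem exec_input {X : Type} {ih h : ℕ} {t : ℕ → Bool} {cs : List Bool} (f : Sym → X × Dir) (hh : h ≤ m) :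
    (input f).Exec x m ⟨ih, h, t, cs⟩ (f (readInput x ih)).1
      ⟨min (move ih (f (readInput x ih)).2) (x.length + 1), h, t, cs⟩ := by
  have := exec_act (f := fun a s => ((f a).1, (f a).2, s.toBool, Dir.stay)) (x := x)
    (m := m) (A := ⟨ih, h, t, cs⟩) hh hh
  simp only [Mem.act, writeTape_self] at this
  exact this

theorem exec_rewind {ih h : ℕ} {t : ℕ → Bool} {cs : List Bool} (hi : ih ≤ x.length + 1) (hh : h ≤ m) :
    rewind.Exec x m ⟨ih, h, t, cs⟩ () ⟨0, h, t, cs⟩ := by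
  induction ih with
  | zero =>
    refine exec_loop_exit ?_
    have := exec_input (x := x) (ih := 0) (t := t) (cs := cs) (X := Unit ⊕ Unit) (fun s =>
      match s with
      | .leftEnd => (.inr (), .stay)
      | _ => (.inl (), .left)) hh
    simpa [readInput, move] using this
  | succ n IH =>
    refine exec_loop_cons (B := ⟨n, h, t, cs⟩) (s' := ()) ?_ (IH (by omega))
    have := exec_input (x := x) (ih := n + 1) (t := t) (cs := cs) (X := Unit ⊕ Unit) (fun s =>
      match s with
      | .leftEnd => (.inr (), .stay)
      | _ => (.inl (), .left)) hh
    have hn' : n ≤ x.length + 1 := by omega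
    simp only [readInput] at this
    split_ifs at this <;> simpa [move, hn'] using this

end Prog

/-- The code of a symbol. -/
def Sym.code : Sym → ℕ
  | .leftEnd => 0
  | .rightEnd => 1
  | .bit false => 2
  | .bit true => 3

theorem readInput_min (x : List Bool) (p : ℕ) :
    readInput x (min p (x.length + 1)) = readInput x p := by
  rcases le_total p (x.length + 1) with h | h
  · rw [min_eq_left h]
  · rw [min_eq_right h]
    obtain ⟨q, rfl⟩ : ∃ q, p = q + 1 := ⟨p - 1, by omega⟩
    simp only [readInput]
    rw [dif_neg (by omega), dif_neg (by omega)]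

/-! ### Functions computable in linear space -/

/-- The size of the arguments of a function. -/
def size {a : ℕ} (x : List Bool) (v : Fin a → ℕ) : ℕ := x.length + ∑ i, v i + 2

/-- Functions of the input and of numbers that register programs compute with numbers bounded by a
power of the size of the arguments, that is, in linear space. -/
def LinSpace {a : ℕ} (f : List Bool → (Fin a → ℕ) → ℕ) : Prop :=
  ∃ d c : ℕ, (∀ x v, f x v ≤ size x v ^ c) ∧
    ∀ k w (ins : Fin a → ℕ) (out : ℕ), w + d ≤ k → (∀ j, ins j < w) → out < w →
      (∀ j, ins j ≠ out) → ∃ P : Prog Unit, ∀ x m σ, (∀ j ≥ w, σ j = 0) → σ out = 0 →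
        size x (σ ∘ ins) ^ c < 2 ^ m →
        P.Reg k x m (0, σ) () (0, Function.update σ out (f x (σ ∘ ins)))

section

variable {a : ℕ} {x : List Bool} {v : Fin a → ℕ}

theorem two_le_size : 2 ≤ size x v := by unfold size; omega

theorem size_pos : 0 < size x v := by unfold size; omega

theorem size_pow_mono {c d : ℕ} (h : c ≤ d) : size x v ^ c ≤ size x v ^ d :=
  Nat.pow_le_pow_right size_pos h

theorem apply_lt_size (i : Fin a) : v i < size x v := by
  have := Finset.single_le_sum (f := v) (fun _ _ => Nat.zero_le _) (Finset.mem_univ i)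
  unfold size; omega

theorem size_cons (n : ℕ) : size x (Fin.cons n v : Fin (a + 1) → ℕ) = size x v + n := by
  simp only [size, Fin.sum_univ_succ, Fin.cons_zero, Fin.cons_succ]
  omega

theorem lt_two_pow_of_size {c m : ℕ} (hc : 1 ≤ c) (h : size x v ^ c < 2 ^ m) (i : Fin a) :
    v i < 2 ^ m :=
  (apply_lt_size (x := x) i).trans (((Nat.le_self_pow (by omega) _)).trans_lt h)

end

/-! ### Composition and bounded primitive recursion -/

namespace LinSpace

variable {a b : ℕ}

theorem of_eq {f g : List Bool → (Fin a → ℕ) → ℕ} (hf : LinSpace f) (h : ∀ x v, f x v = g x v) :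
    LinSpace g := by
  obtain rfl : f = g := by funext x v; exact h x v
  exact hf

theorem zero : LinSpace (fun _ (_ : Fin a → ℕ) => 0) := by
  refine ⟨0, 1, fun _ _ => Nat.zero_le _, fun k w ins out hk hins hout hne => ⟨pure (), ?_⟩⟩
  intro x m σ _ h0 _
  rw [← h0, Function.update_eq_self]
  exact reg_pure _ _

theorem proj (i : Fin a) : LinSpace (fun _ v => v i) := by
  refine ⟨1, 1, fun x v => by simpa using (apply_lt_size i).le,
    fun k w ins out hk hins hout hne => ⟨copy k (ins i) out w, ?_⟩⟩
  intro x m σ hw h0 hm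
  have := hins i
  exact reg_copy (by omega) (by omega) (by omega) (hne i) (by omega) (by omega) 0 σ h0
    (hw w le_rfl) (lt_two_pow_of_size le_rfl hm i)

theorem succ : LinSpace (fun _ (v : Fin 1 → ℕ) => v 0 + 1) := by
  refine ⟨1, 1, fun x v => by simpa using apply_lt_size 0,
    fun k w ins out hk hins hout hne => ⟨(copy k (ins 0) out w).bind fun _ => inc k out, ?_⟩⟩
  intro x m σ hw h0 hm
  have := hins 0
  refine reg_bind (reg_copy (by omega) (by omega) (by omega) (hne 0) (by omega) (by omega) 0 σ h0
    (hw w le_rfl) (lt_two_pow_of_size le_rfl hm 0)) ?_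
  have h := reg_inc (x := x) (m := m) (k := k) (i := out) (by omega)
    (s := (0, Function.update σ out (σ (ins 0))))
    (by
      simp [size] at hm ⊢; omega)
  simpa using h

/-- The input head goes right as often as a copy of the argument says. It gets stuck on the
right-end marker, which is also what `readInput` shows further out (`readInput_min`). Once the
symbol is in the finite control the head is rewound, as every program expects it at the left end.
The exponent `2` leaves room for the codes up to `3`. -/
theorem inp : LinSpace (fun x (v : Fin 1 → ℕ) => (readInput x (v 0)).code) := by
  refine ⟨2, 2, fun x v => ?_, fun k w ins out hk hins hout hne =>
    ⟨(copy k (ins 0) w (w + 1)).bind fun _ =>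
      (downLoop k w (input fun _ => ((), .right))).bind fun _ =>
      (input fun s => (s, .stay)).bind fun s => rewind.bind fun _ =>
      match s with
      | .leftEnd => pure ()
      | .rightEnd => inc k out
      | .bit false => (inc k out).bind fun _ => inc k out
      | .bit true => (inc k out).bind fun _ => (inc k out).bind fun _ => inc k out, ?_⟩⟩
  · have h1 : (readInput x (v 0)).code ≤ 4 := by
      rcases readInput x (v 0) with _ | _ | _ | _ <;> simp [Sym.code]
    exact h1.trans (Nat.pow_le_pow_left (two_le_size (x := x) (v := v)) 2)
  intro x m σ hw h0 hm
  have h1 := hins 0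
  have h4 : 4 < 2 ^ m :=
    (Nat.pow_le_pow_left (two_le_size (x := x) (v := σ ∘ ins)) 2).trans_lt hm
  refine reg_bind (reg_copy (by omega) (by omega) (by omega) (by omega) (by omega) (by omega) 0 σ
    (hw _ le_rfl) (hw _ (by omega)) (lt_two_pow_of_size (by omega) hm 0)) ?_
  refine reg_bind (y := ()) (s' := (min (σ (ins 0)) (x.length + 1), σ)) ?_ ?_
  · have := reg_downLoop (x := x) (m := m) (k := k) (i := w) (n := σ (ins 0)) (by omega)
      (P := input fun _ => ((), .right))
      (fun j => (min j (x.length + 1), Function.update σ w (σ (ins 0) - j))) (by simp)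
      (fun j hj => by
        have := reg_input (x := x) (m := m) (k := k) (fun _ => ((), Dir.right))
          (min j (x.length + 1), Function.update σ w (σ (ins 0) - (j + 1)))
        simp only [move] at this
        rw [show min (min j (x.length + 1) + 1) (x.length + 1) = min (j + 1) (x.length + 1) by
          omega] at this
        simpa using this)
    simp only [tsub_self, tsub_zero, zero_le, inf_of_le_left] at this
    rw [show Function.update σ w 0 = σ by rw [← hw w le_rfl, Function.update_eq_self]] at this
    exact this
  · have h2 := reg_input (x := x) (m := m) (k := k) (fun s => (s, Dir.stay))
      (min (σ (ins 0)) (x.length + 1), σ)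
    simp only [move, readInput_min, min_assoc, min_self] at h2
    refine reg_bind h2 (reg_bind (reg_rewind _ _) ?_)
    have hi : ∀ n, n < 3 → (inc k out).Reg k x m (0, Function.update σ out n) ()
        (0, Function.update σ out (n + 1)) := by
      intro n hn
      have := reg_inc (x := x) (m := m) (k := k) (i := out) (by omega)
        (s := (0, Function.update σ out n)) (by simp; omega)
      simpa using this
    have h00 : Function.update σ out 0 = σ := by rw [← h0, Function.update_eq_self]
    have hi0 := hi 0 (by omega)
    rw [h00] at hi0
    simp only [Function.comp_apply]
    rcases readInput x (σ (ins 0)) with _ | _ | _ | _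
    · simp only [Sym.code, h00]; exact reg_pure _ _
    · exact hi0
    · exact reg_bind hi0 (hi 1 (by omega))
    · exact reg_bind hi0 (reg_bind (hi 1 (by omega)) (hi 2 (by omega)))

/-- The number of summands is absorbed by `b + 1 ≤ 2 ^ b ≤ size x v ^ b`. -/
theorem size_comp_le {g : Fin b → ℕ} {x : List Bool} {v : Fin a → ℕ} {c : ℕ}
    (h : ∀ i, g i ≤ size x v ^ c) : size x g ≤ size x v ^ (c + 1 + b) := by
  have h1 : ∑ i, g i ≤ b * size x v ^ c := by
    simpa using Finset.sum_le_card_nsmul Finset.univ g _ (fun i _ => h i)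
  have h2 : x.length + 2 ≤ size x v ^ (c + 1) := by
    refine le_trans ?_ (Nat.le_self_pow (by omega) _)
    unfold size; omega
  have h3 : b + 1 ≤ size x v ^ b := (Nat.lt_two_pow_self (n := b)).trans_le
    (Nat.pow_le_pow_left two_le_size b)
  have h4 : b * size x v ^ c ≤ b * size x v ^ (c + 1) :=
    Nat.mul_le_mul_left _ (size_pow_mono (by omega))
  calc size x g ≤ (b + 1) * size x v ^ (c + 1) := by
        rw [add_mul]; unfold size at *; omega
    _ ≤ size x v ^ b * size x v ^ (c + 1) := Nat.mul_le_mul_right _ h3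
    _ = _ := by rw [← pow_add]; congr 1; omega

/-- The values of the inner functions are put into the registers `w, …, w + b - 1`, with scratch
registers from `w + b` on; after the outer program has used them they are cleared. Exponents of the
bounds multiply, so the values stay polynomial in the size. -/
theorem comp {f : List Bool → (Fin b → ℕ) → ℕ} {g : Fin b → List Bool → (Fin a → ℕ) → ℕ}
    (hf : LinSpace f) (hg : ∀ i, LinSpace (g i)) :
    LinSpace (fun x v => f x (fun i => g i x v)) := by
  obtain ⟨df, cf, bf, Pf⟩ := hf
  choose dg cg bg Pg using hg
  obtain ⟨C, hC⟩ : ∃ C, ∀ i, cg i ≤ C := ⟨∑ i, cg i, fun i =>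
    Finset.single_le_sum (f := cg) (fun _ _ => Nat.zero_le _) (Finset.mem_univ i)⟩
  obtain ⟨D, hD⟩ : ∃ D, ∀ i, dg i ≤ D := ⟨∑ i, dg i, fun i =>
    Finset.single_le_sum (f := dg) (fun _ _ => Nat.zero_le _) (Finset.mem_univ i)⟩
  have hgs : ∀ x (v : Fin a → ℕ), size x (fun i => g i x v) ≤ size x v ^ (C + 1 + b) :=
    fun x v => size_comp_le fun i => (bg i x v).trans (size_pow_mono (hC i))
  have hfs : ∀ x (v : Fin a → ℕ),
      size x (fun i => g i x v) ^ cf ≤ size x v ^ ((C + 1 + b) * cf + C) := fun x v =>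
    (Nat.pow_le_pow_left (hgs x v) cf).trans
      ((pow_mul _ _ _).symm.le.trans (size_pow_mono (by omega)))
  refine ⟨b + df + D, (C + 1 + b) * cf + C, fun x v => (bf _ _).trans (hfs x v), ?_⟩
  intro k w ins out hk hins hout hne
  have hPg : ∀ i : Fin b, ∃ P : Prog Unit, ∀ x m σ, (∀ j ≥ w + b, σ j = 0) → σ (w + i) = 0 →
      size x (σ ∘ ins) ^ cg i < 2 ^ m →
      P.Reg k x m (0, σ) () (0, Function.update σ (w + i) (g i x (σ ∘ ins))) := fun i =>
    Pg i k (w + b) ins (w + i) (by have := hD i; omega) (fun j => by have := hins j; omega)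
      (by omega) (fun j => by have := hins j; omega)
  choose G hG using hPg
  -- The registers after `n` inner functions have been evaluated.
  let τ : List Bool → (ℕ → ℕ) → ℕ → ℕ → ℕ := fun x σ n r =>
    if h : w ≤ r ∧ r < w + n ∧ r < w + b then g ⟨r - w, by omega⟩ x (σ ∘ ins) else σ r
  have hτ : ∀ x σ n, τ x σ n ∘ ins = σ ∘ ins := by
    intro x σ n
    funext j
    have := hins j
    simp only [Function.comp_apply, τ]
    rw [dif_neg (by omega)]
  have h1 : ∀ n ≤ b, ∃ P : Prog Unit, ∀ x m σ, (∀ j ≥ w, σ j = 0) →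
      size x (σ ∘ ins) ^ ((C + 1 + b) * cf + C) < 2 ^ m →
      P.Reg k x m (0, σ) () (0, τ x σ n) := by
    intro n hn
    induction n with
    | zero =>
      refine ⟨pure (), fun x m σ _ _ => ?_⟩
      have : τ x σ 0 = σ := by funext r; simp only [τ]; rw [dif_neg (by omega)]
      rw [this]; exact reg_pure _ _
    | succ n IH =>
      obtain ⟨P, hP⟩ := IH (by omega)
      refine ⟨P.bind fun _ => G ⟨n, hn⟩, fun x m σ hw hm => reg_bind (hP x m σ hw hm) ?_⟩
      have := hG ⟨n, hn⟩ x m (τ x σ n) (fun j hj => by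
          simp only [τ]; rw [dif_neg (by omega)]; exact hw j (by omega))
        (by simp only [τ]; rw [dif_neg (by omega)]; exact hw _ (by omega))
        (by rw [hτ]; exact (size_pow_mono (by have := hC ⟨n, hn⟩; omega)).trans_lt hm)
      convert this using 2
      rw [hτ]
      funext r
      by_cases hr : r = w + n
      · subst hr
        simp only [τ, Function.update_self]
        rw [dif_pos (by omega)]
        simp
      · rw [Function.update_of_ne hr]
        simp only [τ]
        by_cases h : w ≤ r ∧ r < w + n ∧ r < w + b
        · rw [dif_pos h, dif_pos (by omega)]
        · rw [dif_neg h, dif_neg (by omega)]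
  have h3 : ∀ n ≤ b, ∃ P : Prog Unit, ∀ x m (σ : ℕ → ℕ),
      P.Reg k x m (0, σ) () (0, fun r => if w ≤ r ∧ r < w + n then 0 else σ r) := by
    intro n hn
    induction n with
    | zero =>
      refine ⟨pure (), fun x m σ => ?_⟩
      have : (fun r => if w ≤ r ∧ r < w + 0 then 0 else σ r) = σ := by
        funext r; rw [if_neg (by omega)]
      rw [this]; exact reg_pure _ _
    | succ n IH =>
      obtain ⟨P, hP⟩ := IH (by omega)
      refine ⟨P.bind fun _ => clear k (w + n), fun x m σ => reg_bind (hP x m σ) ?_⟩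
      convert reg_clear (x := x) (m := m) (k := k) (i := w + n) (by omega) 0 _ using 2
      funext r
      simp only [Function.update_apply]
      grind
  obtain ⟨P1, hP1⟩ := h1 b le_rfl
  obtain ⟨P3, hP3⟩ := h3 b le_rfl
  obtain ⟨P2, hP2⟩ := Pf k (w + b) (fun i => w + i) out (by omega) (fun j => by omega) (by omega)
    (fun j => by omega)
  refine ⟨P1.bind fun _ => P2.bind fun _ => P3, fun x m σ hw h0 hm => ?_⟩
  have hτg : (τ x σ b ∘ fun i : Fin b => w + (i : ℕ)) = fun i => g i x (σ ∘ ins) := by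
    funext i
    simp only [Function.comp_apply, τ]
    rw [dif_pos (by omega)]
    simp
  refine reg_bind (hP1 x m σ hw hm) (reg_bind (hP2 x m (τ x σ b) ?_ ?_ ?_) ?_)
  · intro j hj; simp only [τ]; rw [dif_neg (by omega)]; exact hw j (by omega)
  · simp only [τ]; rw [dif_neg (by omega)]; exact h0
  · rw [hτg]; exact (hfs x (σ ∘ ins)).trans_lt hm
  · rw [hτg]
    convert hP3 x m _ using 2
    funext r
    by_cases hr : r = out
    · subst hr
      rw [if_neg (by omega), Function.update_self, Function.update_self]
    · rw [Function.update_of_ne hr, Function.update_of_ne hr]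
      split_ifs with h
      · exact hw r h.1
      · simp only [τ]; rw [dif_neg (by omega)]

/-- A loop with remaining rounds in `w` and index in `w + 1`. The next value is formed in `w + 2`,
because the old one in `out` is an argument of `g`, and is then transferred. The bound `he` cannot
be dispensed with: unrestricted primitive recursion leaves polynomial growth. -/
theorem prec {f : List Bool → (Fin a → ℕ) → ℕ} {g : List Bool → (Fin (a + 2) → ℕ) → ℕ}
    (hf : LinSpace f) (hg : LinSpace g) {e : ℕ}
    (he : ∀ x (n : ℕ) (v : Fin a → ℕ), Nat.rec (motive := fun _ => ℕ) (f x v)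
      (fun i r => g x (Fin.cons i (Fin.cons r v))) n ≤ (size x v + n) ^ e) :
    LinSpace (fun x (v : Fin (a + 1) → ℕ) => Nat.rec (motive := fun _ => ℕ) (f x (Fin.tail v))
      (fun i r => g x (Fin.cons i (Fin.cons r (Fin.tail v)))) (v 0)) := by
  obtain ⟨df, cf, bf, Pf⟩ := hf
  obtain ⟨dg, cg, bg, Pg⟩ := hg
  let H : List Bool → (Fin a → ℕ) → ℕ → ℕ := fun x v n => Nat.rec (motive := fun _ => ℕ) (f x v)
      (fun i r => g x (Fin.cons i (Fin.cons r v))) n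
  have hsz : ∀ x (v : Fin (a + 1) → ℕ), size x v = size x (Fin.tail v) + v 0 := by
    intro x v
    simp only [size, Fin.sum_univ_succ, Fin.tail]
    omega
  -- The summands of the exponent provide room for `f`, for the values of the recursion, for `g` at
  -- arguments of size at most `size x v ^ (e + 2)`, and for the counter.
  refine ⟨3 + df + dg, cf + e + (e + 2) * cg + 1, fun x v => ?_, ?_⟩
  · refine (he x (v 0) (Fin.tail v)).trans ?_
    rw [← hsz]
    exact size_pow_mono (by omega)
  intro k w ins out hk hins hout hne
  obtain ⟨F, hF⟩ := Pf k (w + 3) (Fin.tail ins) out (by omega)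
    (fun j => by have := hins j.succ; simp only [Fin.tail]; omega) (by omega) (fun j => hne j.succ)
  obtain ⟨G, hG⟩ := Pg k (w + 3) (Fin.cons (w + 1) (Fin.cons out (Fin.tail ins))) (w + 2) (by omega)
    (by
      intro j
      refine Fin.cases (by simp) (fun j => ?_) j
      refine Fin.cases (by simp; omega) (fun j => ?_) j
      have := hins j.succ
      simp only [Fin.cons_succ, Fin.tail]; omega) (by omega)
    (by
      intro j
      refine Fin.cases (by simp) (fun j => ?_) j
      refine Fin.cases (by simp; omega) (fun j => ?_) j
      have := hins j.succ
      simp only [Fin.cons_succ, Fin.tail]; omega)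
  refine ⟨F.bind fun _ => (copy k (ins 0) w (w + 1)).bind fun _ =>
    (downLoop k w (G.bind fun _ => (clear k out).bind fun _ => (transfer k (w + 2) out).bind
      fun _ => inc k (w + 1))).bind fun _ => clear k (w + 1), ?_⟩
  intro x m σ hw h0 hm
  have hi0 := hins 0
  have hi0' := hne 0
  set n := σ (ins 0) with hn
  set v := σ ∘ ins with hv
  have hv0 : v 0 = n := rfl
  set u := Fin.tail v with hu
  have hu' : σ ∘ Fin.tail ins = u := rfl
  have hsv : size x v = size x u + n := hsz x v
  have hH : ∀ j ≤ n, H x u j ≤ size x v ^ e := fun j hj => (he x j u).trans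
    (Nat.pow_le_pow_left (by omega) e)
  have hHm : ∀ j ≤ n, H x u j < 2 ^ m := fun j hj =>
    ((hH j hj).trans (size_pow_mono (by omega))).trans_lt hm
  -- The registers after `j` rounds.
  let τ : ℕ → ℕ → ℕ := fun j => Function.update (Function.update (Function.update σ out (H x u j))
    w (n - j)) (w + 1) j
  have hnm : n + 1 < 2 ^ m := by
    refine lt_of_le_of_lt ?_ hm
    refine (apply_lt_size (x := x) (v := v) 0).trans_le (Nat.le_self_pow (by omega) _)
  have s1 := hF x m σ (fun j hj => hw j (by omega)) h0 (by
    rw [hu']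
    refine lt_of_le_of_lt (Nat.pow_le_pow_left (n := size x u) (m := size x v) ?_ cf)
      ((size_pow_mono (by omega)).trans_lt hm)
    omega)
  rw [hu'] at s1
  refine reg_bind s1 ?_
  have s2 := reg_copy (x := x) (m := m) (k := k) (i := ins 0) (o := w) (w := w + 1) (by omega)
    (by omega) (by omega) (by omega) (by omega) (by omega) 0 (Function.update σ out (f x u))
    (by rw [Function.update_of_ne (by omega)]; exact hw w le_rfl)
    (by rw [Function.update_of_ne (by omega)]; exact hw _ (by omega))
    (by rw [Function.update_of_ne hi0']; omega)
  rw [Function.update_of_ne hi0'] at s2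
  refine reg_bind s2 ?_
  have s3 : (downLoop k w (G.bind fun _ => (clear k out).bind fun _ =>
      (transfer k (w + 2) out).bind fun _ => inc k (w + 1))).Reg k x m (0, τ 0) () (0, τ n) := by
    refine reg_downLoop (n := n) (by omega) (fun j => (0, τ j)) (fun j hj => by simp [τ]) ?_
    intro j hj
    have hins' : Function.update (τ j) w (n - (j + 1)) ∘
        (Fin.cons (w + 1) (Fin.cons out (Fin.tail ins)) : Fin (a + 2) → ℕ) =
        Fin.cons j (Fin.cons (H x u j) u) := by
      funext i
      refine Fin.cases (by simp [τ]) (fun i => ?_) i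
      refine Fin.cases ?_ (fun i => ?_) i
      · simp only [Function.comp_apply, Fin.cons_succ, Fin.cons_zero, τ, Function.update_apply]
        grind
      · have := hins i.succ
        have := hne i.succ
        simp only [Function.comp_apply, Fin.cons_succ, τ, Fin.tail, Function.update_apply, u, v]
        grind
    have t1 := hG x m (Function.update (τ j) w (n - (j + 1))) (fun r hr => by
        simp only [τ, Function.update_apply]
        have := hw r (by omega)
        grind)
      (by
        simp only [τ, Function.update_apply]
        have := hw (w + 2) (by omega)
        grind) (by
        rw [hins']
        have hb : size x (Fin.cons j (Fin.cons (H x u j) u) : Fin (a + 2) → ℕ) ≤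
            size x v ^ (e + 2) := by
          have h1 := hH j hj.le
          have h2 : size x v ≤ size x v ^ (e + 1) := Nat.le_self_pow (by omega) _
          have h3 : size x v ^ e ≤ size x v ^ (e + 1) := size_pow_mono (by omega)
          have h4 : size x v ^ (e + 1) * 2 ≤ size x v ^ (e + 2) := by
            rw [pow_succ _ (e + 1)]; exact Nat.mul_le_mul_left _ two_le_size
          rw [size_cons, size_cons]
          omega
        refine lt_of_le_of_lt (Nat.pow_le_pow_left hb cg) ?_
        rw [← pow_mul]
        exact (size_pow_mono (by omega)).trans_lt hm)
    rw [hins'] at t1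
    have hstep : g x (Fin.cons j (Fin.cons (H x u j) u)) = H x u (j + 1) := rfl
    rw [hstep] at t1
    refine reg_bind t1 (reg_bind (reg_clear (by omega) _ _) (reg_bind (y := ())
      (s' := (0, Function.update (τ (j + 1)) (w + 1) j)) ?_ ?_))
    · have h1 := hHm (j + 1) (by omega)
      convert reg_transfer (x := x) (m := m) (k := k) (i := w + 2) (o := out) (by omega)
        (by omega) (by omega) 0 _ ?_ using 2
      · funext r
        have := hw (w + 2) (by omega)
        simp only [τ, Function.update_apply]
        grind
      · simp only [Function.update_apply]
        grind
    · have := reg_inc (x := x) (m := m) (k := k) (i := w + 1) (by omega)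
        (s := (0, Function.update (τ (j + 1)) (w + 1) j)) (by
          dsimp only; rw [Function.update_self]; omega)
      dsimp only at this
      rw [Function.update_self] at this
      simp only [τ, Function.update_idem] at this ⊢
      exact this
  have e0 : τ 0 = Function.update (Function.update σ out (f x u)) w n := by
    funext r
    have := hw (w + 1) (by omega)
    have : H x u 0 = f x u := rfl
    simp only [τ, Function.update_apply]
    grind
  rw [e0] at s3
  refine reg_bind s3 ?_
  convert reg_clear (x := x) (m := m) (k := k) (i := w + 1) (by omega) 0 (τ n) using 2
  funext r
  have := hw w le_rfl
  have := hw (w + 1) (by omega)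
  change Function.update σ out (H x u n) r = _
  simp only [τ, Function.update_apply]
  grind

end LinSpace

end Catalytic

/-! ### Arithmetic in linear space -/

namespace Catalytic

open Machine

namespace LinSpace

variable {a b : ℕ} {f g h f' g' n : List Bool → (Fin a → ℕ) → ℕ}

theorem comp₁ {F : ℕ → ℕ} (hF : LinSpace fun _ (v : Fin 1 → ℕ) => F (v 0)) (hf : LinSpace f) :
    LinSpace fun x v => F (f x v) :=
  comp (g := ![f]) hF (fun i => by fin_cases i; exact hf)

theorem comp₂ {F : ℕ → ℕ → ℕ} (hF : LinSpace fun _ (v : Fin 2 → ℕ) => F (v 0) (v 1))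
    (hf : LinSpace f) (hg : LinSpace g) : LinSpace fun x v => F (f x v) (g x v) :=
  comp (g := ![f, g]) hF (fun i => by fin_cases i; exacts [hf, hg])

theorem add_one (hf : LinSpace f) : LinSpace fun x v => f x v + 1 :=
  comp₁ succ hf

theorem const (n : ℕ) : LinSpace fun _ (_ : Fin a → ℕ) => n := by
  induction n with
  | zero => exact zero
  | succ n ih => exact ih.add_one

theorem bound (hf : LinSpace f) : ∃ c, ∀ x v, f x v ≤ size x v ^ c := by
  obtain ⟨_, c, h, _⟩ := hf
  exact ⟨c, h⟩

/-- Primitive recursion in general form. -/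
theorem primrec {g : List Bool → (Fin (a + 2) → ℕ) → ℕ} (hn : LinSpace n)
    (hf : LinSpace f) (hg : LinSpace g) {e : ℕ}
    (he : ∀ x (n : ℕ) (v : Fin a → ℕ), Nat.rec (motive := fun _ => ℕ) (f x v)
      (fun i r => g x (Fin.cons i (Fin.cons r v))) n ≤ (size x v + n) ^ e) :
    LinSpace fun x v => Nat.rec (motive := fun _ => ℕ) (f x v)
      (fun i r => g x (Fin.cons i (Fin.cons r v))) (n x v) :=
  of_eq (comp (prec hf hg he) (g := Fin.cons n fun i _ v => v i) (by
    intro i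
    refine Fin.cases ?_ (fun i => ?_) i
    · exact hn
    · exact proj i)) (by intros; rfl)

/-- Recursion on the second summand. In the step function of a recursion, coordinate `0` is the
index, coordinate `1` the previous value, and the parameters follow. -/
theorem add (hf : LinSpace f) (hg : LinSpace g) : LinSpace fun x v => f x v + g x v := by
  refine comp₂ (F := fun m n => m + n) ?_ hf hg
  have key : ∀ (x : List Bool) (n : ℕ) (v : Fin 2 → ℕ), Nat.rec (motive := fun _ => ℕ) (v 0)
      (fun i r => (Fin.cons i (Fin.cons r v) : Fin 4 → ℕ) 1 + 1) n = v 0 + n := by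
    intro x n v
    induction n with
    | zero => rfl
    | succ n ih => simp only [ih]; rfl
  refine of_eq (primrec (proj 1) (proj 0) (proj 1).add_one (e := 1) fun x n v => ?_)
    fun x v => key x _ v
  rw [key x, pow_one]
  have := apply_lt_size (x := x) (v := v) 0
  omega

theorem mul (hf : LinSpace f) (hg : LinSpace g) : LinSpace fun x v => f x v * g x v := by
  refine comp₂ (F := fun m n => m * n) ?_ hf hg
  have key : ∀ (x : List Bool) (n : ℕ) (v : Fin 2 → ℕ), Nat.rec (motive := fun _ => ℕ) 0
      (fun i r => (Fin.cons i (Fin.cons r v) : Fin 4 → ℕ) 1 + (Fin.cons i (Fin.cons r v) : Fin 4 → ℕ) 2) n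
        = v 0 * n := by
    intro x n v
    induction n with
    | zero => rfl
    | succ n ih => simp only [ih]; rfl
  refine of_eq (primrec (proj 1) zero ((proj 1).add (proj 2)) (e := 2) fun x n v => ?_)
    fun x v => key x _ v
  rw [key x, sq]
  have := apply_lt_size (x := x) (v := v) 0
  exact Nat.mul_le_mul (by omega) (by omega)

theorem pred (hf : LinSpace f) : LinSpace fun x v => f x v - 1 := by
  refine comp₁ (F := fun m => m - 1) ?_ hf
  have key : ∀ (x : List Bool) (n : ℕ) (v : Fin 1 → ℕ), Nat.rec (motive := fun _ => ℕ) 0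
      (fun i r => (Fin.cons i (Fin.cons r v) : Fin 3 → ℕ) 0) n = n - 1 := by
    intro x n v
    cases n <;> rfl
  refine of_eq (primrec (proj 0) zero (proj 0) (e := 1) fun x n v => ?_) fun x v => key x _ v
  rw [key x, pow_one]; omega

theorem sub (hf : LinSpace f) (hg : LinSpace g) : LinSpace fun x v => f x v - g x v := by
  refine comp₂ (F := fun m n => m - n) ?_ hf hg
  have key : ∀ (x : List Bool) (n : ℕ) (v : Fin 2 → ℕ), Nat.rec (motive := fun _ => ℕ) (v 0)
      (fun i r => (Fin.cons i (Fin.cons r v) : Fin 4 → ℕ) 1 - 1) n = v 0 - n := by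
    intro x n v
    induction n with
    | zero => rfl
    | succ n ih => simp only [ih]; rfl
  refine of_eq (primrec (proj 1) (proj 0) (proj 1).pred (e := 1) fun x n v => ?_)
    fun x v => key x _ v
  rw [key x, pow_one]
  have := apply_lt_size (x := x) (v := v) 0
  omega

/-- Recursion up to `f x v` with start value `g` and a step that ignores the previous value and
returns `h`. -/
theorem ite_zero (hf : LinSpace f) (hg : LinSpace g) (hh : LinSpace h) :
    LinSpace fun x v => if f x v = 0 then g x v else h x v := by
  obtain ⟨cg, hcg⟩ := hg.bound
  obtain ⟨ch, hch⟩ := hh.bound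
  have h' : LinSpace fun x (v : Fin (a + 2) → ℕ) => h x (fun i => v i.succ.succ) :=
    comp hh fun i => proj i.succ.succ
  have key : ∀ (x : List Bool) (n : ℕ) (v : Fin a → ℕ), Nat.rec (motive := fun _ => ℕ) (g x v)
      (fun i r => h x (fun j => (Fin.cons i (Fin.cons r v) : Fin (a + 2) → ℕ) j.succ.succ)) n =
      if n = 0 then g x v else h x v := by
    intro x n v
    cases n <;> rfl
  refine of_eq (primrec hf hg h' (e := cg + ch) fun x n v => ?_) fun x v => key x _ v
  rw [key x]
  refine le_trans ?_ (Nat.pow_le_pow_left (Nat.le_add_right (size x v) n) _)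
  split_ifs
  · exact (hcg x v).trans (size_pow_mono (by omega))
  · exact (hch x v).trans (size_pow_mono (by omega))

theorem ite_le (hf : LinSpace f) (hg : LinSpace g) (hf' : LinSpace f') (hg' : LinSpace g') :
    LinSpace fun x v => if f x v ≤ g x v then f' x v else g' x v :=
  of_eq (ite_zero (hf.sub hg) hf' hg') fun x v => by simp only [Nat.sub_eq_zero_iff_le]

theorem ite_lt (hf : LinSpace f) (hg : LinSpace g) (hf' : LinSpace f') (hg' : LinSpace g') :
    LinSpace fun x v => if f x v < g x v then f' x v else g' x v :=
  ite_le hf.add_one hg hf' hg'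

theorem ite_eq (hf : LinSpace f) (hg : LinSpace g) (hf' : LinSpace f') (hg' : LinSpace g') :
    LinSpace fun x v => if f x v = g x v then f' x v else g' x v :=
  of_eq (ite_zero ((hf.sub hg).add (hg.sub hf)) hf' hg') fun x v => by
    simp only [show f x v - g x v + (g x v - f x v) = 0 ↔ f x v = g x v by omega]

theorem min (hf : LinSpace f) (hg : LinSpace g) : LinSpace fun x v => Min.min (f x v) (g x v) :=
  of_eq (ite_le hf hg hf hg) fun x v => by rw [min_def]

theorem pow_const (hf : LinSpace f) (c : ℕ) : LinSpace fun x v => f x v ^ c := by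
  induction c with
  | zero => exact of_eq (const 1) (by simp)
  | succ c ih => exact of_eq (ih.mul hf) (by simp [pow_succ])

theorem sum {g : List Bool → (Fin (a + 1) → ℕ) → ℕ} (hn : LinSpace n) (hg : LinSpace g) :
    LinSpace fun x v => ∑ i ∈ Finset.range (n x v), g x (Fin.cons i v) := by
  obtain ⟨cg, hcg⟩ := hg.bound
  have h' : LinSpace fun x (v : Fin (a + 2) → ℕ) =>
      v 1 + g x (Fin.cons (v 0) fun i => v i.succ.succ) := by
    refine (proj 1).add (of_eq (comp hg (g := Fin.cons (fun _ v => v 0)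
      fun i _ v => v i.succ.succ) ?_) (g := fun x (v : Fin (a + 2) → ℕ) =>
      g x (Fin.cons (v 0) fun i => v i.succ.succ)) ?_)
    · intro i
      refine Fin.cases ?_ (fun i => ?_) i
      · exact proj 0
      · exact proj i.succ.succ
    · intro x v
      congr 1
      funext i
      refine Fin.cases ?_ (fun i => ?_) i <;> rfl
  have key : ∀ (x : List Bool) (n : ℕ) (v : Fin a → ℕ), Nat.rec (motive := fun _ => ℕ) 0
      (fun i r => (Fin.cons i (Fin.cons r v) : Fin (a + 2) → ℕ) 1 +
        g x (Fin.cons ((Fin.cons i (Fin.cons r v) : Fin (a + 2) → ℕ) 0)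
          fun j => (Fin.cons i (Fin.cons r v) : Fin (a + 2) → ℕ) j.succ.succ)) n =
      ∑ i ∈ Finset.range n, g x (Fin.cons i v) := by
    intro x n v
    induction n with
    | zero => rfl
    | succ n ih => rw [Finset.sum_range_succ, ← ih]; rfl
  refine of_eq (primrec hn zero h' (e := cg + 1) fun x n v => ?_) fun x v => key x _ v
  rw [key x]
  calc ∑ i ∈ Finset.range n, g x (Fin.cons i v) ≤ ∑ i ∈ Finset.range n, (size x v + n) ^ cg := by
        refine Finset.sum_le_sum fun i hi => (hcg _ _).trans (Nat.pow_le_pow_left ?_ _)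
        rw [size_cons]
        have := Finset.mem_range.1 hi
        omega
    _ = n * (size x v + n) ^ cg := by simp
    _ ≤ (size x v + n) ^ (cg + 1) := by
        rw [pow_succ, mul_comm]
        exact Nat.mul_le_mul_left _ (by omega)

/-- Iteration with values cut off at a bound. -/
theorem iterate {g : List Bool → (Fin (a + 1) → ℕ) → ℕ} (hn : LinSpace n) (hf : LinSpace f)
    (hg : LinSpace g) (hh : LinSpace h) : LinSpace fun x v =>
      (fun s => Min.min (h x v) (g x (Fin.cons s v)))^[n x v] (f x v) := by
  obtain ⟨cf, hcf⟩ := hf.bound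
  obtain ⟨ch, hch⟩ := hh.bound
  have h' : LinSpace fun x (v : Fin (a + 2) → ℕ) =>
      Min.min (h x fun i => v i.succ.succ) (g x (Fin.cons (v 1) fun i => v i.succ.succ)) := by
    refine (comp hh fun i => proj i.succ.succ).min (of_eq (comp hg (g := Fin.cons (fun _ v => v 1)
      fun i _ v => v i.succ.succ) ?_) (g := fun x (v : Fin (a + 2) → ℕ) =>
      g x (Fin.cons (v 1) fun i => v i.succ.succ)) ?_)
    · intro i
      refine Fin.cases ?_ (fun i => ?_) i
      · exact proj 1
      · exact proj i.succ.succ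
    · intro x v
      congr 1
      funext i
      refine Fin.cases ?_ (fun i => ?_) i <;> rfl
  have key : ∀ (x : List Bool) (n : ℕ) (v : Fin a → ℕ), Nat.rec (motive := fun _ => ℕ) (f x v)
      (fun i r => Min.min (h x fun j => (Fin.cons i (Fin.cons r v) : Fin (a + 2) → ℕ) j.succ.succ)
        (g x (Fin.cons ((Fin.cons i (Fin.cons r v) : Fin (a + 2) → ℕ) 1)
          fun j => (Fin.cons i (Fin.cons r v) : Fin (a + 2) → ℕ) j.succ.succ))) n =
      (fun s => Min.min (h x v) (g x (Fin.cons s v)))^[n] (f x v) := by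
    intro x n v
    induction n with
    | zero => rfl
    | succ n ih => rw [Function.iterate_succ_apply', ← ih]; rfl
  -- The cut-off supplies the bound that recursion needs: every value after the first is at most
  -- `h`.
  refine of_eq (primrec hn hf h' (e := cf + ch) fun x n v => ?_) fun x v => key x _ v
  rw [key x]
  refine le_trans ?_ (Nat.pow_le_pow_left (Nat.le_add_right (size x v) n) _)
  cases n with
  | zero => exact (hcf x v).trans (size_pow_mono (by omega))
  | succ n =>
    rw [Function.iterate_succ_apply']
    exact (min_le_left _ _).trans ((hch x v).trans (size_pow_mono (by omega)))

/-- The quotient counts the `i` with `(i + 1) * n ≤ m`; all of them are below `m` if `n` is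
positive. -/
theorem div (hf : LinSpace f) (hg : LinSpace g) : LinSpace fun x v => f x v / g x v := by
  refine comp₂ (F := fun m n => m / n) ?_ hf hg
  have hs : LinSpace fun _ (v : Fin 2 → ℕ) => ∑ i ∈ Finset.range (v 0),
      if ((Fin.cons i v : Fin 3 → ℕ) 0 + 1) * (Fin.cons i v : Fin 3 → ℕ) 2 ≤
        (Fin.cons i v : Fin 3 → ℕ) 1 then 1 else 0 :=
    sum (proj 0) (g := fun _ v => if (v 0 + 1) * v 2 ≤ v 1 then 1 else 0)
      (ite_le ((proj 0).add_one.mul (proj 2)) (proj 1) (const 1) zero)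
  refine of_eq (ite_zero (proj 1) zero hs) fun _ v => ?_
  change (if v 1 = 0 then 0 else ∑ i ∈ Finset.range (v 0), if (i + 1) * v 1 ≤ v 0 then 1 else 0) = _
  split_ifs with h0
  · simp [h0]
  · rw [← Finset.card_filter]
    have : (Finset.range (v 0)).filter (fun i => (i + 1) * v 1 ≤ v 0) =
        Finset.range (v 0 / v 1) := by
      ext i
      rw [Finset.mem_filter, Finset.mem_range, Finset.mem_range,
        ← Nat.le_div_iff_mul_le (by omega)]
      have := Nat.div_le_self (v 0) (v 1)
      omega
    rw [this, Finset.card_range]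

theorem mod (hf : LinSpace f) (hg : LinSpace g) : LinSpace fun x v => f x v % g x v :=
  of_eq (hf.sub (hg.mul (hf.div hg))) fun x v => by rw [Nat.mod_eq_sub]

/-- Powers cut off at a bound. -/
theorem min_pow (hf : LinSpace f) (hg : LinSpace g) (hh : LinSpace h) :
    LinSpace fun x v => Min.min (h x v) (f x v ^ g x v) := by
  -- The iteration starts at `1`, which may exceed the bound; for this reason the minimum is taken
  -- once more at the end.
  have h1 : LinSpace fun x v => (fun s => Min.min (h x v) (s * f x v))^[g x v] 1 := by
    refine iterate (g := fun x v => v 0 * f x (fun i => v i.succ)) hg (const 1) ?_ hh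
    exact (proj 0).mul (comp hf fun i => proj i.succ)
  refine of_eq (h1.min hh) fun x v => ?_
  generalize f x v = b
  generalize g x v = e
  generalize h x v = z
  rw [min_comm z]
  induction e with
  | zero => simp
  | succ e ih =>
    rw [Function.iterate_succ_apply', pow_succ]
    set s := (fun s => Min.min z (s * b))^[e] 1
    rcases Nat.eq_zero_or_pos b with rfl | hb
    · simp
    have h2 : s ≤ s * b := Nat.le_mul_of_pos_right _ hb
    have h3 : b ^ e ≤ b ^ e * b := Nat.le_mul_of_pos_right _ hb
    rcases le_or_gt z (b ^ e) with h | h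
    · omega
    · rw [show s = b ^ e by omega]
      omega

/-- Functions with finite support. -/
theorem table {t : ℕ → ℕ} {B : ℕ} (ht : ∀ n ≥ B, t n = 0) (hf : LinSpace f) :
    LinSpace fun x v => t (f x v) := by
  have h1 : ∀ C, LinSpace fun x v => if f x v < C then t (f x v) else 0 := by
    intro C
    induction C with
    | zero => exact of_eq zero fun x v => by simp
    | succ C ih =>
      refine of_eq (ite_eq hf (const C) (const (t C)) ih) fun x v => ?_
      rcases lt_trichotomy (f x v) C with h | h | h
      · rw [if_neg h.ne, if_pos h, if_pos (by omega)]
      · rw [if_pos h, if_pos (by omega), h]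
      · rw [if_neg h.ne', if_neg (by omega), if_neg (by omega)]
  refine of_eq (h1 B) fun x v => ?_
  split_ifs with h
  · rfl
  · exact (ht _ (by omega)).symm

theorem input (hf : LinSpace f) : LinSpace fun x v => (readInput x (f x v)).code :=
  comp (g := ![f]) inp (fun i => by fin_cases i; exact hf)

end LinSpace

end Catalytic

namespace Catalytic

/-! ### Evaluating a recursion with an explicit stack -/

/-- The data of a recursion in which level `i + 1` is a fold over `M` calls of level `i`, with the
bounds `K` for all values and `Z` for codes of states. -/
structure Recursion where
  base : ℕ → ℕ
  arg : ℕ → ℕ → ℕ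
  comb : ℕ → ℕ → ℕ → ℕ → ℕ
  out : ℕ → ℕ
  M : ℕ
  T : ℕ
  K : ℕ
  Z : ℕ

namespace Recursion

/-- The fold over the values `r 0, r 1, …`. -/
def fold (P : Recursion) (y : ℕ) (r : ℕ → ℕ) : ℕ → ℕ
  | 0 => 0
  | e + 1 => P.comb y e (P.fold y r e) (r e)

/-- The function defined by the recursion. -/
def value (P : Recursion) : ℕ → ℕ → ℕ
  | 0, y => P.base y
  | i + 1, y => P.out (P.fold y (fun e => value P i (P.arg y e)) P.M)

/-- The code of a state: a stack, an argument or result, a level, and a mode. -/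
def code (P : Recursion) (st val i md : ℕ) : ℕ := ((st * P.K + val) * P.K + i) * 2 + md

/-- Pushing a frame. -/
def push (P : Recursion) (st y e acc : ℕ) : ℕ := ((st * P.K + y) * P.K + e) * P.K + acc

/-- One step of the evaluation on decoded states. Mode `0` is a call, mode `1` a return. -/
def stepAux (P : Recursion) (st val i md : ℕ) : ℕ :=
  if md = 0 then
    if i = 0 then P.code st (P.base val) 0 1
    else P.code (P.push st val 0 0) (P.arg val 0) (i - 1) 0
  else
    if i = P.T then P.code st val i 1
    else if st / P.K % P.K + 1 < P.M then
      P.code (P.push (st / P.K / P.K / P.K) (st / P.K / P.K % P.K) (st / P.K % P.K + 1)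
        (P.comb (st / P.K / P.K % P.K) (st / P.K % P.K) (st % P.K) val))
        (P.arg (st / P.K / P.K % P.K) (st / P.K % P.K + 1)) i 0
    else P.code (st / P.K / P.K / P.K)
      (P.out (P.comb (st / P.K / P.K % P.K) (st / P.K % P.K) (st % P.K) val)) (i + 1) 1

/-- One step of the evaluation. -/
def step (P : Recursion) (s : ℕ) : ℕ :=
  P.stepAux (s / 2 / P.K / P.K) (s / 2 / P.K % P.K) (s / 2 % P.K) (s % 2)

/-- The result of the evaluation. -/
def result (P : Recursion) (y : ℕ) : ℕ :=
  (fun s => min P.Z (P.step s))^[P.Z] (P.code 0 y P.T 0) / 2 / P.K % P.K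

/-- The time for the evaluation of level `i`. -/
def time (P : Recursion) : ℕ → ℕ
  | 0 => 1
  | i + 1 => 1 + P.M * (time P i + 1)

/-- The conditions under which the evaluation is correct for arguments below `Y`. -/
structure Good (P : Recursion) (Y : ℕ) : Prop where
  hY : Y ≤ P.K
  hM : 2 * P.M + 1 ≤ P.K
  hM0 : 0 < P.M
  hT : P.T < P.K
  hZ : P.K ^ (3 * P.T + 3) ≤ P.Z
  arg_lt : ∀ y < Y, ∀ e < P.M, P.arg y e < Y
  value_lt : ∀ i y, y < Y → P.value i y < P.K
  fold_lt : ∀ i y e, y < Y → e ≤ P.M → P.fold y (fun e => P.value i (P.arg y e)) e < P.K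

variable {P : Recursion} {Y : ℕ}

theorem mul_add_div_of_lt {a b c : ℕ} (h : c < b) : (a * b + c) / b = a := by
  rw [mul_comm, Nat.mul_add_div (by omega), Nat.div_eq_of_lt h, add_zero]

theorem step_code {st val i md : ℕ} (hv : val < P.K) (hi : i < P.K) (hm : md < 2) :
    P.step (P.code st val i md) = P.stepAux st val i md := by
  have h1 : P.code st val i md / 2 = (st * P.K + val) * P.K + i := by unfold code; omega
  have h2 : P.code st val i md % 2 = md := by unfold code; omega
  rw [step, h1, h2, Nat.mul_add_mod_of_lt hi, mul_add_div_of_lt hi, Nat.mul_add_mod_of_lt hv,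
    mul_add_div_of_lt hv]

theorem stepAux_push {st y e acc val i : ℕ} (hy : y < P.K) (he : e < P.K) (ha : acc < P.K)
    (hi : i ≠ P.T) : P.stepAux (P.push st y e acc) val i 1 =
      if e + 1 < P.M then P.code (P.push st y (e + 1) (P.comb y e acc val)) (P.arg y (e + 1)) i 0
      else P.code st (P.out (P.comb y e acc val)) (i + 1) 1 := by
  simp only [stepAux, push, if_neg hi, one_ne_zero, if_false, Nat.mul_add_mod_of_lt ha,
    mul_add_div_of_lt ha, Nat.mul_add_mod_of_lt he, mul_add_div_of_lt he, Nat.mul_add_mod_of_lt hy,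
    mul_add_div_of_lt hy]

theorem mul_add_one_le {a b c d K : ℕ} (h : a + 1 ≤ d * c) (hb : b < K) :
    a * K + b + 1 ≤ d * (c * K) := by
  have := Nat.mul_le_mul_right K h
  rw [add_mul, one_mul, mul_assoc] at this
  omega

theorem mul_add_one_le' {a b K : ℕ} (hb : b < K) : a * K + b + 1 ≤ (a + 1) * K := by
  rw [add_mul]; omega

theorem push_lt {st y e acc : ℕ} (hy : y < P.K) (he : e < P.K) (ha : acc < P.K) :
    P.push st y e acc + 1 ≤ (st + 1) * P.K ^ 3 := by
  rw [pow_succ, pow_succ, pow_one]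
  exact mul_add_one_le (mul_add_one_le (mul_add_one_le' hy) he) ha

/-- A frame costs a factor `K ^ 3` in the stack code, which is exactly the room reserved per level;
one level further down one factor fewer is needed. -/
theorem push_bound {st y e acc i : ℕ} (hst : (st + 1) * P.K ^ (3 * (i + 1) + 3) ≤ P.Z)
    (hy : y < P.K) (he : e < P.K) (ha : acc < P.K) :
    (P.push st y e acc + 1) * P.K ^ (3 * i + 3) ≤ P.Z := by
  refine le_trans (Nat.mul_le_mul_right _ (push_lt hy he ha)) (le_trans (le_of_eq ?_) hst)
  rw [mul_assoc, ← pow_add]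
  congr 2
  ring

namespace Good

variable (h : P.Good Y)
include h

theorem code_le {st val i md n : ℕ} (hn : (st + 1) * P.K ^ (3 * n + 3) ≤ P.Z) (hv : val < P.K)
    (hi : i < P.K) (hm : md < 2) : P.code st val i md ≤ P.Z := by
  have hK : 2 ≤ P.K := by have := h.hM; have := h.hM0; omega
  refine le_trans ?_ hn
  have h1 : P.code st val i md + 1 ≤ (st + 1) * (P.K * P.K * 2) :=
    mul_add_one_le (mul_add_one_le (mul_add_one_le' hv) hi) hm
  have h2 : P.K * P.K * 2 ≤ P.K ^ (3 * n + 3) :=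
    (Nat.mul_le_mul_left _ hK).trans ((by ring : P.K * P.K * P.K = P.K ^ 3).le.trans
      (Nat.pow_le_pow_right (by omega) (by omega)))
  have := Nat.mul_le_mul_left (st + 1) h2
  omega

theorem min_step {st val i md : ℕ} (hv : val < P.K) (hi : i < P.K) (hm : md < 2) {n st' v' i' m' : ℕ}
    (hs : P.stepAux st val i md = P.code st' v' i' m') (hv' : v' < P.K) (hi' : i' < P.K)
    (hm' : m' < 2) (hn : (st' + 1) * P.K ^ (3 * n + 3) ≤ P.Z) :
    min P.Z (P.step (P.code st val i md)) = P.code st' v' i' m' := by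
  rw [step_code hv hi hm, hs]
  exact min_eq_right (h.code_le hn hv' hi' hm')

/-- Induction on the level, for all stacks with enough room at once: a call on level `i + 1` makes
`M` calls on level `i` above a frame that records the argument, the index of the call and the
accumulated fold. The stack below the frame is never touched, and the cut-off at `Z` never bites. -/
theorem iterate_eq (i : ℕ) (hi : i ≤ P.T) {y : ℕ} (hy : y < Y) (st : ℕ)
    (hst : (st + 1) * P.K ^ (3 * i + 3) ≤ P.Z) :
    (fun s => min P.Z (P.step s))^[P.time i] (P.code st y i 0) = P.code st (P.value i y) i 1 := by
  have hYK := h.hY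
  have hTK := h.hT
  have hMK := h.hM
  have hM0 := h.hM0
  induction i generalizing y st with
  | zero =>
    exact h.min_step (by omega) (by omega) (by omega) (by simp [stepAux, value])
      (h.value_lt 0 y hy) (by omega) (by omega) hst
  | succ i IH =>
    have hyK : y < P.K := by omega
    have hf := fun e he => h.fold_lt i y e hy he
    set F : ℕ → ℕ := P.fold y fun e => P.value i (P.arg y e) with hF
    set G : ℕ → ℕ := fun s => min P.Z (P.step s) with hG
    have hpb : ∀ e, e < P.M → (P.push st y e (F e) + 1) * P.K ^ (3 * i + 3) ≤ P.Z := fun e he =>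
      push_bound hst hyK (by omega) (hf e he.le)
    have h1 : G (P.code st y (i + 1) 0) = P.code (P.push st y 0 0) (P.arg y 0) i 0 :=
      h.min_step hyK (by omega) (by omega) (by simp [stepAux])
        ((h.arg_lt y hy 0 hM0).trans_le hYK) (by omega) (by omega) (hpb 0 hM0)
    -- The call takes `time i` steps. The return takes one more, which either updates the frame and
    -- issues the next call, or pops the frame.
    have hcall : ∀ e < P.M, G^[P.time i + 1] (P.code (P.push st y e (F e)) (P.arg y e) i 0) =
        if e + 1 < P.M then P.code (P.push st y (e + 1) (F (e + 1))) (P.arg y (e + 1)) i 0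
        else P.code st (P.out (F (e + 1))) (i + 1) 1 := by
      intro e he
      rw [Function.iterate_succ_apply', IH (by omega) (h.arg_lt y hy e he) _ (hpb e he)]
      have hs := stepAux_push (P := P) (st := st) (val := P.value i (P.arg y e)) hyK
        (by omega : e < P.K) (hf e he.le) (by omega : i ≠ P.T)
      split_ifs with hlt
      · rw [if_pos hlt] at hs
        exact h.min_step (h.value_lt i _ (h.arg_lt y hy e he)) (by omega) (by omega) hs
          ((h.arg_lt y hy _ hlt).trans_le hYK) (by omega) (by omega) (hpb _ hlt)
      · rw [if_neg hlt] at hs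
        have hM : P.M = e + 1 := by omega
        refine h.min_step (h.value_lt i _ (h.arg_lt y hy e he)) (by omega) (by omega) hs ?_
          (by omega) (by omega) hst
        have := h.value_lt (i + 1) y hy
        rw [value, hM] at this
        exact this
    have hloop : ∀ e < P.M, G^[e * (P.time i + 1)] (P.code (P.push st y 0 0) (P.arg y 0) i 0) =
        P.code (P.push st y e (F e)) (P.arg y e) i 0 := by
      intro e he
      induction e with
      | zero => simp [hF, fold]
      | succ e ihe =>
        rw [add_mul, one_mul, add_comm, Function.iterate_add_apply, ihe (by omega),
          hcall e (by omega), if_pos he]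
    obtain ⟨M', hM'⟩ : ∃ M', P.M = M' + 1 := ⟨P.M - 1, by omega⟩
    rw [time, add_comm, Function.iterate_succ_apply, h1, hM', add_mul, one_mul, add_comm,
      Function.iterate_add_apply, hloop M' (by omega), hcall M' (by omega), if_neg (by omega),
      value, hM']

theorem time_le (i : ℕ) : P.time i ≤ P.K ^ i := by
  have hMK := h.hM
  induction i with
  | zero => simp [time]
  | succ i IH =>
    have h1 : 1 ≤ P.K ^ i := Nat.one_le_pow _ _ (by omega)
    calc P.time (i + 1) = 1 + P.M * (P.time i + 1) := rfl
      _ ≤ P.K ^ i + P.M * (P.K ^ i + P.K ^ i) :=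
        Nat.add_le_add h1 (Nat.mul_le_mul_left _ (Nat.add_le_add IH h1))
      _ = (2 * P.M + 1) * P.K ^ i := by ring
      _ ≤ P.K ^ (i + 1) := by rw [pow_succ, mul_comm]; exact Nat.mul_le_mul_left _ hMK

theorem result_eq {y : ℕ} (hy : y < Y) : P.result y = P.value P.T y := by
  have hMK := h.hM
  have hTK := h.hT
  have hZ : (0 + 1) * P.K ^ (3 * P.T + 3) ≤ P.Z := by rw [zero_add, one_mul]; exact h.hZ
  have hv := h.value_lt P.T y hy
  have ht : P.time P.T ≤ P.Z := (h.time_le _).trans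
    ((Nat.pow_le_pow_right (by omega) (by omega)).trans h.hZ)
  -- A return on the top level is a fixed point, so iterating `Z` times gives the result without
  -- knowledge of the exact time.
  have hfix : ∀ n, (fun s => min P.Z (P.step s))^[n] (P.code 0 (P.value P.T y) P.T 1) =
      P.code 0 (P.value P.T y) P.T 1 := fun n =>
    Function.iterate_fixed (h.min_step hv hTK (by omega) (by simp [stepAux]) hv hTK
      (by omega) hZ) n
  rw [result, show P.Z = (P.Z - P.time P.T) + P.time P.T by omega, Function.iterate_add_apply]
  rw [show P.Z - P.time P.T + P.time P.T = P.Z by omega, h.iterate_eq P.T le_rfl hy 0 hZ, hfix]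
  rw [show P.code 0 (P.value P.T y) P.T 1 / 2 = (0 * P.K + P.value P.T y) * P.K + P.T by
    unfold code; omega, mul_add_div_of_lt hTK, Nat.mul_add_mod_of_lt hv]

end Good

end Recursion

end Catalytic

namespace Catalytic

/-! ### Truncated repeated squaring of a transition matrix -/

/-- The approximation, in multiples of `1 / (2 * l)`, for the probability that `2 ^ i` random steps
lead from `C` to `D`, where bit `b` leads from `C` to `δ b C`. -/
def entry (δ : Bool → ℕ → ℕ) (N l : ℕ) : ℕ → ℕ → ℕ → ℕ
  | 0, C, D => l * ((if δ false C = D then 1 else 0) + (if δ true C = D then 1 else 0))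
  | i + 1, C, D => (∑ E ∈ Finset.range N, entry δ N l i C E * entry δ N l i E D) / (2 * l)

/-- The expectation of `u` after one random step. -/
noncomputable def expect (δ : Bool → ℕ → ℕ) (u : ℕ → ℝ) (C : ℕ) : ℝ :=
  (u (δ false C) + u (δ true C)) / 2

section

variable {δ : Bool → ℕ → ℕ} {N l : ℕ}

theorem expect_iterate_nonneg {u : ℕ → ℝ} (hu : ∀ C, 0 ≤ u C) (n C : ℕ) :
    0 ≤ (expect δ)^[n] u C := by
  induction n generalizing C with
  | zero => exact hu C
  | succ n ih =>
    rw [Function.iterate_succ_apply']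
    have h1 := ih (δ false C)
    have h2 := ih (δ true C)
    unfold expect at *; linarith

theorem expect_iterate_le_one {u : ℕ → ℝ} (hu : ∀ C, u C ≤ 1) (n C : ℕ) :
    (expect δ)^[n] u C ≤ 1 := by
  induction n generalizing C with
  | zero => exact hu C
  | succ n ih =>
    rw [Function.iterate_succ_apply']
    have h1 := ih (δ false C)
    have h2 := ih (δ true C)
    unfold expect at *; linarith

theorem sum_entry_zero (u : ℕ → ℝ) (C : ℕ) :
    ∑ D ∈ Finset.range N, (entry δ N l 0 C D : ℝ) * u D =
      l * ((if δ false C < N then u (δ false C) else 0) +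
        (if δ true C < N then u (δ true C) else 0)) := by
  have h : ∀ a, ∑ D ∈ Finset.range N, (if a = D then 1 else 0 : ℝ) * u D =
      if a < N then u a else 0 := by
    intro a
    simp
  rw [← h, ← h, ← Finset.sum_add_distrib, Finset.mul_sum]
  refine Finset.sum_congr rfl fun D _ => ?_
  simp only [entry]
  push_cast
  ring

theorem sum_entry_mul (i C : ℕ) (u : ℕ → ℝ) :
    ∑ D ∈ Finset.range N, (∑ E ∈ Finset.range N, (entry δ N l i C E : ℝ) * entry δ N l i E D) * u D =
    ∑ E ∈ Finset.range N, (entry δ N l i C E : ℝ) *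
      ∑ D ∈ Finset.range N, (entry δ N l i E D : ℝ) * u D := by
  simp_rw [Finset.sum_mul, Finset.mul_sum]
  rw [Finset.sum_comm]
  exact Finset.sum_congr rfl fun E _ => Finset.sum_congr rfl fun D _ => by ring

/-- Matrices are compared through their action on nonnegative functions `u`. There squaring becomes
composition of expectations, and rounding down can only lose. -/
theorem sum_entry_le (hl : 0 < l) {u : ℕ → ℝ} (hu : ∀ C, 0 ≤ u C) (i C : ℕ) :
    ∑ D ∈ Finset.range N, (entry δ N l i C D : ℝ) * u D ≤
      2 * l * (expect δ)^[2 ^ i] u C := by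
  have hl' : (0 : ℝ) < l := by exact_mod_cast hl
  induction i generalizing C u with
  | zero =>
    rw [sum_entry_zero, pow_zero, Function.iterate_one, expect]
    have h : ∀ a, (if a < N then u a else 0) ≤ u a := fun a => by
      split_ifs
      exacts [le_rfl, hu a]
    have := mul_le_mul_of_nonneg_left (add_le_add (h (δ false C)) (h (δ true C))) hl'.le
    linarith
  | succ i ih =>
    rw [pow_succ, mul_two, Function.iterate_add_apply]
    refine le_trans ?_ (ih (expect_iterate_nonneg hu _) C)
    calc ∑ D ∈ Finset.range N, (entry δ N l (i + 1) C D : ℝ) * u D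
        ≤ ∑ D ∈ Finset.range N, (∑ E ∈ Finset.range N, (entry δ N l i C E : ℝ) *
            entry δ N l i E D) * u D / (2 * l) := by
          refine Finset.sum_le_sum fun D _ => ?_
          rw [mul_div_right_comm]
          refine mul_le_mul_of_nonneg_right ?_ (hu D)
          have := Nat.cast_div_le (α := ℝ)
            (m := ∑ E ∈ Finset.range N, entry δ N l i C E * entry δ N l i E D) (n := 2 * l)
          push_cast at this
          exact this
      _ = ∑ E ∈ Finset.range N, (entry δ N l i C E : ℝ) *
            ((∑ D ∈ Finset.range N, (entry δ N l i E D : ℝ) * u D) / (2 * l)) := by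
          rw [← Finset.sum_div, sum_entry_mul, Finset.sum_div]
          exact Finset.sum_congr rfl fun E _ => by ring
      _ ≤ _ := by
          refine Finset.sum_le_sum fun E _ => mul_le_mul_of_nonneg_left ?_ (Nat.cast_nonneg _)
          rw [div_le_iff₀ (by positivity)]
          linarith [ih hu E]

/-- The case `u = 1`: rows remain substochastic under rounding, which keeps all entries bounded by
`2 * l`. -/
theorem sum_entry_le_two_mul (hl : 0 < l) (i C : ℕ) :
    ∑ D ∈ Finset.range N, entry δ N l i C D ≤ 2 * l := by
  have h1 := sum_entry_le (δ := δ) (N := N) hl (u := fun _ => 1) (fun _ => zero_le_one) i C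
  have h2 := expect_iterate_le_one (δ := δ) (u := fun _ => 1) (fun _ => le_rfl) (2 ^ i) C
  have hl' : (0 : ℝ) < l := by exact_mod_cast hl
  simp only [mul_one] at h1
  have h3 : (∑ D ∈ Finset.range N, entry δ N l i C D : ℝ) ≤ 2 * l :=
    h1.trans (by nlinarith)
  exact_mod_cast h3

theorem entry_le (hl : 0 < l) (i C : ℕ) {D : ℕ} (hD : D < N) : entry δ N l i C D ≤ 2 * l :=
  (Finset.single_le_sum (f := fun D => entry δ N l i C D) (fun _ _ => Nat.zero_le _)
    (Finset.mem_range.2 hD)).trans (sum_entry_le_two_mul hl i C)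

-- The error after `i` squarings obeys the recursion `err (i + 1) ≤ 2 * err i + N`: one error for
-- each of the two factors, and less than `1` for the rounding in each of `N` columns. This gives
-- `(2 ^ i - 1) * N`. The closed set `G` keeps the chain among the codes below `N`; outside it no
-- lower bound is claimed.
open Classical in
theorem le_sum_entry (hl : 0 < l) {G : ℕ → Prop} (hGN : ∀ C, G C → C < N)
    (hG : ∀ C b, G C → G (δ b C)) {u : ℕ → ℝ} (hu : ∀ C, 0 ≤ u C) (hu' : ∀ C, u C ≤ 1) (i : ℕ)
    {C : ℕ} (hC : G C) :
    2 * l * (expect δ)^[2 ^ i] u C - (2 ^ i - 1) * N ≤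
      ∑ D ∈ Finset.range N, (entry δ N l i C D : ℝ) * (if G D then u D else 0) := by
  have hl' : (0 : ℝ) < l := by exact_mod_cast hl
  induction i generalizing C u with
  | zero =>
    rw [sum_entry_zero, pow_zero, Function.iterate_one, expect, if_pos (hGN _ (hG C false hC)),
      if_pos (hGN _ (hG C true hC)), if_pos (hG C false hC), if_pos (hG C true hC)]
    linarith
  | succ i ih =>
    set w : ℕ → ℝ := fun D => if G D then u D else 0 with hw
    have hw0 : ∀ D, 0 ≤ w D := fun D => by
      simp only [hw]; split_ifs
      exacts [hu D, le_rfl]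
    have hw1 : ∀ D, w D ≤ 1 := fun D => by
      simp only [hw]; split_ifs
      exacts [hu' D, zero_le_one]
    have h2 : (1 : ℝ) ≤ 2 ^ i := one_le_pow₀ (by norm_num)
    have h3 : (∑ E ∈ Finset.range N, (entry δ N l i C E : ℝ)) ≤ 2 * l := by
      exact_mod_cast sum_entry_le_two_mul (δ := δ) (N := N) hl i C
    have h4 := ih (expect_iterate_nonneg (δ := δ) hu (2 ^ i)) (expect_iterate_le_one hu' (2 ^ i)) hC
    rw [← Function.iterate_add_apply, ← mul_two, ← pow_succ] at h4
    calc 2 * l * (expect δ)^[2 ^ (i + 1)] u C - (2 ^ (i + 1) - 1) * N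
        ≤ ∑ E ∈ Finset.range N, (entry δ N l i C E : ℝ) *
            (if G E then (expect δ)^[2 ^ i] u E else 0) - (2 ^ i - 1) * N - N := by
          rw [pow_succ (2 : ℝ) i]; linarith
      -- The error of the second factor is spread over the row of the first, whose sum is at most `2
      -- * l`.
      _ ≤ ∑ E ∈ Finset.range N, (entry δ N l i C E : ℝ) *
            (if G E then (expect δ)^[2 ^ i] u E else 0) -
            (∑ E ∈ Finset.range N, (entry δ N l i C E : ℝ)) * ((2 ^ i - 1) * N / (2 * l)) - N := by
          have h5 : (0 : ℝ) ≤ (2 ^ i - 1) * N / (2 * l) :=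
            div_nonneg (mul_nonneg (by linarith) (Nat.cast_nonneg _)) (by linarith)
          have h6 := mul_le_mul_of_nonneg_right h3 h5
          have h7 : 2 * (l : ℝ) * ((2 ^ i - 1) * N / (2 * l)) = (2 ^ i - 1) * N := by
            field_simp
          linarith
      _ = ∑ E ∈ Finset.range N, (entry δ N l i C E : ℝ) *
            ((if G E then (expect δ)^[2 ^ i] u E else 0) - (2 ^ i - 1) * N / (2 * l)) - N := by
          rw [Finset.sum_mul, ← Finset.sum_sub_distrib]
          congr 1
          exact Finset.sum_congr rfl fun E _ => by ring
      _ ≤ ∑ E ∈ Finset.range N, (entry δ N l i C E : ℝ) *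
            ((∑ D ∈ Finset.range N, (entry δ N l i E D : ℝ) * w D) / (2 * l)) - N := by
          refine sub_le_sub_right (Finset.sum_le_sum fun E _ =>
            mul_le_mul_of_nonneg_left ?_ (Nat.cast_nonneg _)) _
          rw [le_div_iff₀ (by positivity), sub_mul, div_mul_cancel₀ _ (by positivity)]
          by_cases hE : G E
          · rw [if_pos hE]
            linarith [ih hu hu' hE]
          · rw [if_neg hE]
            have h8 : 0 ≤ ∑ D ∈ Finset.range N, (entry δ N l i E D : ℝ) * w D :=
              Finset.sum_nonneg fun D _ => mul_nonneg (Nat.cast_nonneg _) (hw0 D)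
            have h9 : (0 : ℝ) ≤ (2 ^ i - 1) * N :=
              mul_nonneg (by linarith) (Nat.cast_nonneg _)
            linarith
      _ = ∑ D ∈ Finset.range N, ((∑ E ∈ Finset.range N, (entry δ N l i C E : ℝ) *
            entry δ N l i E D) / (2 * l) * w D - 1) := by
          rw [Finset.sum_sub_distrib]
          simp only [Finset.sum_const, Finset.card_range, nsmul_eq_mul, mul_one]
          congr 1
          simp_rw [div_mul_eq_mul_div]
          rw [← Finset.sum_div, sum_entry_mul, Finset.sum_div]
          exact Finset.sum_congr rfl fun E _ => by ring
      -- Rounding down loses less than `1` in each column, and the weight `w D` is at most `1`.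
      _ ≤ ∑ D ∈ Finset.range N, (entry δ N l (i + 1) C D : ℝ) * w D := by
          refine Finset.sum_le_sum fun D _ => ?_
          have h10 := Nat.lt_div_mul_add (a := ∑ E ∈ Finset.range N, entry δ N l i C E *
            entry δ N l i E D) (b := 2 * l) (by omega)
          have h11 : (∑ E ∈ Finset.range N, (entry δ N l i C E : ℝ) * entry δ N l i E D) / (2 * l) ≤
              (entry δ N l (i + 1) C D : ℝ) + 1 := by
            rw [div_le_iff₀ (by positivity)]
            have h12 : ∑ E ∈ Finset.range N, entry δ N l i C E * entry δ N l i E D ≤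
              (entry δ N l (i + 1) C D + 1) * (2 * l) := by
              rw [add_mul, one_mul]; exact h10.le
            exact_mod_cast h12
          have := mul_le_mul_of_nonneg_right h11 (hw0 D)
          nlinarith [hw0 D, hw1 D]

/-- The probability of being in `a` after `t` random steps. -/
noncomputable def hitProb (δ : Bool → ℕ → ℕ) (a t : ℕ) : ℕ → ℝ :=
  (expect δ)^[t] fun C => if C = a then 1 else 0

theorem hitProb_zero (a C : ℕ) : hitProb δ a 0 C = if C = a then 1 else 0 := rfl

theorem hitProb_succ (a t C : ℕ) :
    hitProb δ a (t + 1) C = (hitProb δ a t (δ false C) + hitProb δ a t (δ true C)) / 2 := by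
  rw [hitProb, Function.iterate_succ_apply']; rfl

theorem hitProb_of_fixed {a C : ℕ} (h : ∀ b, δ b C = C) (t : ℕ) :
    hitProb δ a t C = if C = a then 1 else 0 := by
  induction t with
  | zero => rfl
  | succ t ih => rw [hitProb_succ, h, h, ih]; ring

theorem entry_le_hitProb (hl : 0 < l) {a : ℕ} (ha : a < N) (T C : ℕ) :
    (entry δ N l T C a : ℝ) ≤ 2 * l * hitProb δ a (2 ^ T) C := by
  have := sum_entry_le (δ := δ) (N := N) hl (u := fun C => if C = a then 1 else 0)
    (fun C => by split_ifs <;> norm_num) T C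
  simpa [ha, hitProb] using this

theorem hitProb_le_entry (hl : 0 < l) {G : ℕ → Prop} (hGN : ∀ C, G C → C < N)
    (hG : ∀ C b, G C → G (δ b C)) {a : ℕ} (ha : a < N) (T : ℕ) {C : ℕ} (hC : G C) :
    2 * l * hitProb δ a (2 ^ T) C - 2 ^ T * N ≤ entry δ N l T C a := by
  classical
  have h := le_sum_entry (δ := δ) (N := N) hl hGN hG (u := fun C => if C = a then 1 else 0)
    (fun C => by split_ifs <;> norm_num) (fun C => by split_ifs <;> norm_num) T hC
  have h' : ∑ D ∈ Finset.range N, (entry δ N l T C D : ℝ) *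
      (if G D then if D = a then 1 else 0 else 0) ≤ entry δ N l T C a := by
    rw [Finset.sum_eq_single a]
    · rw [if_pos rfl]
      split_ifs <;> simp
    · intro D _ hD
      simp [hD]
    · intro h; exact absurd (Finset.mem_range.2 ha) h
  have hN : (0 : ℝ) ≤ N := Nat.cast_nonneg _
  unfold hitProb
  linarith

/-- The recursion for the entries, on codes `C * N + D`. -/
def squaring (δ : Bool → ℕ → ℕ) (N l T Z : ℕ) : Recursion where
  base y := l * ((if δ false (y / N) = y % N then 1 else 0) +
    (if δ true (y / N) = y % N then 1 else 0))
  arg y e := if e % 2 = 0 then y / N * N + e / 2 else e / 2 * N + y % N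
  comb _ e acc v := if e % 2 = 0 then acc / (2 * l + 1) * (2 * l + 1) + v
    else (acc / (2 * l + 1) + acc % (2 * l + 1) * v) * (2 * l + 1)
  out acc := acc / (2 * l + 1) / (2 * l)
  M := 2 * N
  T := T
  K := (N + 2 * l + T + 2) ^ 4
  Z := Z

variable {T Z : ℕ}

/-- The accumulator is a pair in base `2 * l + 1`. An even call stores the left factor in the low
digit; the odd call after it multiplies this digit by the right factor, adds the product to the sum
in the high part, and resets the digit to zero. -/
theorem squaring_fold (hl : 0 < l) {i C D : ℕ} {r : ℕ → ℕ}
    (h0 : ∀ E < N, r (2 * E) = entry δ N l i C E) (h1 : ∀ E < N, r (2 * E + 1) = entry δ N l i E D)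
    (y : ℕ) {E : ℕ} (hE : E ≤ N) : (squaring δ N l T Z).fold y r (2 * E) =
      (∑ F ∈ Finset.range E, entry δ N l i C F * entry δ N l i F D) * (2 * l + 1) := by
  induction E with
  | zero => simp [Recursion.fold]
  | succ E ih =>
    have h2 := entry_le (δ := δ) hl i C (D := E) (N := N) (by omega)
    rw [show 2 * (E + 1) = 2 * E + 1 + 1 by ring, Recursion.fold, Recursion.fold, ih (by omega),
      h0 E (by omega), h1 E (by omega), Finset.sum_range_succ]
    have e1 : (2 * E) % 2 = 0 := by omega
    have e2 : (2 * E + 1) % 2 ≠ 0 := by omega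
    simp only [squaring, if_pos e1, if_neg e2]
    rw [Nat.mul_div_cancel _ (by omega), Recursion.mul_add_div_of_lt (by omega),
      Nat.mul_add_mod_of_lt (by omega)]

theorem squaring_value (hl : 0 < l) (i : ℕ) {y : ℕ} (hy : y < N * N) :
    (squaring δ N l T Z).value i y = entry δ N l i (y / N) (y % N) := by
  have hN : 0 < N := by rcases Nat.eq_zero_or_pos N with rfl | h <;> simp_all
  induction i generalizing y with
  | zero => rfl
  | succ i ih =>
    have hd : y / N < N := Nat.div_lt_of_lt_mul hy
    have hm : y % N < N := Nat.mod_lt _ hN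
    have hlt : ∀ a b, a < N → b < N → a * N + b < N * N := fun a b ha hb =>
      (Recursion.mul_add_one_le' hb).trans (Nat.mul_le_mul_right _ ha)
    rw [Recursion.value, show (squaring δ N l T Z).M = 2 * N from rfl,
      squaring_fold hl (i := i) (C := y / N) (D := y % N) _ _ y le_rfl]
    · simp only [squaring, entry]
      rw [Nat.mul_div_cancel _ (by omega)]
    · intro E hE
      have e1 : (2 * E) % 2 = 0 := by omega
      have e3 : 2 * E / 2 = E := by omega
      simp only [show (squaring δ N l T Z).arg y (2 * E) = y / N * N + E by
        simp only [squaring, if_pos e1, e3]]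
      rw [ih (hlt _ _ hd hE), Recursion.mul_add_div_of_lt hE, Nat.mul_add_mod_of_lt hE]
    · intro E hE
      have e1 : (2 * E + 1) % 2 ≠ 0 := by omega
      have e3 : (2 * E + 1) / 2 = E := by omega
      simp only [show (squaring δ N l T Z).arg y (2 * E + 1) = E * N + y % N by
        simp only [squaring, if_neg e1, e3]]
      rw [ih (hlt _ _ hE hm), Recursion.mul_add_div_of_lt hm, Nat.mul_add_mod_of_lt hm]

theorem squaring_good (hl : 0 < l) (hN : 0 < N)
    (hZ : (N + 2 * l + T + 2) ^ (4 * (3 * T + 3)) ≤ Z) : (squaring δ N l T Z).Good (N * N) := by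
  set X := N + 2 * l + T + 2 with hX
  have hlt : ∀ a b, a < N → b < N → a * N + b < N * N := fun a b ha hb =>
    (Recursion.mul_add_one_le' hb).trans (Nat.mul_le_mul_right _ ha)
  have hK : (squaring δ N l T Z).K = X ^ 4 := rfl
  have hX2 : X ^ 2 ≤ X ^ 4 := Nat.pow_le_pow_right (by omega) (by omega)
  have hX4 : X * 4 ≤ X ^ 4 := by
    have : 2 ^ 3 ≤ X ^ 3 := Nat.pow_le_pow_left (by omega) 3
    rw [pow_succ, mul_comm]; exact Nat.mul_le_mul_right _ (by omega)
  have hent : ∀ i C D, D < N → entry δ N l i C D ≤ 2 * l := fun i C D hD => entry_le hl i C hD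
  have harg : ∀ y < N * N, ∀ e < 2 * N, (squaring δ N l T Z).arg y e < N * N := by
    intro y hy e he
    simp only [squaring]
    split_ifs
    · exact hlt _ _ (Nat.div_lt_of_lt_mul hy) (by omega)
    · exact hlt _ _ (by omega) (Nat.mod_lt _ hN)
  refine ⟨?_, ?_, ?_, ?_, ?_, harg, ?_, ?_⟩
  · rw [hK, ← sq]; exact (Nat.pow_le_pow_left (by omega) 2).trans hX2
  · rw [hK, show (squaring δ N l T Z).M = 2 * N from rfl]; omega
  · change 0 < 2 * N; omega
  · rw [hK, show (squaring δ N l T Z).T = T from rfl]; omega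
  · rw [show (squaring δ N l T Z).T = T from rfl, show (squaring δ N l T Z).Z = Z from rfl, hK,
      ← pow_mul]
    exact hZ
  · intro i y hy
    rw [squaring_value hl i hy, hK]
    have := hent i (y / N) (y % N) (Nat.mod_lt _ hN)
    omega
  · intro i y e hy he
    rw [hK]
    change e ≤ 2 * N at he
    have hd : y / N < N := Nat.div_lt_of_lt_mul hy
    have hm : y % N < N := Nat.mod_lt _ hN
    set r : ℕ → ℕ := fun e => (squaring δ N l T Z).value i ((squaring δ N l T Z).arg y e) with hr
    have hv : ∀ e < 2 * N, r e = entry δ N l i ((squaring δ N l T Z).arg y e / N)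
        ((squaring δ N l T Z).arg y e % N) := fun e he => squaring_value hl i (harg y hy e he)
    have hr0 : ∀ E < N, r (2 * E) = entry δ N l i (y / N) E := by
      intro E hE
      rw [hv _ (by omega)]
      have e1 : (2 * E) % 2 = 0 := by omega
      have e3 : 2 * E / 2 = E := by omega
      simp only [squaring, if_pos e1, e3]
      rw [Recursion.mul_add_div_of_lt hE, Nat.mul_add_mod_of_lt hE]
    have hr1 : ∀ E < N, r (2 * E + 1) = entry δ N l i E (y % N) := by
      intro E hE
      rw [hv _ (by omega)]
      have e1 : (2 * E + 1) % 2 ≠ 0 := by omega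
      have e3 : (2 * E + 1) / 2 = E := by omega
      simp only [squaring, if_neg e1, e3]
      rw [Recursion.mul_add_div_of_lt hm, Nat.mul_add_mod_of_lt hm]
    have hsum : ∀ E ≤ N, ∑ F ∈ Finset.range E, entry δ N l i (y / N) F * entry δ N l i F (y % N) ≤
        N * (2 * l * (2 * l)) := by
      intro E hE
      calc _ ≤ ∑ F ∈ Finset.range E, 2 * l * (2 * l) := Finset.sum_le_sum fun F hF =>
            Nat.mul_le_mul (hent _ _ _ (by have := Finset.mem_range.1 hF; omega)) (hent _ _ _ hm)
        _ = E * (2 * l * (2 * l)) := by simp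
        _ ≤ _ := Nat.mul_le_mul_right _ hE
    -- The largest accumulator: a sum of `N` products together with a digit. It determines the
    -- exponent `4` in `K`.
    have hbound : N * (2 * l * (2 * l)) * (2 * l + 1) + 2 * l < X ^ 4 := by
      have h1 : (N * (2 * l * (2 * l)) + 1) ≤ X ^ 3 := by
        have : N * (2 * l * (2 * l)) + 1 ≤ (N + 1) * ((2 * l + 1) * (2 * l + 1)) := by nlinarith
        refine this.trans ?_
        rw [pow_succ, pow_two, mul_assoc]
        exact Nat.mul_le_mul (by omega) (Nat.mul_le_mul (by omega) (by omega))
      have h2 : (N * (2 * l * (2 * l)) + 1) * (2 * l + 1) ≤ X ^ 4 := by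
        rw [pow_succ X 3]
        exact Nat.mul_le_mul h1 (by omega)
      rw [add_mul, one_mul] at h2
      omega
    rcases Nat.even_or_odd' e with ⟨E, rfl | rfl⟩
    · rw [squaring_fold hl hr0 hr1 y (by omega)]
      have := Nat.mul_le_mul_right (2 * l + 1) (hsum E (by omega))
      omega
    · rw [Recursion.fold, squaring_fold hl hr0 hr1 y (by omega), hr0 E (by omega)]
      have e1 : (2 * E) % 2 = 0 := by omega
      simp only [squaring, if_pos e1]
      rw [Nat.mul_div_cancel _ (by omega)]
      have := Nat.mul_le_mul_right (2 * l + 1) (hsum E (by omega))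
      have := hent i (y / N) E (by omega)
      omega

theorem squaring_result (hl : 0 < l) (hZ : (N + 2 * l + T + 2) ^ (4 * (3 * T + 3)) ≤ Z)
    {C D : ℕ} (hC : C < N) (hD : D < N) :
    (squaring δ N l T Z).result (C * N + D) = entry δ N l T C D := by
  have hlt : C * N + D < N * N :=
    (Recursion.mul_add_one_le' hD).trans (Nat.mul_le_mul_right _ hC)
  rw [(squaring_good hl (by omega) hZ).result_eq hlt, squaring_value hl _ hlt,
    Recursion.mul_add_div_of_lt hD, Nat.mul_add_mod_of_lt hD]
  rfl

end

end Catalytic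

namespace Catalytic

open Machine

/-! ### Configurations as numbers -/

/-- The code of a head movement. -/
def Dir.code : Dir → ℕ
  | .left => 0
  | .stay => 1
  | .right => 2

theorem Sym.code_lt (s : Sym) : s.code < 4 := by
  rcases s with _ | _ | _ | _ <;> simp [Sym.code]

theorem Sym.code_injective : Function.Injective Sym.code := by
  rintro (_ | _ | _ | _) (_ | _ | _ | _) h <;> simp_all [Sym.code]

/-- A head position is represented by the power of two with this exponent. `symOf u t` is the code
of the symbol scanned on the tape with number `t`. -/
def symOf (u t : ℕ) : ℕ := if u = 1 then 0 else 2 + t / u % 2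

/-- Moving the input head when scanning the symbol with code `s`. -/
def moveInput (s d p : ℕ) : ℕ := if d = 0 then p - 1 else if d = 1 then p else if s = 1 then p else p + 1

/-- Moving the head of a read-write tape. -/
def moveHead (d u : ℕ) : ℕ := if d = 0 then (if u = 1 then 1 else u / 2) else if d = 1 then u else 2 * u

/-- Writing a bit on a read-write tape. -/
def writeNum (u t b : ℕ) : ℕ := if u = 1 then t else t - u * (t / u % 2) + u * b

/-- The number of a tape with content `t` on the first `g` cells. -/
def tapeNum (g : ℕ) (t : ℕ → Bool) : ℕ := 2 * Nat.ofBits fun i : Fin g => t i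

/-- The factor `2` in `tapeNum` aligns cells with head positions: the head on cell `p` is at
position `p + 1`, represented by `2 ^ (p + 1)`, and scans bit `p + 1`. Bit `0` belongs to the
left-end marker. -/
theorem testBit_tapeNum {g : ℕ} {t : ℕ → Bool} (ht : ∀ p ≥ g, t p = false) (p : ℕ) :
    (tapeNum g t).testBit (p + 1) = t p := by
  rw [tapeNum, Nat.testBit_succ, Nat.mul_div_cancel_left _ (by omega)]
  rcases lt_or_ge p g with h | h
  · rw [Nat.testBit_ofBits_lt _ _ h]
  · rw [Nat.testBit_ofBits_ge _ _ h, ht p h]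

theorem testBit_tapeNum_zero (g : ℕ) (t : ℕ → Bool) : (tapeNum g t).testBit 0 = false := by
  simp [tapeNum]

theorem tapeNum_lt (g : ℕ) (t : ℕ → Bool) : tapeNum g t < 2 ^ (g + 1) := by
  rw [tapeNum, pow_succ, mul_comm]
  exact Nat.mul_lt_mul_of_pos_right (Nat.ofBits_lt_two_pow _) (by omega)

theorem tapeNum_injective {g : ℕ} {t t' : ℕ → Bool} (ht : ∀ p ≥ g, t p = false)
    (ht' : ∀ p ≥ g, t' p = false) (h : tapeNum g t = tapeNum g t') : t = t' := by
  funext p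
  rw [← testBit_tapeNum ht, h, testBit_tapeNum ht']

theorem two_pow_succ_ne_one (p : ℕ) : 2 ^ (p + 1) ≠ 1 := by
  have := Nat.one_lt_two_pow (n := p + 1) (by omega)
  omega

theorem symOf_tapeNum {g : ℕ} {t : ℕ → Bool} (ht : ∀ p ≥ g, t p = false) (h : ℕ) :
    symOf (2 ^ h) (tapeNum g t) = (readTape t h).code := by
  cases h with
  | zero => rfl
  | succ p =>
    have := testBit_tapeNum ht p
    rw [Nat.testBit_eq_decide_div_mod_eq] at this
    rw [symOf, if_neg (two_pow_succ_ne_one p), readTape, ← this]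
    by_cases hb : tapeNum g t / 2 ^ (p + 1) % 2 = 1
    · simp [hb, Sym.code]
    · rw [show tapeNum g t / 2 ^ (p + 1) % 2 = 0 by omega]
      rfl

theorem moveHead_two_pow (d : Dir) (h : ℕ) : moveHead d.code (2 ^ h) = 2 ^ move h d := by
  cases d
  · cases h with
    | zero => rfl
    | succ p =>
      rw [moveHead, Dir.code, if_pos rfl, if_neg (two_pow_succ_ne_one p), pow_succ,
        Nat.mul_div_cancel _ (by omega)]
      rfl
  · rfl
  · simp only [moveHead, Dir.code, move, pow_succ, mul_comm]
    simp

theorem writeNum_tapeNum {g : ℕ} {t : ℕ → Bool} (ht : ∀ p ≥ g, t p = false) (b : Bool) {h : ℕ}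
    (hh : h ≤ g) : (∀ p ≥ g, writeTape t b h p = false) ∧
      writeNum (2 ^ h) (tapeNum g t) b.toNat = tapeNum g (writeTape t b h) := by
  cases h with
  | zero => exact ⟨ht, rfl⟩
  | succ p =>
    have ht' : ∀ q ≥ g, writeTape t b (p + 1) q = false := by
      intro q hq
      rw [writeTape, Function.update_of_ne (by omega)]
      exact ht q hq
    refine ⟨ht', ?_⟩
    rw [writeNum, if_neg (two_pow_succ_ne_one p)]
    have hb := testBit_tapeNum ht p
    have hmod : tapeNum g t / 2 ^ (p + 1) % 2 = (t p).toNat := by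
      rw [← hb, Nat.toNat_testBit]
    rw [hmod]
    refine Nat.eq_of_testBit_eq fun q => ?_
    have key : (tapeNum g (writeTape t b (p + 1))).testBit q =
        if q = p + 1 then b else (tapeNum g t).testBit q := by
      cases q with
      | zero => rw [testBit_tapeNum_zero, testBit_tapeNum_zero, if_neg (by omega)]
      | succ q =>
        rw [testBit_tapeNum ht', testBit_tapeNum ht, writeTape, Function.update_apply]
        simp
    rw [key]
    cases htp : t p <;> rw [htp] at hb <;> cases b <;> simp only [Bool.toNat_false,
      Bool.toNat_true, mul_zero, mul_one, Nat.sub_zero, add_zero]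
    · split_ifs with h
      · rw [h, hb]
      · rfl
    · exact Prog.testBit_add_two_pow hb q
    · exact Prog.testBit_sub_two_pow hb q
    · rw [Nat.sub_add_cancel (Nat.ge_two_pow_of_testBit hb)]
      split_ifs with h
      · rw [h, hb]
      · rfl

/-- The head stands on position `x.length + 1` exactly when it scans the right-end marker, so the
clamping can be done without knowing the length. -/
theorem moveInput_eq (x : List Bool) (d : Dir) {p : ℕ} (hp : p ≤ x.length + 1) :
    moveInput (readInput x p).code d.code p = min (move p d) (x.length + 1) := by
  cases d
  · simp [moveInput, Dir.code, move]; omega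
  · simp [moveInput, Dir.code, move]; omega
  · change (if (readInput x p).code = 1 then p else p + 1) = min (p + 1) (x.length + 1)
    cases p with
    | zero => simp [readInput, Sym.code]
    | succ p =>
      rw [readInput]
      split_ifs with h1 h2 h2
      · cases hx : x[p] <;> simp [hx, Sym.code] at h2
      · omega
      · omega
      · simp [Sym.code] at h2

/-- Packing a state, an input head position, and two heads and tapes. -/
def pack (R q p u t u' t' : ℕ) : ℕ := ((((q * R + p) * R + u) * R + t) * R + u') * R + t'

theorem pack_lt {R q p u t u' t' Q : ℕ} (hq : q < Q) (hp : p < R) (hu : u < R) (ht : t < R)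
    (hu' : u' < R) (ht' : t' < R) : pack R q p u t u' t' < Q * R ^ 5 := by
  have h := Recursion.mul_add_one_le (Recursion.mul_add_one_le (Recursion.mul_add_one_le
    (Recursion.mul_add_one_le (Recursion.mul_add_one_le' (a := q) hp) hu) ht) hu') ht'
  have h2 := Nat.mul_le_mul_right (R * R * R * R * R) hq
  rw [show R ^ 5 = R * R * R * R * R by ring]
  exact lt_of_lt_of_le (Nat.lt_of_succ_le h) h2

theorem unpack {R q p u t u' t' : ℕ} (hp : p < R) (hu : u < R) (ht : t < R)
    (hu' : u' < R) (ht' : t' < R) :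
    pack R q p u t u' t' / R / R / R / R / R = q ∧ pack R q p u t u' t' / R / R / R / R % R = p ∧
    pack R q p u t u' t' / R / R / R % R = u ∧ pack R q p u t u' t' / R / R % R = t ∧
    pack R q p u t u' t' / R % R = u' ∧ pack R q p u t u' t' % R = t' := by
  simp only [pack, Recursion.mul_add_div_of_lt hp, Recursion.mul_add_div_of_lt hu,
    Recursion.mul_add_div_of_lt ht, Recursion.mul_add_div_of_lt hu',
    Recursion.mul_add_div_of_lt ht', Nat.mul_add_mod_of_lt hp, Nat.mul_add_mod_of_lt hu,
    Nat.mul_add_mod_of_lt ht, Nat.mul_add_mod_of_lt hu', Nat.mul_add_mod_of_lt ht', and_self]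

/-- The number of states of a machine. -/
noncomputable def numStates (M : Machine CatTape) : ℕ := Nat.card M.State

/-- The number of a state. -/
noncomputable def stateNum (M : Machine CatTape) (q : M.State) : ℕ :=
  have := M.finite_state
  Finite.equivFin M.State q

theorem stateNum_lt (M : Machine CatTape) (q : M.State) : stateNum M q < numStates M :=
  Fin.is_lt _

theorem stateNum_injective (M : Machine CatTape) : Function.Injective (stateNum M) := by
  intro p q h
  have := M.finite_state
  exact (Finite.equivFin M.State).injective (Fin.ext h)

/-- What the transition function of a machine depends on. -/
abbrev Key (M : Machine CatTape) : Type := M.State × Sym × Sym × Sym × Bool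

/-- The code of the arguments of the transition function. -/
def keyNum (q a b c o : ℕ) : ℕ := (((q * 4 + a) * 4 + b) * 4 + c) * 2 + o

/-- The code of the arguments of the transition function of `M`. -/
noncomputable def Key.code {M : Machine CatTape} (k : Key M) : ℕ :=
  keyNum (stateNum M k.1) k.2.1.code k.2.2.1.code k.2.2.2.1.code k.2.2.2.2.toNat

theorem Key.code_injective {M : Machine CatTape} :
    Function.Injective (Key.code : Key M → ℕ) := by
  rintro ⟨q, a, b, c, o⟩ ⟨q', a', b', c', o'⟩ h
  simp only [Key.code, keyNum] at h
  have h1 := a.code_lt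
  have h2 := b.code_lt
  have h3 := c.code_lt
  have h4 := a'.code_lt
  have h5 := b'.code_lt
  have h6 := c'.code_lt
  have h7 : o.toNat < 2 := Bool.toNat_lt o
  have h8 : o'.toNat < 2 := Bool.toNat_lt o'
  have e1 : stateNum M q = stateNum M q' := by omega
  have e2 : a.code = a'.code := by omega
  have e3 : b.code = b'.code := by omega
  have e4 : c.code = c'.code := by omega
  have e5 : o.toNat = o'.toNat := by omega
  rw [stateNum_injective M e1, Sym.code_injective e2, Sym.code_injective e3,
    Sym.code_injective e4, show o = o' by cases o <;> cases o' <;> simp at e5 ⊢]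

/-- The table of a function of the arguments of the transition function. -/
noncomputable def table {M : Machine CatTape} (f : Key M → ℕ) : ℕ → ℕ :=
  Function.extend Key.code f 0

theorem table_code {M : Machine CatTape} (f : Key M → ℕ) (k : Key M) : table f k.code = f k :=
  Key.code_injective.extend_apply f 0 k

/-- A function on a finite type, transported to codes and extended by zero, has finite support. Thus
the transition function of an arbitrary machine enters the arithmetic through `LinSpace.table`. -/
theorem extend_eventually_zero {α : Type} [Finite α] (c f : α → ℕ) :
    ∃ B, ∀ n ≥ B, Function.extend c f 0 n = 0 := by
  obtain ⟨B, hB⟩ := (Set.finite_range c).bddAbove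
  refine ⟨B + 1, fun n hn => Function.extend_apply' _ _ _ ?_⟩
  rintro ⟨k, rfl⟩
  have := hB ⟨k, rfl⟩
  omega

theorem linSpace_table {M : Machine CatTape} (t : Key M → ℕ) {a : ℕ}
    {f : List Bool → (Fin a → ℕ) → ℕ} (hf : LinSpace f) : LinSpace fun x v => table t (f x v) := by
  have := M.finite_state
  obtain ⟨B, hB⟩ := extend_eventually_zero (Key.code : Key M → ℕ) t
  exact LinSpace.table hB hf

/-- The transition of `M` for given arguments. -/
def transition (M : Machine CatTape) (k : Key M) : M.State × Dir × (CatTape → Bool × Dir) :=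
  M.next k.1 k.2.1 (fun i => match i with | .work => k.2.2.1 | .cat => k.2.2.2.1)
    (if M.tosses k.1 then some k.2.2.2.2 else none)

/-- The code of the output in a state, `0` if it is not a halting state. -/
noncomputable def outputNum (M : Machine CatTape) : ℕ → ℕ :=
  Function.extend (stateNum M) (fun q => match M.output q with
    | none => 0
    | some true => 1
    | some false => 2) 0

/-- The absorbing code for the output `b`. -/
noncomputable def haltCode (M : Machine CatTape) (R : ℕ) (b : Bool) : ℕ :=
  pack R (numStates M) 0 0 0 0 b.toNat

/-- The absorbing code for leaving the space bound. -/
noncomputable def trashCode (M : Machine CatTape) (R : ℕ) : ℕ := pack R (numStates M) 0 0 0 1 0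

/-- The successor of a configuration with given components, where `o` is the random bit and `key`
the code of the arguments of the transition function. -/
noncomputable def succCode (M : Machine CatTape) (R s key p u t u' t' : ℕ) : ℕ :=
  if moveInput s (table (fun k : Key M => (transition M k).2.1.code) key) p < R then
    if moveHead (table (fun k : Key M => ((transition M k).2.2 .work).2.code) key) u < R then
      if moveHead (table (fun k : Key M => ((transition M k).2.2 .cat).2.code) key) u' < R then
        pack R (table (fun k : Key M => stateNum M (transition M k).1) key)
          (moveInput s (table (fun k : Key M => (transition M k).2.1.code) key) p)
          (moveHead (table (fun k : Key M => ((transition M k).2.2 .work).2.code) key) u)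
          (writeNum u t (table (fun k : Key M => ((transition M k).2.2 .work).1.toNat) key))
          (moveHead (table (fun k : Key M => ((transition M k).2.2 .cat).2.code) key) u')
          (writeNum u' t' (table (fun k : Key M => ((transition M k).2.2 .cat).1.toNat) key))
      else trashCode M R
    else trashCode M R
  else trashCode M R

/-- The successor of the configuration with code `C`. -/
noncomputable def delta (M : Machine CatTape) (x : List Bool) (R : ℕ) (o : Bool) (C : ℕ) : ℕ :=
  if numStates M ≤ C / R / R / R / R / R then C
  else if outputNum M (C / R / R / R / R / R) = 1 then haltCode M R true
  else if outputNum M (C / R / R / R / R / R) = 2 then haltCode M R false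
  else succCode M R (readInput x (C / R / R / R / R % R)).code
    (keyNum (C / R / R / R / R / R) (readInput x (C / R / R / R / R % R)).code
      (symOf (C / R / R / R % R) (C / R / R % R)) (symOf (C / R % R) (C % R)) o.toNat)
    (C / R / R / R / R % R) (C / R / R / R % R) (C / R / R % R) (C / R % R) (C % R)

section LinSpace

variable {a : ℕ} {f g h f' g' : List Bool → (Fin a → ℕ) → ℕ} {M : Machine CatTape}

open LinSpace

theorem linSpace_symOf (hf : LinSpace f) (hg : LinSpace g) :
    LinSpace fun x v => symOf (f x v) (g x v) :=
  ite_eq hf (const 1) zero ((const 2).add ((hg.div hf).mod (const 2)))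

theorem linSpace_moveInput (hf : LinSpace f) (hg : LinSpace g) (hh : LinSpace h) :
    LinSpace fun x v => moveInput (f x v) (g x v) (h x v) :=
  ite_eq hg zero hh.pred (ite_eq hg (const 1) hh (ite_eq hf (const 1) hh hh.add_one))

theorem linSpace_moveHead (hf : LinSpace f) (hg : LinSpace g) :
    LinSpace fun x v => moveHead (f x v) (g x v) :=
  ite_eq hf zero (ite_eq hg (const 1) (const 1) (hg.div (const 2)))
    (ite_eq hf (const 1) hg ((const 2).mul hg))

theorem linSpace_writeNum (hf : LinSpace f) (hg : LinSpace g) (hh : LinSpace h) :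
    LinSpace fun x v => writeNum (f x v) (g x v) (h x v) :=
  ite_eq hf (const 1) hg ((hg.sub (hf.mul ((hg.div hf).mod (const 2)))).add (hf.mul hh))

theorem linSpace_pack {r q p u t u' t' : List Bool → (Fin a → ℕ) → ℕ} (hr : LinSpace r)
    (hq : LinSpace q) (hp : LinSpace p) (hu : LinSpace u) (ht : LinSpace t) (hu' : LinSpace u')
    (ht' : LinSpace t') : LinSpace fun x v =>
      pack (r x v) (q x v) (p x v) (u x v) (t x v) (u' x v) (t' x v) :=
  ((((((((((hq.mul hr).add hp).mul hr).add hu).mul hr).add ht).mul hr).add hu').mul hr).add ht')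

theorem linSpace_haltCode (hf : LinSpace f) (b : Bool) :
    LinSpace fun x v => haltCode M (f x v) b :=
  linSpace_pack hf (const _) zero zero zero zero (const _)

theorem linSpace_delta (hf : LinSpace f) (hg : LinSpace g) (o : Bool) :
    LinSpace fun x v => delta M x (f x v) o (g x v) := by
  have hM := M.finite_state
  have d1 := hg.div hf
  have d2 := d1.div hf
  have d3 := d2.div hf
  have d4 := d3.div hf
  have d5 := d4.div hf
  have hout : LinSpace fun x v => outputNum M
      (g x v / f x v / f x v / f x v / f x v / f x v) := by
    obtain ⟨B, hB⟩ := extend_eventually_zero (stateNum M) (fun q => match M.output q with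
      | none => 0
      | some true => 1
      | some false => 2)
    exact LinSpace.table hB d5
  have hs := input (d4.mod hf)
  have hkey := (((((((d5.mul (const 4)).add hs).mul (const 4)).add
    (linSpace_symOf (d3.mod hf) (d2.mod hf))).mul (const 4)).add
    (linSpace_symOf (d1.mod hf) (hg.mod hf))).mul (const 2)).add (const (a := a) o.toNat)
  have htab := fun t : Key M → ℕ => linSpace_table t hkey
  have htrash : LinSpace fun x v => trashCode M (f x v) :=
    linSpace_pack hf (const _) zero zero zero (const _) zero
  have hp := linSpace_moveInput hs (htab fun k => (transition M k).2.1.code) (d4.mod hf)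
  have hu := linSpace_moveHead (htab fun k => ((transition M k).2.2 .work).2.code) (d3.mod hf)
  have hu' := linSpace_moveHead (htab fun k => ((transition M k).2.2 .cat).2.code) (d1.mod hf)
  have ht := linSpace_writeNum (d3.mod hf) (d2.mod hf)
    (htab fun k => ((transition M k).2.2 .work).1.toNat)
  have ht' := linSpace_writeNum (d1.mod hf) (hg.mod hf)
    (htab fun k => ((transition M k).2.2 .cat).1.toNat)
  have hsucc := ite_lt hp hf (ite_lt hu hf (ite_lt hu' hf (linSpace_pack hf
    (htab fun k => stateNum M (transition M k).1) hp hu ht hu' ht') htrash) htrash) htrash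
  exact ite_le (const _) d5 hg (ite_eq hout (const 1) (linSpace_haltCode hf true)
    (ite_eq hout (const 2) (linSpace_haltCode hf false) hsucc))

end LinSpace

/-- A configuration that obeys the bounds belonging to `g`. -/
structure Bounded {M : Machine CatTape} (x : List Bool) (g : ℕ) (C : M.Config) : Prop where
  inputHead_le : C.inputHead ≤ x.length + 1
  inputHead_lt : C.inputHead < 2 ^ (g + 1)
  head_le : ∀ i, C.head i ≤ g
  tape_eq : ∀ i, ∀ p ≥ g, C.tape i p = false

/-- The code of a configuration. -/
noncomputable def configCode {M : Machine CatTape} (g : ℕ) (C : M.Config) : ℕ :=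
  pack (2 ^ (g + 1)) (stateNum M C.state) C.inputHead (2 ^ C.head .work) (tapeNum g (C.tape .work))
    (2 ^ C.head .cat) (tapeNum g (C.tape .cat))

/-! ### The chain of codes imitates the machine -/

section

variable {M : Machine CatTape} {x : List Bool} {g : ℕ} {C D : M.Config}

theorem two_pow_head_lt {h g : ℕ} (hh : h ≤ g) : 2 ^ h < 2 ^ (g + 1) :=
  Nat.pow_lt_pow_right (by omega) (by omega)

theorem Bounded.unpack (h : Bounded x g C) :
    configCode g C / 2 ^ (g + 1) / 2 ^ (g + 1) / 2 ^ (g + 1) / 2 ^ (g + 1) / 2 ^ (g + 1) =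
      stateNum M C.state ∧
    configCode g C / 2 ^ (g + 1) / 2 ^ (g + 1) / 2 ^ (g + 1) / 2 ^ (g + 1) % 2 ^ (g + 1) =
      C.inputHead ∧
    configCode g C / 2 ^ (g + 1) / 2 ^ (g + 1) / 2 ^ (g + 1) % 2 ^ (g + 1) = 2 ^ C.head .work ∧
    configCode g C / 2 ^ (g + 1) / 2 ^ (g + 1) % 2 ^ (g + 1) = tapeNum g (C.tape .work) ∧
    configCode g C / 2 ^ (g + 1) % 2 ^ (g + 1) = 2 ^ C.head .cat ∧
    configCode g C % 2 ^ (g + 1) = tapeNum g (C.tape .cat) :=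
  Catalytic.unpack h.inputHead_lt (two_pow_head_lt (h.head_le _)) (tapeNum_lt _ _)
    (two_pow_head_lt (h.head_le _)) (tapeNum_lt _ _)

theorem Bounded.code_lt (h : Bounded x g C) : configCode g C < numStates M * (2 ^ (g + 1)) ^ 5 :=
  pack_lt (stateNum_lt M _) h.inputHead_lt (two_pow_head_lt (h.head_le _)) (tapeNum_lt _ _)
    (two_pow_head_lt (h.head_le _)) (tapeNum_lt _ _)

/-- Cells from `g` on are empty in a bounded configuration, so its code forgets nothing but the
coins. -/
theorem Bounded.code_injective (hC : Bounded x g C) (hD : Bounded x g D)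
    (h : configCode g C = configCode g D) (h' : C.coins = D.coins) : C = D := by
  have h1 := hC.unpack
  have h2 := hD.unpack
  rw [h] at h1
  obtain ⟨a1, a2, a3, a4, a5, a6⟩ := h1
  obtain ⟨b1, b2, b3, b4, b5, b6⟩ := h2
  rcases C with ⟨q, p, hd, t, cs⟩
  rcases D with ⟨q', p', hd', t', cs'⟩
  dsimp only at *
  have e1 := stateNum_injective M (a1.symm.trans b1)
  have e2 := a2.symm.trans b2
  have e3 := Nat.pow_right_injective (le_refl 2) (a3.symm.trans b3)
  have e4 := tapeNum_injective (hC.tape_eq _) (hD.tape_eq _) (a4.symm.trans b4)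
  have e5 := Nat.pow_right_injective (le_refl 2) (a5.symm.trans b5)
  have e6 := tapeNum_injective (hC.tape_eq _) (hD.tape_eq _) (a6.symm.trans b6)
  subst e1 e2 h'
  congr 1
  · funext i; cases i
    exacts [e3, e5]
  · funext i; cases i
    exacts [e4, e6]

theorem delta_of_numStates_le {R A : ℕ} {b : Bool} (h : numStates M ≤ A / R / R / R / R / R) :
    delta M x R b A = A := by
  rw [delta, if_pos h]

theorem delta_haltCode {R : ℕ} (hR : 2 ≤ R) (b o : Bool) :
    delta M x R o (haltCode M R b) = haltCode M R b := by
  refine delta_of_numStates_le ?_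
  have : b.toNat < R := (Bool.toNat_lt b).trans_le hR
  rw [haltCode, (Catalytic.unpack (by omega) (by omega) (by omega) (by omega) this).1]

theorem delta_trashCode {R : ℕ} (hR : 2 ≤ R) (o : Bool) :
    delta M x R o (trashCode M R) = trashCode M R := by
  refine delta_of_numStates_le ?_
  rw [trashCode, (Catalytic.unpack (by omega) (by omega) (by omega) (by omega) (by omega)).1]

theorem Bounded.delta_halt (h : Bounded x g C) {b : Bool} (hb : M.output C.state = some b)
    (o : Bool) : delta M x (2 ^ (g + 1)) o (configCode g C) = haltCode M (2 ^ (g + 1)) b := by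
  have h1 := h.unpack.1
  have h2 : outputNum M (stateNum M C.state) = if b then 1 else 2 := by
    rw [outputNum, (stateNum_injective M).extend_apply, hb]
    cases b <;> rfl
  rw [delta, h1, if_neg (by have := stateNum_lt M C.state; omega), h2]
  cases b <;> simp

/-- The configuration after a transition with random bit `o`. -/
def successor (M : Machine CatTape) (x : List Bool) (C : M.Config) (o : Bool)
    (rest : List Bool) : M.Config :=
  M.applyNext x C (if M.tosses C.state then some o else none) rest

theorem Bounded.successor_tape (h : Bounded x g C) (o : Bool) (rest : List Bool) :
    ∀ i, ∀ p ≥ g, (successor M x C o rest).tape i p = false := by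
  intro i
  exact (writeNum_tapeNum (h.tape_eq i) _ (h.head_le i)).1

/-- Each component of the transition is matched with its arithmetic counterpart. The unread coins
`rest` are arbitrary because codes ignore them. A represented head stays below `2 ^ (g + 1)` exactly
if its position is at most `g`. -/
theorem Bounded.delta_succ (h : Bounded x g C) (hC : M.output C.state = none) (o : Bool)
    (rest : List Bool) : delta M x (2 ^ (g + 1)) o (configCode g C) =
      if (successor M x C o rest).inputHead < 2 ^ (g + 1) then
        if (successor M x C o rest).head .work ≤ g then
          if (successor M x C o rest).head .cat ≤ g then configCode g (successor M x C o rest)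
          else trashCode M (2 ^ (g + 1))
        else trashCode M (2 ^ (g + 1))
      else trashCode M (2 ^ (g + 1)) := by
  obtain ⟨h1, h2, h3, h4, h5, h6⟩ := h.unpack
  have ho : outputNum M (stateNum M C.state) = 0 := by
    rw [outputNum, (stateNum_injective M).extend_apply, hC]
  rw [delta, h1, if_neg (by have := stateNum_lt M C.state; omega), ho, if_neg (by omega),
    if_neg (by omega), h2, h3, h4, h5, h6, symOf_tapeNum (h.tape_eq _),
    symOf_tapeNum (h.tape_eq _)]
  have hk : keyNum (stateNum M C.state) (readInput x C.inputHead).code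
      (readTape (C.tape .work) (C.head .work)).code (readTape (C.tape .cat) (C.head .cat)).code
      o.toNat = Key.code ((C.state, readInput x C.inputHead,
        readTape (C.tape .work) (C.head .work), readTape (C.tape .cat) (C.head .cat), o) : Key M) :=
    rfl
  set k : Key M := (C.state, readInput x C.inputHead,
        readTape (C.tape .work) (C.head .work), readTape (C.tape .cat) (C.head .cat), o) with hkdef
  have hfun : (fun i => readTape (C.tape i) (C.head i)) =
      (fun i => match i with | .work => k.2.2.1 | .cat => k.2.2.2.1) := by
    funext i; cases i <;> rfl
  have ht : successor M x C o rest =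
      { state := (transition M k).1
        inputHead := min (move C.inputHead (transition M k).2.1) (x.length + 1)
        head := fun i => move (C.head i) ((transition M k).2.2 i).2
        tape := fun i => writeTape (C.tape i) ((transition M k).2.2 i).1 (C.head i)
        coins := rest } := by
    simp only [successor, applyNext, hfun]
    rfl
  rw [hk, succCode, ht]
  simp only [table_code, moveInput_eq x _ h.inputHead_le, moveHead_two_pow, configCode,
    (writeNum_tapeNum (h.tape_eq _) _ (h.head_le _)).2, Nat.pow_lt_pow_iff_right (le_refl 2),
    Nat.lt_succ_iff]

theorem Bounded.of_successor (h : Bounded x g C) {o : Bool} {rest : List Bool}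
    (h1 : (successor M x C o rest).inputHead < 2 ^ (g + 1))
    (h2 : ∀ i, (successor M x C o rest).head i ≤ g) : Bounded x g (successor M x C o rest) :=
  ⟨min_le_right _ _, h1, h2, h.successor_tape o rest⟩

end

end Catalytic

namespace Catalytic

open Machine

/-! ### Probabilities -/

section

variable {m : ℕ}

theorem prob_nonneg (P : (Fin m → Bool) → Prop) : 0 ≤ prob P := by
  unfold prob; positivity

theorem prob_mono {P Q : (Fin m → Bool) → Prop} (h : ∀ r, P r → Q r) : prob P ≤ prob Q := by
  refine div_le_div_of_nonneg_right ?_ (by positivity)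
  exact_mod_cast Nat.card_le_card_of_injective (Subtype.map id h)
    (Subtype.map_injective h Function.injective_id)

theorem prob_congr {P Q : (Fin m → Bool) → Prop} (h : ∀ r, P r ↔ Q r) : prob P = prob Q :=
  le_antisymm (prob_mono fun r => (h r).1) (prob_mono fun r => (h r).2)

theorem prob_true {P : (Fin m → Bool) → Prop} (h : ∀ r, P r) : prob P = 1 := by
  have : Nat.card {r : Fin m → Bool // P r} = 2 ^ m := by
    rw [Nat.card_congr (Equiv.subtypeUnivEquiv h)]
    simp
  rw [prob, this]
  simp

theorem prob_false {P : (Fin m → Bool) → Prop} (h : ∀ r, ¬ P r) : prob P = 0 := by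
  have : IsEmpty {r : Fin m → Bool // P r} := ⟨fun r => h r.1 r.2⟩
  simp [prob]

theorem prob_le_one (P : (Fin m → Bool) → Prop) : prob P ≤ 1 := by
  rw [← prob_true (m := m) (P := fun _ => True) fun _ => trivial]
  exact prob_mono fun _ _ => trivial

theorem prob_add_le_one {P Q : (Fin m → Bool) → Prop} (h : ∀ r, P r → ¬ Q r) :
    prob P + prob Q ≤ 1 := by
  have h1 : Nat.card {r : Fin m → Bool // P r} + Nat.card {r : Fin m → Bool // Q r} ≤ 2 ^ m := by
    rw [← Nat.card_sum]
    have : Nat.card (Fin m → Bool) = 2 ^ m := by simp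
    rw [← this]
    refine Nat.card_le_card_of_injective (Sum.elim Subtype.val Subtype.val) ?_
    rintro (⟨a, ha⟩ | ⟨a, ha⟩) (⟨b, hb⟩ | ⟨b, hb⟩) hab
    · cases hab; rfl
    · cases hab; exact absurd hb (h _ ha)
    · cases hab; exact absurd ha (h _ hb)
    · cases hab; rfl
  rw [prob, prob, ← add_div, div_le_one (by positivity)]
  exact_mod_cast h1

/-- Conditioning on the first bit, which splits the strings into two copies of the shorter ones. -/
theorem prob_succ (P : (Fin (m + 1) → Bool) → Prop) :
    prob P = (prob (fun r => P (Fin.cons false r)) + prob (fun r => P (Fin.cons true r))) / 2 := by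
  have h : Nat.card {r : Fin (m + 1) → Bool // P r} =
      Nat.card {r : Fin m → Bool // P (Fin.cons false r)} +
        Nat.card {r : Fin m → Bool // P (Fin.cons true r)} := by
    rw [← Nat.card_sum]
    refine Nat.card_congr (Equiv.ofBijective (Sum.elim (fun r => ⟨Fin.cons false r.1, r.2⟩)
      (fun r => ⟨Fin.cons true r.1, r.2⟩)) ⟨?_, ?_⟩).symm
    · rintro (⟨a, ha⟩ | ⟨a, ha⟩) (⟨b, hb⟩ | ⟨b, hb⟩) hab <;>
        simp [Fin.cons_inj] at hab ⊢ <;> exact hab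
    · rintro ⟨r, hr⟩
      obtain ⟨b, r, rfl⟩ : ∃ b r', r = Fin.cons b r' := ⟨r 0, Fin.tail r, (Fin.cons_self_tail r).symm⟩
      cases b
      · exact ⟨.inl ⟨r, hr⟩, rfl⟩
      · exact ⟨.inr ⟨r, hr⟩, rfl⟩
  rw [prob, prob, prob, h]
  push_cast
  rw [pow_succ]
  field_simp

end

/-! ### Runs and the chain of codes -/

section

variable {M : Machine CatTape} {x : List Bool} {g m : ℕ} {C D : M.Config} {b : Bool}

/-- The same configuration with other unread random bits. -/
def withCoins (C : M.Config) (l : List Bool) : M.Config := { C with coins := l }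

theorem haltsIn_of_output (h : M.output C.state = some b) {b' : Bool} (hD : M.HaltsIn x C D b') :
    b' = b := by
  rcases hD.1.cases_head with rfl | ⟨E, hE, _⟩
  · exact Option.some_injective _ (hD.2.symm.trans h)
  · simp [step, h] at hE

theorem exists_haltsIn_iff (h : M.step x C = some D) {b' : Bool} :
    (∃ E, M.HaltsIn x C E b') ↔ ∃ E, M.HaltsIn x D E b' := by
  refine ⟨fun ⟨E, hE⟩ => ?_, fun ⟨E, hE⟩ => ⟨E, hE.1.head h, hE.2⟩⟩
  rcases hE.1.cases_head with rfl | ⟨F, hF, hr⟩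
  · have := hE.2
    simp [step, this] at h
  · rw [h] at hF
    cases hF
    exact ⟨E, hr, hE.2⟩

/-- The machine halts for each choice of `m` random bits. -/
def AlwaysHalts (x : List Bool) (m : ℕ) (C : M.Config) : Prop :=
  ∀ r : Fin m → Bool, ∃ D b, M.HaltsIn x (withCoins C (List.ofFn r)) D b

theorem step_withCoins_toss (h : M.output C.state = none) (ht : M.tosses C.state = true)
    (o : Bool) (l : List Bool) :
    M.step x (withCoins C (o :: l)) = some (withCoins (successor M x C o []) l) := by
  simp only [step, withCoins, h, Option.isSome_none, ht, successor]
  rfl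

theorem step_withCoins_of_not_toss (h : M.output C.state = none) (ht : M.tosses C.state = false)
    (o : Bool) (l : List Bool) :
    M.step x (withCoins C l) = some (withCoins (successor M x C o []) l) := by
  simp only [step, withCoins, h, Option.isSome_none, ht, successor]
  rfl

/-- This brings both kinds of steps into the form of `hitProb_succ`: a step without a toss is viewed
as a toss whose outcome is ignored. Accordingly `m'` is `m` or `m - 1`. -/
theorem AlwaysHalts.exists_step (hC : AlwaysHalts x m C) (h : M.output C.state = none) :
    ∃ m', (∀ (o : Bool) (r' : Fin m' → Bool), ∃ r : Fin m → Bool,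
      M.step x (withCoins C (List.ofFn r)) =
        some (withCoins (successor M x C o []) (List.ofFn r'))) ∧
      ∀ Q : M.Config → Prop, (∀ A B, M.step x A = some B → (Q A ↔ Q B)) →
        prob (fun r : Fin m → Bool => Q (withCoins C (List.ofFn r))) =
        (prob (fun r : Fin m' → Bool => Q (withCoins (successor M x C false []) (List.ofFn r))) +
        prob (fun r : Fin m' → Bool => Q (withCoins (successor M x C true []) (List.ofFn r)))) / 2 := by
  cases ht : M.tosses C.state with
  | false =>
    refine ⟨m, fun o r' => ⟨r', step_withCoins_of_not_toss h ht o _⟩, fun Q hQ => ?_⟩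
    have key : ∀ o, prob (fun r : Fin m → Bool => Q (withCoins C (List.ofFn r))) =
        prob (fun r : Fin m → Bool => Q (withCoins (successor M x C o []) (List.ofFn r))) :=
      fun o => prob_congr fun r => hQ _ _ (step_withCoins_of_not_toss h ht o _)
    rw [← key, ← key]
    ring
  | true =>
    cases m with
    | zero =>
      -- A machine that asks for a coin when none is left is stuck without having halted.
      obtain ⟨D, b, hD⟩ := hC Fin.elim0
      exfalso
      rcases hD.1.cases_head with rfl | ⟨E, hE, _⟩
      · have := hD.2
        simp [withCoins, h] at this
      · simp [withCoins, step, h, ht] at hE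
    | succ m =>
      refine ⟨m, fun o r' => ⟨Fin.cons o r', ?_⟩, fun Q hQ => ?_⟩
      · rw [List.ofFn_cons]
        exact step_withCoins_toss h ht o _
      · rw [prob_succ]
        simp only [List.ofFn_cons]
        rw [prob_congr fun r => hQ _ _ (step_withCoins_toss h ht false _),
          prob_congr fun r => hQ _ _ (step_withCoins_toss h ht true _)]

theorem haltCode_injective (M : Machine CatTape) {R : ℕ} {b b' : Bool}
    (h : haltCode M R b = haltCode M R b') : b = b' := by
  have : b.toNat = b'.toNat := by simpa [haltCode, pack] using h
  cases b <;> cases b' <;> simp at this ⊢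

theorem le_haltCode (M : Machine CatTape) (R : ℕ) (b : Bool) :
    numStates M * R ^ 5 ≤ haltCode M R b := by
  rw [haltCode, pack, show R ^ 5 = R * R * R * R * R by ring]
  simp only [add_zero, mul_assoc]
  omega

theorem Bounded.code_ne_haltCode (h : Bounded x g C) (b : Bool) :
    configCode g C ≠ haltCode M (2 ^ (g + 1)) b :=
  (h.code_lt.trans_le (le_haltCode M _ b)).ne

theorem trashCode_ne_haltCode (M : Machine CatTape) (b : Bool) {R : ℕ} (hR : 2 ≤ R) :
    trashCode M R ≠ haltCode M R b := by
  intro h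
  have : R = b.toNat := by
    simp only [haltCode, trashCode, pack, add_zero, add_mul, one_mul] at h
    omega
  cases b <;> simp at this <;> omega

theorem two_le_two_pow_succ (g : ℕ) : 2 ≤ 2 ^ (g + 1) := by
  have := Nat.one_lt_two_pow (n := g + 1) (by omega)
  omega

/-- A halting configuration needs one more step to reach its absorbing code; hence `t + 1`. -/
theorem hitProb_delta_halt (h : Bounded x g C) {b' : Bool} (hb : M.output C.state = some b')
    (t : ℕ) : hitProb (delta M x (2 ^ (g + 1))) (haltCode M (2 ^ (g + 1)) b) (t + 1)
      (configCode g C) = if b' = b then 1 else 0 := by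
  rw [hitProb_succ, h.delta_halt hb, h.delta_halt hb,
    hitProb_of_fixed (fun o => delta_haltCode (two_le_two_pow_succ g) b' o)]
  by_cases hbb : b' = b
  · rw [hbb]; simp
  · rw [if_neg hbb, if_neg fun h => hbb (haltCode_injective M h)]
    simp

theorem Bounded.withCoins_iff {l : List Bool} : Bounded x g (withCoins C l) ↔ Bounded x g C :=
  ⟨fun h => ⟨h.1, h.2, h.3, h.4⟩, fun h => ⟨h.1, h.2, h.3, h.4⟩⟩

/-- The chain of codes never overestimates the probability of an output. -/
theorem hitProb_le_prob (t : ℕ) (hb : Bounded x g C) (hC : AlwaysHalts x m C) :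
    hitProb (delta M x (2 ^ (g + 1))) (haltCode M (2 ^ (g + 1)) b) t (configCode g C) ≤
      prob fun r : Fin m → Bool => ∃ D, M.HaltsIn x (withCoins C (List.ofFn r)) D b := by
  induction t generalizing C m with
  | zero =>
    rw [hitProb_zero, if_neg (hb.code_ne_haltCode b)]
    exact prob_nonneg _
  | succ t ih =>
    cases ho : M.output C.state with
    | some b' =>
      rw [hitProb_delta_halt hb ho]
      split_ifs with hbb
      · rw [prob_true fun r => ⟨_, .refl, by rw [← hbb]; exact ho⟩]
      · exact prob_nonneg _
    | none =>
      obtain ⟨m', h1, h2⟩ := hC.exists_step ho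
      rw [h2 (fun A => ∃ D, M.HaltsIn x A D b) fun A B h => exists_haltsIn_iff h, hitProb_succ]
      have key : ∀ o, hitProb (delta M x (2 ^ (g + 1))) (haltCode M (2 ^ (g + 1)) b) t
          (delta M x (2 ^ (g + 1)) o (configCode g C)) ≤ prob fun r : Fin m' → Bool =>
            ∃ D, M.HaltsIn x (withCoins (successor M x C o []) (List.ofFn r)) D b := by
        intro o
        -- Trash is absorbing and differs from the halting codes, so leaving the bounds only loses
        -- probability. This makes the estimate valid for every `g`.
        have htrash : hitProb (delta M x (2 ^ (g + 1))) (haltCode M (2 ^ (g + 1)) b) t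
            (trashCode M (2 ^ (g + 1))) = 0 := by
          rw [hitProb_of_fixed (fun o => delta_trashCode (two_le_two_pow_succ g) o),
            if_neg (trashCode_ne_haltCode M b (two_le_two_pow_succ g))]
        rw [hb.delta_succ ho o []]
        split_ifs with a1 a2 a3
        · refine ih (hb.of_successor a1 fun i => ?_) fun r' => ?_
          · cases i
            exacts [a2, a3]
          · obtain ⟨r, hr⟩ := h1 o r'
            obtain ⟨D, b', hD⟩ := hC r
            obtain ⟨E, hE⟩ := (exists_haltsIn_iff hr).1 ⟨D, hD⟩
            exact ⟨E, b', hE⟩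
        all_goals
          rw [htrash]
          exact prob_nonneg _
      have := key false
      have := key true
      linarith

/-- The machine halts after exactly `t` steps. -/
def HaltsAt (M : Machine CatTape) (x : List Bool) : ℕ → M.Config → Prop
  | 0, C => (M.output C.state).isSome
  | t + 1, C => ∃ D, M.step x C = some D ∧ HaltsAt M x t D

theorem HaltsAt.unique {t t' : ℕ} (h : HaltsAt M x t C) (h' : HaltsAt M x t' C) : t = t' := by
  induction t generalizing C t' with
  | zero =>
    cases t' with
    | zero => rfl
    | succ t' =>
      obtain ⟨D, hD, _⟩ := h'
      simp only [HaltsAt] at h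
      simp [step, h] at hD
  | succ t ih =>
    obtain ⟨D, hD, hr⟩ := h
    cases t' with
    | zero =>
      simp only [HaltsAt] at h'
      simp [step, h'] at hD
    | succ t' =>
      obtain ⟨D', hD', hr'⟩ := h'
      rw [hD] at hD'
      cases hD'
      rw [ih hr hr']

theorem exists_haltsAt (h : M.HaltsIn x C D b) : ∃ t, HaltsAt M x t C := by
  obtain ⟨h, hb⟩ := h
  induction h using Relation.ReflTransGen.head_induction_on with
  | refl => exact ⟨0, by simp [HaltsAt, hb]⟩
  | head h _ ih =>
    obtain ⟨t, ht⟩ := ih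
    exact ⟨t + 1, _, h, ht⟩

theorem HaltsAt.exists_reaches {t : ℕ} (h : HaltsAt M x t C) {i : ℕ} (hi : i ≤ t) :
    ∃ D, M.Reaches x C D ∧ HaltsAt M x (t - i) D := by
  induction i generalizing C t with
  | zero => exact ⟨C, .refl, h⟩
  | succ i ih =>
    obtain ⟨t, rfl⟩ : ∃ t', t = t' + 1 := ⟨t - 1, by omega⟩
    obtain ⟨E, hE, hr⟩ := h
    obtain ⟨D, hD, hr'⟩ := ih hr (by omega)
    exact ⟨D, hD.head hE, by rwa [show t + 1 - (i + 1) = t - i by omega]⟩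

theorem step_coins_suffix (h : M.step x C = some D) : D.coins <:+ C.coins := by
  rw [step] at h
  split_ifs at h with h1 h2
  · cases hc : C.coins with
    | nil => rw [hc] at h; cases h
    | cons a l =>
      rw [hc] at h
      cases h
      exact List.suffix_cons a l
  · cases h
    exact List.suffix_refl _

theorem reaches_coins_suffix (h : M.Reaches x C D) : D.coins <:+ C.coins := by
  induction h with
  | refl => exact List.suffix_refl _
  | tail _ h ih => exact (step_coins_suffix h).trans ih

/-- A machine in bounded space halts within the number of its configurations. -/
theorem HaltsAt.le {t : ℕ} (h : HaltsAt M x t C) (hb : ∀ D, M.Reaches x C D → Bounded x g D) :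
    t < numStates M * (2 ^ (g + 1)) ^ 5 * (C.coins.length + 1) := by
  have : Nonempty M.Config := ⟨C⟩
  choose! d hd hd' using fun (i : ℕ) (hi : i ≤ t) => h.exists_reaches hi
  -- The code and the number of unread coins determine a configuration of the run, and the remaining
  -- time until halting tells the configurations apart.
  have hinj : Set.InjOn (fun i => (configCode g (d i), (d i).coins.length))
      (Finset.range (t + 1) : Set ℕ) := by
    intro i hi j hj hij
    simp only [Finset.coe_range, Set.mem_Iio] at hi hj
    simp only [Prod.mk.injEq] at hij
    -- Both lists are suffixes of the same list, hence determined by their lengths.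
    have hc : (d i).coins = (d j).coins := by
      have h1 := List.suffix_iff_eq_drop.1 (reaches_coins_suffix (hd i (by omega)))
      have h2 := List.suffix_iff_eq_drop.1 (reaches_coins_suffix (hd j (by omega)))
      rw [h1, h2, hij.2]
    have he := (hb _ (hd i (by omega))).code_injective (hb _ (hd j (by omega))) hij.1 hc
    have h3 := hd' i (by omega)
    rw [he] at h3
    have := h3.unique (hd' j (by omega))
    omega
  have := Finset.card_le_card_of_injOn (t := Finset.range (numStates M * (2 ^ (g + 1)) ^ 5) ×ˢ
    Finset.range (C.coins.length + 1)) _ (fun i hi => ?_) hinj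
  · simp only [Finset.card_range, Finset.card_product] at this
    omega
  · simp only [Finset.coe_range, Set.mem_Iio] at hi
    simp only [Finset.coe_product, Set.mem_prod, Finset.coe_range, Set.mem_Iio]
    exact ⟨(hb _ (hd i (by omega))).code_lt, Nat.lt_succ_of_le
      (reaches_coins_suffix (hd i (by omega))).length_le⟩

/-- The machine halts within the bounds belonging to `g` for each choice of `m` random bits. -/
def Safe (x : List Bool) (g m : ℕ) (C : M.Config) : Prop :=
  AlwaysHalts x m C ∧ ∀ (r : Fin m → Bool) D, M.Reaches x (withCoins C (List.ofFn r)) D →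
    Bounded x g D

theorem Safe.bounded (h : Safe x g m C) : Bounded x g C :=
  Bounded.withCoins_iff.1 (h.2 (fun _ => false) _ .refl)

/-- A safe configuration never leads to trash, so here the chain follows the machine exactly. -/
theorem Safe.successor (h : Safe x g m C) (ho : M.output C.state = none) (o : Bool) :
    (∃ m', Safe x g m' (successor M x C o [])) ∧
    delta M x (2 ^ (g + 1)) o (configCode g C) = configCode g (successor M x C o []) := by
  obtain ⟨m', h1, -⟩ := h.1.exists_step ho
  have hs : Safe x g m' (Catalytic.successor M x C o []) := by
    refine ⟨fun r' => ?_, fun r' D hD => ?_⟩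
    · obtain ⟨r, hr⟩ := h1 o r'
      obtain ⟨D, b', hD⟩ := h.1 r
      obtain ⟨E, hE⟩ := (exists_haltsIn_iff hr).1 ⟨D, hD⟩
      exact ⟨E, b', hE⟩
    · obtain ⟨r, hr⟩ := h1 o r'
      exact h.2 r D (hD.head hr)
  refine ⟨⟨m', hs⟩, ?_⟩
  rw [h.bounded.delta_succ ho o [], if_pos hs.bounded.inputHead_lt, if_pos (hs.bounded.head_le _),
    if_pos (hs.bounded.head_le _)]

/-- The chain of codes does not underestimate the probability of an output within `t` steps. -/
theorem prob_le_hitProb (t : ℕ) (hC : Safe x g m C)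
    (ht : ∀ r : Fin m → Bool, ∃ t' ≤ t, HaltsAt M x t' (withCoins C (List.ofFn r))) {n : ℕ}
    (hn : t + 1 ≤ n) : (prob fun r : Fin m → Bool =>
      ∃ D, M.HaltsIn x (withCoins C (List.ofFn r)) D b) ≤
      hitProb (delta M x (2 ^ (g + 1))) (haltCode M (2 ^ (g + 1)) b) n (configCode g C) := by
  -- The additional step leads from a halting configuration to its absorbing code.
  obtain ⟨n, rfl⟩ : ∃ n', n = n' + 1 := ⟨n - 1, by omega⟩
  induction t generalizing C m n with
  | zero =>
    obtain ⟨t', ht', h0⟩ := ht fun _ => false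
    obtain rfl : t' = 0 := by omega
    obtain ⟨b', hb'⟩ := Option.isSome_iff_exists.1 h0
    rw [hitProb_delta_halt hC.bounded hb']
    split_ifs with hbb
    · exact prob_le_one _
    · rw [prob_false]
      rintro r ⟨D, hD⟩
      exact hbb (haltsIn_of_output (C := withCoins C (List.ofFn r)) hb' hD).symm
  | succ t ih =>
    cases ho : M.output C.state with
    | some b' =>
      rw [hitProb_delta_halt hC.bounded ho]
      split_ifs with hbb
      · exact prob_le_one _
      · rw [prob_false]
        rintro r ⟨D, hD⟩
        exact hbb (haltsIn_of_output (C := withCoins C (List.ofFn r)) ho hD).symm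
    | none =>
      obtain ⟨n, rfl⟩ : ∃ n', n = n' + 1 := ⟨n - 1, by omega⟩
      obtain ⟨m', h1, h2⟩ := hC.1.exists_step ho
      rw [h2 (fun A => ∃ D, M.HaltsIn x A D b) fun A B h => exists_haltsIn_iff h, hitProb_succ]
      have key : ∀ o, (prob fun r : Fin m' → Bool => ∃ D,
          M.HaltsIn x (withCoins (Catalytic.successor M x C o []) (List.ofFn r)) D b) ≤
          hitProb (delta M x (2 ^ (g + 1))) (haltCode M (2 ^ (g + 1)) b) (n + 1)
          (delta M x (2 ^ (g + 1)) o (configCode g C)) := by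
        intro o
        rw [(hC.successor ho o).2]
        refine ih ⟨fun r' => ?_, fun r' D hD => ?_⟩ (fun r' => ?_) n (by omega)
        · obtain ⟨r, hr⟩ := h1 o r'
          obtain ⟨D, b', hD⟩ := hC.1 r
          obtain ⟨E, hE⟩ := (exists_haltsIn_iff hr).1 ⟨D, hD⟩
          exact ⟨E, b', hE⟩
        · obtain ⟨r, hr⟩ := h1 o r'
          exact hC.2 r D (hD.head hr)
        · obtain ⟨r, hr⟩ := h1 o r'
          obtain ⟨t', ht', h0⟩ := ht r
          cases t' with
          | zero =>
            have : M.output (withCoins C (List.ofFn r)).state = none := ho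
            simp [HaltsAt, this] at h0
          | succ t' =>
            obtain ⟨D, hD, h0⟩ := h0
            rw [hr] at hD
            cases hD
            exact ⟨t', by omega, h0⟩
      have := key false
      have := key true
      linarith

end

end Catalytic

namespace Catalytic

open Machine

/-! ### Estimating the probability of an output -/

section LinSpace

variable {a : ℕ} {r n l T Z s y i v e acc st md : List Bool → (Fin a → ℕ) → ℕ} {M : Machine CatTape}

open LinSpace

theorem linSpace_code (hn : LinSpace n) (hl : LinSpace l) (hT : LinSpace T) (hst : LinSpace st)
    (hv : LinSpace v) (hi : LinSpace i) (hmd : LinSpace md) {δ : List Bool → (Fin a → ℕ) → Bool → ℕ → ℕ} :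
    LinSpace fun x w => (squaring (δ x w) (n x w) (l x w) (T x w) (Z x w)).code (st x w) (v x w)
      (i x w) (md x w) := by
  have hK := ((((hn.add ((const 2).mul hl)).add hT).add (const 2))).pow_const 4
  exact (((((hst.mul hK).add hv).mul hK).add hi).mul (const 2)).add hmd

theorem linSpace_push (hn : LinSpace n) (hl : LinSpace l) (hT : LinSpace T) (hst : LinSpace st)
    (hy : LinSpace y) (he : LinSpace e) (hacc : LinSpace acc)
    {δ : List Bool → (Fin a → ℕ) → Bool → ℕ → ℕ} :
    LinSpace fun x w => (squaring (δ x w) (n x w) (l x w) (T x w) (Z x w)).push (st x w) (y x w)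
      (e x w) (acc x w) := by
  have hK := ((((hn.add ((const 2).mul hl)).add hT).add (const 2))).pow_const 4
  exact (((((hst.mul hK).add hy).mul hK).add he).mul hK).add hacc

theorem linSpace_arg (hn : LinSpace n) (hy : LinSpace y) (he : LinSpace e)
    {δ : List Bool → (Fin a → ℕ) → Bool → ℕ → ℕ} :
    LinSpace fun x w => (squaring (δ x w) (n x w) (l x w) (T x w) (Z x w)).arg (y x w) (e x w) :=
  ite_eq (he.mod (const 2)) zero (((hy.div hn).mul hn).add (he.div (const 2)))
    (((he.div (const 2)).mul hn).add (hy.mod hn))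

theorem linSpace_comb (hl : LinSpace l) (he : LinSpace e) (hacc : LinSpace acc)
    (hv : LinSpace v) {δ : List Bool → (Fin a → ℕ) → Bool → ℕ → ℕ} :
    LinSpace fun x w => (squaring (δ x w) (n x w) (l x w) (T x w) (Z x w)).comb (y x w) (e x w)
      (acc x w) (v x w) := by
  have hq := ((const 2).mul hl).add_one
  exact ite_eq (he.mod (const 2)) zero (((hacc.div hq).mul hq).add hv)
    (((hacc.div hq).add ((hacc.mod hq).mul hv)).mul hq)

theorem linSpace_out (hl : LinSpace l) (hacc : LinSpace acc)
    {δ : List Bool → (Fin a → ℕ) → Bool → ℕ → ℕ} :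
    LinSpace fun x w => (squaring (δ x w) (n x w) (l x w) (T x w) (Z x w)).out (acc x w) :=
  (hacc.div ((const 2).mul hl).add_one).div ((const 2).mul hl)

theorem linSpace_base (hr : LinSpace r) (hn : LinSpace n) (hl : LinSpace l) (hy : LinSpace y) :
    LinSpace fun x w => (squaring (delta M x (r x w)) (n x w) (l x w) (T x w) (Z x w)).base
      (y x w) :=
  hl.mul ((ite_eq (linSpace_delta hr (hy.div hn) false) (hy.mod hn) (const 1) zero).add
    (ite_eq (linSpace_delta hr (hy.div hn) true) (hy.mod hn) (const 1) zero))

theorem linSpace_stepAux (hr : LinSpace r) (hn : LinSpace n) (hl : LinSpace l) (hT : LinSpace T)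
    (hst : LinSpace st) (hv : LinSpace v) (hi : LinSpace i) (hmd : LinSpace md) :
    LinSpace fun x w => (squaring (delta M x (r x w)) (n x w) (l x w) (T x w) (Z x w)).stepAux
      (st x w) (v x w) (i x w) (md x w) := by
  have hK := ((((hn.add ((const 2).mul hl)).add hT).add (const 2))).pow_const 4
  have d1 := hst.div hK
  have d2 := d1.div hK
  have d3 := d2.div hK
  have hc := linSpace_comb (T := T) (Z := Z) (δ := fun x w => delta M x (r x w)) (n := n)
    (y := fun _ _ => 0) hl (d1.mod hK) (hst.mod hK) hv
  exact ite_eq hmd zero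
    (ite_eq hi zero (linSpace_code hn hl hT hst (linSpace_base hr hn hl hv) zero (const 1))
      (linSpace_code hn hl hT (linSpace_push hn hl hT hst hv zero zero) (linSpace_arg hn hv zero)
        hi.pred zero))
    (ite_eq hi hT (linSpace_code hn hl hT hst hv hi (const 1))
      (ite_lt (d1.mod hK).add_one ((const 2).mul hn)
        (linSpace_code hn hl hT
          (linSpace_push hn hl hT d3 (d2.mod hK) (d1.mod hK).add_one hc)
          (linSpace_arg hn (d2.mod hK) (d1.mod hK).add_one) hi zero)
        (linSpace_code hn hl hT d3 (linSpace_out hl hc) hi.add_one (const 1))))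

theorem linSpace_result (hr : LinSpace r) (hn : LinSpace n) (hl : LinSpace l) (hT : LinSpace T)
    (hZ : LinSpace Z) (hy : LinSpace y) :
    LinSpace fun x w => (squaring (delta M x (r x w)) (n x w) (l x w) (T x w) (Z x w)).result
      (y x w) := by
  have hK := ((((hn.add ((const 2).mul hl)).add hT).add (const 2))).pow_const 4
  have tl : ∀ {f : List Bool → (Fin a → ℕ) → ℕ}, LinSpace f →
      LinSpace fun x (w : Fin (a + 1) → ℕ) => f x fun i => w i.succ :=
    fun hf => comp hf fun i => proj i.succ
  have hs : LinSpace fun _ (w : Fin (a + 1) → ℕ) => w 0 / 2 := (proj 0).div (const 2)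
  have d1 := hs.div (tl hK)
  have h := iterate (g := fun x w => (squaring (delta M x (r x fun i => w i.succ))
    (n x fun i => w i.succ) (l x fun i => w i.succ) (T x fun i => w i.succ)
    (Z x fun i => w i.succ)).step (w 0)) hZ
    (linSpace_code (Z := Z) (δ := fun x w => delta M x (r x w)) hn hl hT zero hy hT zero)
    (linSpace_stepAux (tl hr) (tl hn) (tl hl) (tl hT) (d1.div (tl hK)) (d1.mod (tl hK))
      (hs.mod (tl hK)) ((proj 0).mod (const 2))) hZ
  exact ((h.div (const 2)).div hK).mod hK

end LinSpace

/-- The number of codes. -/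
noncomputable def numCodes (M : Machine CatTape) (R : ℕ) : ℕ := (numStates M + 1) * R ^ 5

/-- The code of the initial configuration with an empty catalytic tape. -/
noncomputable def startCode (M : Machine CatTape) (R : ℕ) : ℕ :=
  pack R (stateNum M M.start) 0 1 0 1 0

open Classical in
/-- The test whether the output `b` has probability above `1 / 2`, in precision given by `g`, `T`
and `l`, with numbers below `Z` only. -/
noncomputable def accept (M : Machine CatTape) (x : List Bool) (b : Bool) (l T g Z : ℕ) : ℕ :=
  if Z ≤ min Z (2 ^ (g + 1)) then 0
  else if Z ≤ min Z ((numCodes M (min Z (2 ^ (g + 1))) + 2 * l + T + 2) ^ (4 * (3 * T + 3))) then 0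
  else if l = 0 then 0
  else if l < (squaring (delta M x (min Z (2 ^ (g + 1)))) (numCodes M (min Z (2 ^ (g + 1)))) l T
    Z).result (startCode M (min Z (2 ^ (g + 1))) * numCodes M (min Z (2 ^ (g + 1))) +
      haltCode M (min Z (2 ^ (g + 1))) b) then 1
  else 0

/-- Search for parameters below `Z` for which `b` is accepted. -/
noncomputable def acceptSum (M : Machine CatTape) (x : List Bool) (b : Bool) (Z : ℕ) : ℕ :=
  ∑ g ∈ Finset.range Z, ∑ T ∈ Finset.range Z, ∑ l ∈ Finset.range Z, accept M x b l T g Z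

/-- The verdict with numbers below `Z`: `1` for `true`, `2` for `false`, `0` for no verdict. -/
noncomputable def verdict (M : Machine CatTape) (x : List Bool) (Z : ℕ) : ℕ :=
  if acceptSum M x true Z = 0 then if acceptSum M x false Z = 0 then 0 else 2 else 1

open LinSpace in
theorem linSpace_accept (M : Machine CatTape) (b : Bool) :
    LinSpace fun x (v : Fin 4 → ℕ) => accept M x b (v 0) (v 1) (v 2) (v 3) := by
  have hR : LinSpace fun _ (v : Fin 4 → ℕ) => Min.min (v 3) (2 ^ (v 2 + 1)) :=
    min_pow (const 2) (proj 2).add_one (proj 3)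
  have hN : LinSpace fun _ (v : Fin 4 → ℕ) => numCodes M (Min.min (v 3) (2 ^ (v 2 + 1))) :=
    (const _).mul (hR.pow_const 5)
  have hy := ((linSpace_pack hR (const (stateNum M M.start)) zero (const 1) zero (const 1)
    zero).mul hN).add (linSpace_haltCode (M := M) hR b)
  exact ite_le (proj 3) hR zero (ite_le (proj 3)
    (min_pow (((hN.add ((const 2).mul (proj 0))).add (proj 1)).add (const 2))
      ((const 4).mul (((const 3).mul (proj 1)).add (const 3))) (proj 3)) zero
    (ite_eq (proj 0) zero zero (ite_lt (proj 0)
      (linSpace_result hR hN (proj 0) (proj 1) (proj 3) hy) (const 1) zero)))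

theorem linSpace_acceptSum (M : Machine CatTape) (b : Bool) :
    LinSpace fun x (v : Fin 1 → ℕ) => acceptSum M x b (v 0) :=
  .sum (.proj 0) (g := fun x (v : Fin 2 → ℕ) => ∑ T ∈ Finset.range (v 1),
      ∑ l ∈ Finset.range (v 1), accept M x b l T (v 0) (v 1))
    (.sum (.proj 1) (g := fun x (v : Fin 3 → ℕ) => ∑ l ∈ Finset.range (v 2),
      accept M x b l (v 0) (v 1) (v 2)) (.sum (.proj 2) (linSpace_accept M b)))

theorem linSpace_verdict (M : Machine CatTape) :
    LinSpace fun x (v : Fin 1 → ℕ) => verdict M x (v 0) :=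
  .ite_zero (linSpace_acceptSum M true)
    (.ite_zero (linSpace_acceptSum M false) .zero (.const 2)) (.const 1)

/-! ### Correctness of the verdict -/

section

variable {M : Machine CatTape} {x : List Bool} {g m : ℕ} {C D : M.Config} {b : Bool}

theorem HaltsIn.unique {b' : Bool} (h : M.HaltsIn x C D b) (h' : ∃ D', M.HaltsIn x C D' b') :
    b = b' := by
  obtain ⟨h, hb⟩ := h
  induction h using Relation.ReflTransGen.head_induction_on with
  | refl => exact (haltsIn_of_output hb h'.choose_spec).symm
  | head h _ ih => exact ih ((exists_haltsIn_iff h).1 h')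

/-- The initial configuration with an empty catalytic tape. -/
def blank (M : Machine CatTape) : M.Config := M.init (fun _ _ => false) []

theorem tapeNum_false (g : ℕ) : tapeNum g (fun _ => false) = 0 := by
  have : ∀ p ≥ g, (fun _ : ℕ => false) p = false := fun _ _ => rfl
  refine Nat.eq_of_testBit_eq fun p => ?_
  cases p with
  | zero => rw [testBit_tapeNum_zero, Nat.zero_testBit]
  | succ p => rw [testBit_tapeNum this, Nat.zero_testBit]

theorem configCode_blank (M : Machine CatTape) (g : ℕ) :
    configCode g (blank M) = startCode M (2 ^ (g + 1)) := by
  simp [configCode, blank, init, startCode, tapeNum_false]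

theorem bounded_blank (M : Machine CatTape) (x : List Bool) (g : ℕ) : Bounded x g (blank M) :=
  ⟨Nat.zero_le _, Nat.two_pow_pos _, fun _ => Nat.zero_le _, fun _ _ _ => rfl⟩

theorem haltCode_lt {R : ℕ} (hR : 2 ≤ R) : haltCode M R b < numCodes M R :=
  pack_lt (by omega) (by omega) (by omega) (by omega) (by omega) ((Bool.toNat_lt b).trans_le hR)

theorem Bounded.code_lt_numCodes (h : Bounded x g C) : configCode g C < numCodes M (2 ^ (g + 1)) :=
  h.code_lt.trans_le (Nat.mul_le_mul_right _ (by omega))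

theorem accept_le_one (l T Z : ℕ) : accept M x b l T g Z ≤ 1 := by
  unfold accept; split_ifs <;> omega

/-- The numbers needed for the test. -/
noncomputable def demand (M : Machine CatTape) (l T g : ℕ) : ℕ :=
  (numCodes M (2 ^ (g + 1)) + 2 * l + T + 2) ^ (4 * (3 * T + 3))

/-- Cutting off at `Z` is what makes the test computable with small numbers. The guards reject
whenever a cut-off takes effect, so an acceptance always refers to the true numbers. -/
theorem accept_eq_one_iff {l T Z : ℕ} : accept M x b l T g Z = 1 ↔
    2 ^ (g + 1) < Z ∧ demand M l T g < Z ∧ 0 < l ∧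
      l < entry (delta M x (2 ^ (g + 1))) (numCodes M (2 ^ (g + 1))) l T
        (configCode g (blank M)) (haltCode M (2 ^ (g + 1)) b) := by
  unfold accept
  by_cases h1 : 2 ^ (g + 1) < Z
  · have e1 : min Z (2 ^ (g + 1)) = 2 ^ (g + 1) := min_eq_right h1.le
    rw [e1, if_neg (by omega)]
    change (if Z ≤ min Z (demand M l T g) then 0 else _) = 1 ↔ _
    by_cases h2 : demand M l T g < Z
    · rw [min_eq_right h2.le, if_neg (by omega)]
      by_cases h3 : l = 0
      · simp [h3]
      · rw [if_neg h3, ← configCode_blank, squaring_result (by omega) h2.le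
          (bounded_blank M x g).code_lt_numCodes (haltCode_lt (two_le_two_pow_succ g))]
        simp [h1, h2, Nat.pos_of_ne_zero h3]
    · rw [min_eq_left (by omega), if_pos le_rfl]
      simp [h2]
  · rw [min_eq_left (by omega), if_pos le_rfl]
    simp [h1]

/-- If the output `b` is accepted then it has probability above `1 / 2`. -/
theorem half_lt_prob_of_accept {l T Z : ℕ} (hC : AlwaysHalts x m (blank M))
    (h : accept M x b l T g Z = 1) : 1 / 2 <
      prob fun r : Fin m → Bool => ∃ D, M.HaltsIn x (withCoins (blank M) (List.ofFn r)) D b := by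
  obtain ⟨-, -, hl, h⟩ := accept_eq_one_iff.1 h
  have h1 := entry_le_hitProb (δ := delta M x (2 ^ (g + 1))) hl
    (haltCode_lt (M := M) (b := b) (two_le_two_pow_succ g)) T (configCode g (blank M))
  have h2 := hitProb_le_prob (b := b) (2 ^ T) (bounded_blank M x g) hC
  have h3 : (l : ℝ) < entry (delta M x (2 ^ (g + 1))) (numCodes M (2 ^ (g + 1))) l T
        (configCode g (blank M)) (haltCode M (2 ^ (g + 1)) b) := by exact_mod_cast h
  have hl' : (0 : ℝ) < l := by exact_mod_cast hl
  refine lt_of_lt_of_le ?_ h2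
  nlinarith

/-- Provides the closed set needed by `hitProb_le_entry`: codes of safe configurations and the two
halting codes. -/
theorem Safe.delta_closed (D : ℕ) (o : Bool)
    (h : (∃ m C, Safe (M := M) x g m C ∧ D = configCode g C) ∨ ∃ b, D = haltCode M (2 ^ (g + 1)) b) :
    (∃ m C, Safe (M := M) x g m C ∧ delta M x (2 ^ (g + 1)) o D = configCode g C) ∨
      ∃ b, delta M x (2 ^ (g + 1)) o D = haltCode M (2 ^ (g + 1)) b := by
  rcases h with ⟨m, C, hC, rfl⟩ | ⟨b, rfl⟩
  · cases ho : M.output C.state with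
    | some b => exact .inr ⟨b, hC.bounded.delta_halt ho o⟩
    | none =>
      obtain ⟨⟨m', h1⟩, h2⟩ := hC.successor ho o
      exact .inl ⟨m', _, h1, h2⟩
  · exact .inr ⟨b, delta_haltCode (two_le_two_pow_succ g) b o⟩

/-- An output of probability at least `1 / 2 + ε` is accepted if the precision suffices. -/
theorem accept_of_le_prob {ε : ℝ} {e T : ℕ} (he : 1 < 2 ^ e * ε) (hC : Safe x g m (blank M))
    (hT : numStates M * (2 ^ (g + 1)) ^ 5 * (m + 1) ≤ 2 ^ T)
    (hp : 1 / 2 + ε ≤ prob fun r : Fin m → Bool =>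
      ∃ D, M.HaltsIn x (withCoins (blank M) (List.ofFn r)) D b) {Z : ℕ}
    (hZ : demand M (2 ^ (T + e) * numCodes M (2 ^ (g + 1))) T g < Z) :
    accept M x b (2 ^ (T + e) * numCodes M (2 ^ (g + 1))) T g Z = 1 := by
  have hN : 2 ^ (g + 1) ≤ numCodes M (2 ^ (g + 1)) :=
    (Nat.le_self_pow (by omega) _).trans (Nat.le_mul_of_pos_left _ (by omega))
  have hN0 : 0 < numCodes M (2 ^ (g + 1)) := (Nat.two_pow_pos _).trans_le hN
  set N := numCodes M (2 ^ (g + 1)) with hNdef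
  have hl : 0 < 2 ^ (T + e) * N := Nat.mul_pos (Nat.two_pow_pos _) hN0
  refine accept_eq_one_iff.2 ⟨lt_of_le_of_lt ?_ hZ, hZ, hl, ?_⟩
  · refine le_trans ?_ (Nat.le_self_pow (by omega) _)
    omega
  · have hpos : 0 < numStates M * (2 ^ (g + 1)) ^ 5 * (m + 1) :=
      Nat.mul_pos (Nat.mul_pos ((Nat.zero_le _).trans_lt (stateNum_lt M M.start)) (by positivity))
        (Nat.succ_pos _)
    -- The time bound is strict; subtracting `1` makes room for the step into the absorbing code.
    have h1 := prob_le_hitProb (b := b) (numStates M * (2 ^ (g + 1)) ^ 5 * (m + 1) - 1) hC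
      (fun r => by
        obtain ⟨D, b', hD⟩ := hC.1 r
        obtain ⟨t, ht⟩ := exists_haltsAt hD
        have := ht.le (hC.2 r)
        rw [show (withCoins (blank M) (List.ofFn r)).coins.length = m from List.length_ofFn] at this
        exact ⟨t, by omega, ht⟩) (n := 2 ^ T) (by omega)
    have h2 := hitProb_le_entry (δ := delta M x (2 ^ (g + 1))) hl
      (G := fun D => (∃ m C, Safe (M := M) x g m C ∧ D = configCode g C) ∨
        ∃ b, D = haltCode M (2 ^ (g + 1)) b) (N := N)
      (by
        rintro D (⟨m, C, hC, rfl⟩ | ⟨b, rfl⟩)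
        · exact hC.bounded.code_lt_numCodes
        · exact haltCode_lt (two_le_two_pow_succ g))
      (fun D o h => Safe.delta_closed D o h) (haltCode_lt (b := b) (two_le_two_pow_succ g)) T
      (.inl ⟨m, _, hC, rfl⟩)
    have h3 := hp.trans h1
    have hT0 : (0 : ℝ) < 2 ^ T := by positivity
    have hN' : (0 : ℝ) < N := by exact_mod_cast hN0
    -- With `l = 2 ^ (T + e) * N` the surplus `2 * l * (1 / 2 + ε) - 2 ^ T * N - l` equals `2 ^ T *
    -- N * (2 * 2 ^ e * ε - 1)`, which is positive.
    rw [← Nat.cast_lt (α := ℝ)]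
    refine lt_of_lt_of_le ?_ h2
    push_cast
    rw [pow_add]
    have h4 := mul_le_mul_of_nonneg_left h3 (show (0 : ℝ) ≤ 2 * (2 ^ T * 2 ^ e * N) by positivity)
    have h5 := mul_lt_mul_of_pos_left he (show (0 : ℝ) < 2 ^ T * N by positivity)
    nlinarith [mul_pos hT0 hN']

/-- Space bounds of a machine imply that all its configurations are safe. -/
theorem safe_blank {s c : ℕ} (hH : AlwaysHalts x m (blank M))
    (hS : ∀ r : Fin m → Bool, M.InSpace x (withCoins (blank M) (List.ofFn r)) (catSpace s c))
    (hs : s ≤ g) (hc : c ≤ g) (hx : x.length + 1 < 2 ^ (g + 1)) : Safe x g m (blank M) := by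
  refine ⟨hH, fun r D hD => ?_⟩
  have hb : ∀ D, M.Reaches x (withCoins (blank M) (List.ofFn r)) D → ∀ i, D.head i ≤ g := by
    intro D hD i
    refine (hS r D hD i).trans ?_
    cases i
    exacts [hs, hc]
  have key : D.inputHead ≤ x.length + 1 ∧ ∀ i, ∀ p ≥ g, D.tape i p = false := by
    induction hD with
    | refl => exact ⟨Nat.zero_le _, fun _ _ _ => rfl⟩
    | @tail D E h hE ih =>
      have hap : ∃ o rest, E = M.applyNext x D o rest := by
        rw [step] at hE
        split_ifs at hE with h1 h2
        · cases hc : D.coins with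
          | nil => rw [hc] at hE; cases hE
          | cons a l =>
            rw [hc] at hE
            cases hE
            exact ⟨_, _, rfl⟩
        · cases hE
          exact ⟨_, _, rfl⟩
      obtain ⟨o, rest, rfl⟩ := hap
      exact ⟨min_le_right _ _, fun i => (writeNum_tapeNum (ih.2 i) _ (hb D h i)).1⟩
  exact ⟨key.1, key.1.trans_lt hx, hb D hD, key.2⟩

end

end Catalytic

namespace Catalytic

open Machine

namespace Prog

variable {X Y : Type} {x : List Bool} {m ih h : ℕ} {t : ℕ → Bool} {cs : List Bool}

/-! ### Short inputs -/

/-- Reading the rest of the input if it has fewer than the given number of bits. -/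
def lookup (ans : List Bool → Y) : ℕ → List Bool → Prog (Option Y)
  | 0, _ => pure none
  | n + 1, l => (input fun a => (a, .right)).bind fun a =>
    match a with
    | .bit b => lookup ans n (l ++ [b])
    | _ => pure (some (ans l))

theorem exec_lookup (ans : List Bool → Y) (hh : h ≤ m) (n : ℕ) (l r : List Bool)
    (hx : x = l ++ r) : ∃ ih ≤ x.length + 1, (lookup ans n l).Exec x m ⟨l.length + 1, h, t, cs⟩
      (if r.length < n then some (ans x) else none) ⟨ih, h, t, cs⟩ := by
  have hl : l.length + 1 ≤ x.length + 1 := by simp [hx]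
  induction n generalizing l r with
  | zero => exact ⟨_, hl, exec_pure _ hl hh⟩
  | succ n IH =>
    have h1 := exec_input (x := x) (ih := l.length + 1) (t := t) (cs := cs)
      (fun a : Sym => (a, Dir.right)) hh
    cases r with
    | nil =>
      have hr : readInput x (l.length + 1) = .rightEnd := by simp [readInput, hx]
      rw [hr] at h1
      have hi : min (move (l.length + 1) .right) (x.length + 1) ≤ x.length + 1 := min_le_right _ _
      refine ⟨_, hi, exec_bind h1 ?_⟩
      have h2 := exec_pure (x := x) (t := t) (cs := cs) (some (ans x)) hi hh
      simpa [hx] using h2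
    | cons b r =>
      have hr : readInput x (l.length + 1) = .bit b := by simp [readInput, hx]
      rw [hr] at h1
      obtain ⟨ih, hi, h2⟩ := IH (l ++ [b]) r (by simp [hx]) (by simp [hx])
      refine ⟨ih, hi, exec_bind h1 ?_⟩
      have : min (move (l.length + 1) .right) (x.length + 1) = (l ++ [b]).length + 1 := by
        simp [move, hx]
      rw [this]
      simpa using h2

/-- Answering directly on inputs with fewer than `n` bits. -/
def shortcut (ans : List Bool → Bool) (n : ℕ) (P : Prog Bool) : Prog Bool :=
  (input fun _ => ((), .right)).bind fun _ => (lookup ans n []).bind fun o =>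
    rewind.bind fun _ => o.elim P pure

theorem exec_shortcut_aux (ans : List Bool → Bool) (n : ℕ) (P : Prog Bool) {b : Bool} {B : Mem}
    (hh : h ≤ m) (hP : (Option.elim (if x.length < n then some (ans x) else none) P pure).Exec x m
      ⟨0, h, t, cs⟩ b B) : (shortcut ans n P).Exec x m ⟨0, h, t, cs⟩ b B := by
  have h1 := exec_input (x := x) (ih := 0) (t := t) (cs := cs) (fun _ : Sym => ((), Dir.right)) hh
  obtain ⟨ih, hi, h2⟩ := exec_lookup (t := t) (cs := cs) ans hh n [] x rfl
  refine exec_bind h1 (exec_bind ?_ (exec_bind (exec_rewind hi hh) hP))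
  have : min (move 0 .right) (x.length + 1) = ([] : List Bool).length + 1 := by
    simp [move]
  rw [this]
  exact h2

/-- Only the input head moves and the tape is left as it is, so no cell of the read-write tape is
needed. -/
theorem exec_shortcut_of_lt {ans : List Bool → Bool} {n : ℕ} (P : Prog Bool) (hh : h ≤ m)
    (hx : x.length < n) :
    (shortcut ans n P).Exec x m ⟨0, h, t, cs⟩ (ans x) ⟨0, h, t, cs⟩ := by
  refine exec_shortcut_aux ans n P hh ?_
  rw [if_pos hx]
  exact exec_pure _ (Nat.zero_le _) hh

theorem exec_shortcut {ans : List Bool → Bool} {n : ℕ} {P : Prog Bool} (hh : h ≤ m)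
    (hx : n ≤ x.length) {b : Bool} {B : Mem} (hP : P.Exec x m ⟨0, h, t, cs⟩ b B) :
    (shortcut ans n P).Exec x m ⟨0, h, t, cs⟩ b B := by
  refine exec_shortcut_aux ans n P hh ?_
  rwa [if_neg (by omega)]

/-! ### Programs without random bits -/

/-- The program that never reads a random bit. -/
def mute (P : Prog X) : Prog X where
  State := P.State
  finite_state := P.finite_state
  start := P.start
  tosses _ := false
  next q a b _ := P.next q a b none

/-- With no coins at hand a step cannot be a toss, so ignoring the tossing states does not change
the run. This meets the formal demand that a deterministic machine have no such states. -/
theorem Step.mute {P : Prog X} {q : P.State} {A B : Mem} {e : P.State ⊕ X} (h : P.Step x q A e B)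
    (hA : A.coins = []) : P.mute.Step x q A e B ∧ B.coins = [] := by
  obtain ⟨o, rest, ⟨-, rfl, rfl⟩ | ⟨-, b, -, hc⟩, rfl, rfl⟩ := h
  · exact ⟨⟨none, _, .inl ⟨rfl, rfl, rfl⟩, rfl, rfl⟩, hA⟩
  · rw [hA] at hc
    cases hc

theorem Exec.mute {P : Prog X} {A B : Mem} {y : X} (h : P.Exec x m A y B) (hA : A.coins = []) :
    P.mute.Exec x m A y B := by
  unfold Exec at h ⊢
  change P.mute.Run x m P.start A y B
  revert h
  generalize P.start = q
  intro h
  induction h with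
  | exit h hA' hB => exact .exit (h.mute hA).1 hA' hB
  | cons h hA' _ ih => exact .cons (h.mute hA).1 hA' (ih (h.mute hA).2)

theorem init_eq_cfg {ι : Type} [DecidableEq ι] (P : Prog Bool) (i : ι) (T : ι → ℕ → Bool)
    (r : List Bool) :
    (P.toMachine i).init T r = P.cfg i T (.inl P.start) ⟨0, 0, T i, r⟩ := by
  simp only [init, cfg, Function.update_eq_self, ite_self]
  rfl

/-- A language decided by a program in space `S` is in `SPACE(S)`. -/
theorem mem_SPACE {L : Language Bool} {S : ℕ → ℕ} (P : Prog Bool)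
    (h : ∀ x : List Bool, ∃ b B, IsAnswer L x b ∧
      P.Exec x (S x.length) ⟨0, 0, fun _ => false, []⟩ b B) : L ∈ SPACE S := by
  refine ⟨P.mute.toMachine (), ?_, fun x => ?_⟩
  · rintro (_ | _) <;> rfl
  · obtain ⟨b, B, hb, hP⟩ := h x
    have := Run.halts () (fun _ _ => false) (hP.mute rfl) (m' := fun _ => S x.length) le_rfl
    rw [init_eq_cfg]
    exact ⟨⟨_, b, this.1, hb⟩, this.2⟩

/-! ### Unbounded search -/

/-- A program searching the first number at which a function does not vanish. -/
theorem exists_search {f : List Bool → (Fin 1 → ℕ) → ℕ} (hf : LinSpace f) :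
    ∃ (P : Prog Bool) (k c : ℕ), ∀ (x : List Bool) (Z m : ℕ),
      (∀ i < Z, f x (fun _ => i) = 0) → 0 < f x (fun _ => Z) → (x.length + Z + 2) ^ c < 2 ^ m →
      ∃ B, P.Exec x (span k m) ⟨0, 0, fun _ => false, []⟩ (decide (f x (fun _ => Z) = 1)) B := by
  obtain ⟨d, c, hc, h⟩ := hf
  obtain ⟨P, hP⟩ := h (2 + d) 2 (fun _ => 0) 1 le_rfl (by simp) (by omega) (by simp)
  -- Register `0` holds the candidate and register `1` the value of `f`. A positive value is
  -- decremented and tested again, to distinguish `1` from larger values. The exponent `c + 1`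
  -- leaves room for the candidate even if `c = 0`.
  refine ⟨loop (fun _ : Unit => P.bind fun _ => (test (2 + d) 1).bind fun b =>
    if b then (dec (2 + d) 1).bind fun _ => (test (2 + d) 1).bind fun b =>
      pure (.inr (!b)) else (inc (2 + d) 0).bind fun _ => pure (.inl ())) (), 2 + d, c + 1,
    fun x Z m h0 h1 hm => ?_⟩
  set σ : ℕ → ℕ → ℕ := fun i => Function.update (fun _ => 0) 0 i with hσ
  suffices H : ∀ e i, e + i = Z → ∃ σ', (loop (fun _ : Unit => P.bind fun _ =>
      (test (2 + d) 1).bind fun b => if b then (dec (2 + d) 1).bind fun _ =>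
      (test (2 + d) 1).bind fun b => pure (.inr (!b)) else
      (inc (2 + d) 0).bind fun _ => pure (.inl ())) ()).Reg (2 + d) x m (0, σ i)
      (decide (f x (fun _ => Z) = 1)) (0, σ') by
    obtain ⟨σ', hr⟩ := H Z 0 (by omega)
    obtain ⟨-, f', -, -, he⟩ := hr (Nat.zero_le _) 0 (Nat.zero_le _) (by simp [hσ])
    -- The empty tape already encodes zero registers with no flagged block.
    have h2 : enc (2 + d) (0, σ 0).2 0 = fun _ => false := by
      funext p
      simp [enc, hσ]
    rw [h2] at he
    exact ⟨_, he⟩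
  have hsize : ∀ i ≤ Z, size x (σ i ∘ fun _ : Fin 1 => 0) ^ c < 2 ^ m := by
    intro i hi
    refine lt_of_le_of_lt ?_ hm
    have : size x (σ i ∘ fun _ : Fin 1 => 0) ≤ x.length + Z + 2 := by
      simp [size, hσ]; omega
    exact (Nat.pow_le_pow_left this c).trans (Nat.pow_le_pow_right (by omega) (by omega))
  have hbody : ∀ i ≤ Z, P.Reg (2 + d) x m (0, σ i) ()
      (0, Function.update (σ i) 1 (f x fun _ => i)) := by
    intro i hi
    have := hP x m (σ i) (fun j hj => by
      rw [hσ]; exact Function.update_of_ne (by omega) _ _) (by simp [hσ]) (hsize i hi)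
    simpa [hσ, Function.comp_def] using this
  have hZ : Z + 1 < 2 ^ m := by
    refine lt_of_lt_of_le ?_ ((Nat.le_self_pow (by omega) (x.length + Z + 2)).trans hm.le)
    omega
  intro e
  induction e with
  | zero =>
    rintro i rfl
    rw [zero_add] at *
    refine ⟨Function.update (σ i) 1 (f x (fun _ => i) - 1), reg_loop_exit (b := (0, _))
      (reg_bind (hbody i le_rfl) (reg_bind (reg_test (by omega) _) ?_))⟩
    rw [decide_eq_true (by simpa using h1), if_pos rfl]
    have h3 := reg_dec (k := 2 + d) (x := x) (m := m) (i := 1) (by omega)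
      (s := (0, Function.update (σ i) 1 (f x fun _ => i))) (by simpa using h1)
    simp only [Function.update_self, Function.update_idem] at h3
    refine reg_bind h3 (reg_bind (reg_test (by omega) _) ?_)
    have : (!decide (0 < Function.update (σ i) 1 (f x (fun _ => i) - 1) 1)) =
        decide (f x (fun _ => i) = 1) := by
      rw [← decide_not]
      simp only [Function.update_self, decide_eq_decide]
      omega
    simp only [this]
    exact reg_pure _ _
  | succ e ih =>
    intro i hi
    obtain ⟨σ', hr⟩ := ih (i + 1) (by omega)
    refine ⟨σ', reg_loop_cons (s' := ()) (b := (0, σ (i + 1)))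
      (reg_bind (hbody i (by omega)) (reg_bind (reg_test (by omega) _) ?_)) hr⟩
    have h2 : Function.update (σ i) 1 (f x fun _ => i) = σ i := by
      rw [h0 i (by omega)]
      funext j
      by_cases hj : j = 1
      · subst hj; simp [hσ]
      · simp [hj]
    rw [h2, decide_eq_false (by simp [hσ])]
    have h3 := reg_inc (k := 2 + d) (x := x) (m := m) (i := 0) (by omega) (s := (0, σ i))
      (by simp only [hσ, Function.update_self]; omega)
    have h4 : Function.update (σ i) 0 (σ i 0 + 1) = σ (i + 1) := by
      simp [hσ]
    simp only [h4] at h3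
    exact reg_bind h3 (reg_pure _ _)

end Prog

end Catalytic

namespace Catalytic

open Machine

/-! ### Polynomial bounds -/

/-- Where `u` is at least `2`, the function `f` is bounded by a power of `u`. -/
def PolyBounded (u f : ℕ → ℕ) : Prop := ∃ e, ∀ n, 2 ≤ u n → f n ≤ u n ^ e

namespace PolyBounded

variable {u f g : ℕ → ℕ}

theorem of_le (hg : PolyBounded u g) (h : ∀ n, f n ≤ g n) : PolyBounded u f :=
  hg.imp fun _ he n hn => (h n).trans (he n hn)

theorem self : PolyBounded u u := ⟨1, fun n _ => by simp⟩

/-- Here `2 ≤ u n` is needed: powers of `0` and `1` do not grow. -/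
theorem const (a : ℕ) : PolyBounded u fun _ => a :=
  ⟨a, fun _ hn => Nat.lt_two_pow_self.le.trans (Nat.pow_le_pow_left hn a)⟩

theorem mul (hf : PolyBounded u f) (hg : PolyBounded u g) : PolyBounded u fun n => f n * g n := by
  obtain ⟨a, ha⟩ := hf
  obtain ⟨b, hb⟩ := hg
  exact ⟨a + b, fun n hn => by rw [pow_add]; exact Nat.mul_le_mul (ha n hn) (hb n hn)⟩

theorem add (hf : PolyBounded u f) (hg : PolyBounded u g) : PolyBounded u fun n => f n + g n := by
  obtain ⟨a, ha⟩ := hf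
  obtain ⟨b, hb⟩ := hg
  refine ⟨a + b + 1, fun n hn => ?_⟩
  have h1 := (ha n hn).trans (Nat.pow_le_pow_right (by omega) (show a ≤ a + b by omega))
  have h2 := (hb n hn).trans (Nat.pow_le_pow_right (by omega) (show b ≤ a + b by omega))
  have h3 := Nat.mul_le_mul_left (u n ^ (a + b)) hn
  rw [pow_succ]
  dsimp only
  omega

theorem pow (hf : PolyBounded u f) (k : ℕ) : PolyBounded u fun n => f n ^ k := by
  obtain ⟨a, ha⟩ := hf
  exact ⟨a * k, fun n hn => by rw [pow_mul]; exact Nat.pow_le_pow_left (ha n hn) k⟩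

end PolyBounded

/-! ### Catalytic machines in polynomial space -/

/-- A number of bits for the numbers that decide an input. -/
noncomputable def bits (q e g c : ℕ) : ℕ :=
  ((q + 5 * (g + 1) + (c + 1)) + e + (q + 5 * (g + 1)) + 3) *
    (4 * (3 * (q + 5 * (g + 1) + (c + 1)) + 3))

/-- The base of the power is a sum of at most `5`, hence at most `2 ^ 3`, times the largest power of
two involved. This is the `3` in `bits`. -/
theorem demand_le (M : Machine CatTape) {q e g c : ℕ} (hq : numStates M + 1 ≤ 2 ^ q) :
    demand M (2 ^ (q + 5 * (g + 1) + (c + 1) + e) * numCodes M (2 ^ (g + 1)))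
      (q + 5 * (g + 1) + (c + 1)) g ≤ 2 ^ bits q e g c := by
  have hN : numCodes M (2 ^ (g + 1)) ≤ 2 ^ (q + 5 * (g + 1)) := by
    rw [numCodes, pow_add _ q, mul_comm 5, pow_mul]
    exact Nat.mul_le_mul_right _ hq
  set T := q + 5 * (g + 1) + (c + 1) with hT
  set A := q + 5 * (g + 1)
  have h1 : 2 ^ (T + e) * numCodes M (2 ^ (g + 1)) ≤ 2 ^ (T + e + A) := by
    rw [pow_add _ (T + e)]
    exact Nat.mul_le_mul_left _ hN
  have h2 : T < 2 ^ T := Nat.lt_two_pow_self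
  have h3 : 2 ^ T ≤ 2 ^ (T + e + A) := Nat.pow_le_pow_right (by omega) (by omega)
  have h4 : 2 ^ A ≤ 2 ^ (T + e + A) := Nat.pow_le_pow_right (by omega) (by omega)
  have h5 : 2 ≤ 2 ^ (T + e + A) := by
    have : 1 < 2 ^ (T + e + A) := Nat.one_lt_two_pow (by omega)
    omega
  rw [demand, bits, pow_mul _ (T + e + A + 3)]
  refine Nat.pow_le_pow_left ?_ _
  rw [pow_add _ _ 3]
  omega

open Classical in
/-- The verdict is correct, and it is reached for numbers with a moderate number of bits. -/
theorem exists_verdict {ε : ℝ} (hε : 0 < ε) {e q : ℕ} (he : 1 < 2 ^ e * ε) {M : Machine CatTape}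
    (hq : numStates M + 1 ≤ 2 ^ q) {L : Language Bool} {x : List Bool} {s c g : ℕ} (hs : s ≤ g)
    (hc : c ≤ g) (hx : x.length + 1 < 2 ^ (g + 1))
    (hM : ∀ r : Fin (2 ^ c) → Bool, (∃ D b, M.HaltsIn x (withCoins (blank M) (List.ofFn r)) D b) ∧
      M.InSpace x (withCoins (blank M) (List.ofFn r)) (catSpace s c))
    (hp : 1 / 2 + ε ≤ prob fun r : Fin (2 ^ c) → Bool =>
      ∃ D b, M.HaltsIn x (withCoins (blank M) (List.ofFn r)) D b ∧ IsAnswer L x b) :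
    ∃ Z ≤ 2 ^ bits q e g c + 1, (∀ i < Z, verdict M x i = 0) ∧
      verdict M x Z = if x ∈ L then 1 else 2 := by
  have hH : AlwaysHalts x (2 ^ c) (blank M) := fun r => (hM r).1
  have hans : ∀ b, IsAnswer L x b ↔ b = decide (x ∈ L) := by
    intro b
    cases b <;> simp [IsAnswer]
  have hp' : 1 / 2 + ε ≤ prob fun r : Fin (2 ^ c) → Bool =>
      ∃ D, M.HaltsIn x (withCoins (blank M) (List.ofFn r)) D (decide (x ∈ L)) :=
    hp.trans (prob_mono fun r ⟨D, b, hD, hb⟩ => ⟨D, by rwa [← (hans b).1 hb]⟩)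
  -- An accepted output has probability above `1 / 2`, as has the right one; since outputs exclude
  -- each other, they coincide. This holds for all parameters.
  have hsound : ∀ b l T g Z, accept M x b l T g Z ≠ 0 → b = decide (x ∈ L) := by
    intro b l T g Z h
    have h1 := accept_le_one (M := M) (x := x) (g := g) (b := b) l T Z
    have h2 := half_lt_prob_of_accept hH (show accept M x b l T g Z = 1 by omega)
    by_contra hb
    have h3 := prob_add_le_one (m := 2 ^ c)
      (P := fun r => ∃ D, M.HaltsIn x (withCoins (blank M) (List.ofFn r)) D b)
      (Q := fun r => ∃ D, M.HaltsIn x (withCoins (blank M) (List.ofFn r)) D (decide (x ∈ L)))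
      (fun r ⟨D, hD⟩ hD' => hb (HaltsIn.unique hD hD'))
    linarith
  have hsum : ∀ b Z, acceptSum M x b Z ≠ 0 → b = decide (x ∈ L) := by
    intro b Z h
    obtain ⟨g, -, h⟩ := Finset.exists_ne_zero_of_sum_ne_zero h
    obtain ⟨T, -, h⟩ := Finset.exists_ne_zero_of_sum_ne_zero h
    obtain ⟨l, -, h⟩ := Finset.exists_ne_zero_of_sum_ne_zero h
    exact hsound b l T g Z h
  have hv : ∀ Z, verdict M x Z ≠ 0 → verdict M x Z = if x ∈ L then 1 else 2 := by
    intro Z h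
    unfold verdict at h ⊢
    by_cases h1 : acceptSum M x true Z = 0
    · by_cases h2 : acceptSum M x false Z = 0
      · simp [h1, h2] at h
      · have := hsum false Z h2
        rw [if_pos h1, if_neg h2, if_neg (by simpa using this)]
    · have := hsum true Z h1
      rw [if_neg h1, if_pos (by simpa using this)]
  -- At `Z = demand + 1` all three parameters lie in the range of the search, being smaller than the
  -- demand.
  have hZ : ∃ Z, verdict M x Z ≠ 0 ∧ Z ≤ 2 ^ bits q e g c + 1 := by
    set T := q + 5 * (g + 1) + (c + 1) with hT
    set l := 2 ^ (T + e) * numCodes M (2 ^ (g + 1)) with hl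
    have h1 : demand M l T g ≤ 2 ^ bits q e g c := demand_le M hq
    refine ⟨demand M l T g + 1, ?_, by omega⟩
    -- In the exponent `T`, the part `q` pays for the states, `5 * (g + 1)` for the remaining
    -- components of a code, and `c + 1` for the `2 ^ c + 1` possible numbers of unread coins.
    have h2 := accept_of_le_prob (b := decide (x ∈ L)) (Z := demand M l T g + 1) (T := T) he
      (safe_blank hH (fun r => (hM r).2) hs hc hx) (by
        rw [hT, pow_add _ (q + 5 * (g + 1)), pow_add _ q, mul_comm 5, pow_mul]
        refine Nat.mul_le_mul (Nat.mul_le_mul_right _ (by omega)) ?_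
        have := Nat.two_pow_pos c
        rw [pow_succ]
        omega) hp' (Nat.lt_succ_self _)
    have h3 : acceptSum M x (decide (x ∈ L)) (demand M l T g + 1) ≠ 0 := by
      obtain ⟨h4, -, -, -⟩ := accept_eq_one_iff.1 h2
      have h5 : numCodes M (2 ^ (g + 1)) + 2 * l + T + 2 ≤ demand M l T g :=
        Nat.le_self_pow (by omega) _
      have h6 : g + 1 < 2 ^ (g + 1) := Nat.lt_two_pow_self
      intro h
      unfold acceptSum at h
      rw [Finset.sum_eq_zero_iff] at h
      have h := h g (Finset.mem_range.2 (by omega))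
      rw [Finset.sum_eq_zero_iff] at h
      have h := h T (Finset.mem_range.2 (by omega))
      rw [Finset.sum_eq_zero_iff] at h
      have h := h l (Finset.mem_range.2 (by omega))
      rw [h2] at h
      exact one_ne_zero h
    generalize demand M l T g + 1 = Z at h3 ⊢
    generalize decide (x ∈ L) = b at h3
    unfold verdict
    cases b
    · rw [if_neg h3]
      split_ifs <;> simp
    · rw [if_neg h3]
      simp
  -- The first verdict may come from other parameters than those constructed, but by `hv` it is
  -- right anyway.
  have hZ' := Nat.find_spec hZ
  refine ⟨Nat.find hZ, hZ'.2, fun i hi => ?_, hv _ hZ'.1⟩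
  by_contra h
  exact Nat.find_min hZ hi ⟨h, by omega⟩

theorem catInit_zero (M : Machine CatTape) {c m : ℕ} (r : Fin m → Bool) :
    catInit M (fun _ : Fin c => false) r = withCoins (blank M) (List.ofFn r) := by
  have : catTapes (fun _ : Fin c => false) = fun _ _ => false := by
    funext i p
    cases i <;> simp [catTapes]
  rw [catInit, this]
  rfl

/-- Only the zero catalytic tape and the bound on the error of the output are used. -/
theorem BPCSPACE_subset_SPACE {ε δ : ℝ} (hε : 0 < ε) {s c : ℕ → ℕ}
    (hs : ∀ n, Nat.clog 2 n ≤ s n) (hc : ∀ n, s n ≤ c n) (k : ℕ) :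
    BPCSPACE ε δ (fun n => k * s n) (fun n => c n ^ k) ⊆
      ⋃ k : ℕ, SPACE (fun n => (s n + c n) ^ k) := by
  classical
  rintro L ⟨M, hM⟩
  obtain ⟨e, he⟩ : ∃ e : ℕ, 1 < 2 ^ e * ε := by
    obtain ⟨e, he⟩ := pow_unbounded_of_one_lt (1 / ε) (one_lt_two : (1 : ℝ) < 2)
    exact ⟨e, (div_lt_iff₀ hε).1 he⟩
  have hq : numStates M + 1 ≤ 2 ^ (numStates M + 1) := Nat.lt_two_pow_self.le
  obtain ⟨P, K, d, hP⟩ := Prog.exists_search (linSpace_verdict M)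
  -- A common bound for both tapes; the part `s n + 1` makes `2 ^ (G n + 1)` exceed the positions of
  -- the input head.
  set G : ℕ → ℕ := fun n => k * s n + c n ^ k + s n + 1 with hG
  set W : ℕ → ℕ := fun n => bits (numStates M + 1) e (G n) (c n ^ k) with hW
  have hu : PolyBounded (fun n => s n + c n) fun n => Prog.span K (d * (s n + W n + 3) + 1) := by
    have h1 : PolyBounded (fun n => s n + c n) s :=
      .of_le .self fun n => by omega
    have h2 : PolyBounded (fun n => s n + c n) fun n => c n ^ k :=
      (PolyBounded.of_le .self fun n => by omega).pow k
    have h3 : PolyBounded (fun n => s n + c n) G :=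
      ((((PolyBounded.const k).mul h1).add h2).add h1).add (.const 1)
    have h4 := (PolyBounded.const (u := fun n => s n + c n) (numStates M + 1)).add
      ((PolyBounded.const 5).mul (h3.add (.const 1)))
    have h5 := h4.add (h2.add (.const 1))
    have h6 : PolyBounded (fun n => s n + c n) W :=
      (((h5.add (.const e)).add h4).add (.const 3)).mul
        ((PolyBounded.const 4).mul (((PolyBounded.const 3).mul h5).add (.const 3)))
    exact (((((PolyBounded.const d).mul ((h1.add h6).add (.const 3))).add (.const 1)).add
      (.const 1)).mul (.const (K + 1))).add (.const 1)
  obtain ⟨E, hE⟩ := hu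
  refine Set.mem_iUnion.2 ⟨E, Prog.mem_SPACE (.shortcut (fun x => decide (x ∈ L)) 2 P) fun x => ?_⟩
  refine ⟨decide (x ∈ L), ?_⟩
  -- From length `2` on, `s` and `c` are positive, so `s + c ≥ 2` and polynomial bounds become
  -- single powers.
  rcases lt_or_ge x.length 2 with hx | hx
  · exact ⟨_, by simp [IsAnswer], Prog.exec_shortcut_of_lt P (Nat.zero_le _) hx⟩
  · have hs1 : 1 ≤ s x.length := (Nat.clog_pos (by omega) hx).trans_le (hs _)
    have hc1 := hc x.length
    have hx2 : x.length ≤ 2 ^ s x.length :=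
      (Nat.le_pow_clog (by omega) _).trans (Nat.pow_le_pow_right (by omega) (hs _))
    obtain ⟨h1, h2, -⟩ := hM x fun _ => false
    simp only [catInit_zero] at h1 h2
    have hx3 : x.length + 1 < 2 ^ (G x.length + 1) := by
      have : 2 ^ (s x.length + 2) ≤ 2 ^ (G x.length + 1) :=
        Nat.pow_le_pow_right (by omega) (by simp only [hG]; omega)
      rw [pow_add] at this
      omega
    obtain ⟨Z, hZ1, hZ2, hZ3⟩ := exists_verdict (g := G x.length) hε he hq (by simp only [hG]; omega)
      (by simp only [hG]; omega) hx3 h1 h2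
    replace hZ1 : Z ≤ 2 ^ W x.length + 1 := hZ1
    obtain ⟨B, hB⟩ := hP x Z (d * (s x.length + W x.length + 3) + 1) hZ2
      (by rw [hZ3]; split_ifs <;> omega) (by
        have h3 : 2 ^ s x.length ≤ 2 ^ (s x.length + W x.length) :=
          Nat.pow_le_pow_right (by omega) (by omega)
        have h4 : 2 ^ W x.length ≤ 2 ^ (s x.length + W x.length) :=
          Nat.pow_le_pow_right (by omega) (by omega)
        have h5 : 2 ^ (s x.length + W x.length) ≥ 1 := Nat.one_le_two_pow
        have h6 : x.length + Z + 2 ≤ 2 ^ (s x.length + W x.length + 3) := by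
          rw [pow_add _ _ 3]
          omega
        refine (Nat.pow_le_pow_left h6 d).trans_lt ?_
        rw [← pow_mul, mul_comm]
        exact Nat.pow_lt_pow_right (by omega) (by omega))
    have h7 : decide ((if x ∈ L then 1 else 2) = 1) = decide (x ∈ L) := by
      by_cases h : x ∈ L <;> simp [h]
    rw [hZ3, h7] at hB
    exact ⟨B, by simp [IsAnswer], Prog.exec_shortcut (Nat.zero_le _) hx
      (hB.mono (hE x.length (by dsimp only; omega)))⟩

end Catalytic

namespace Catalytic

open Machine

instance : Finite Dir :=
  Finite.of_injective (β := Option Bool)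
    (fun s => match s with | .left => none | .stay => some false | .right => some true)
    (by rintro (_ | _ | _) (_ | _ | _) h <;> simp_all)

instance : DecidableEq CatTape
  | .work, .work => isTrue rfl
  | .work, .cat => isFalse nofun
  | .cat, .work => isFalse nofun
  | .cat, .cat => isTrue rfl

namespace Prog

variable {x : List Bool} {m ih h : ℕ} {t : ℕ → Bool} {cs : List Bool}

/-! ### Simulating a machine on a tape with arbitrary content -/

/-- The tape `t` represents the tape `u`: cell `p` of `u` is stored in cell `2 * p + 1`, and the
flags in the even cells mark the first `f` cells, outside of which `u` is empty. -/
structure Rep (f : ℕ) (u t : ℕ → Bool) : Prop where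
  flag : ∀ p < f, t (2 * p) = true
  bit : ∀ p < f, t (2 * p + 1) = u p
  last : t (2 * f) = false
  zero : ∀ p ≥ f, u p = false

/-- Moving right by one represented cell. -/
def advance : Prog Unit :=
  (moves .right 1).bind fun _ => look.bind fun b =>
    if b then moves .right 1 else
      (write true .right).bind fun _ => (write false .right).bind fun _ => write false .left

/-- Position `h` is represented by position `2 * h`, which is on the bit of cell `h - 1`. At the
frontier the old content is erased lazily: the flag of the new cell is set, its bit cleared, and the
next flag cleared. This visits position `2 * h + 3`. -/
theorem exec_advance {f : ℕ} {u : ℕ → Bool} (hi : ih ≤ x.length + 1) (hm : 2 * h + 3 ≤ m)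
    (hf : h ≤ f) (ht : Rep f u t) : ∃ f' t', h + 1 ≤ f' ∧ Rep f' u t' ∧
      advance.Exec x m ⟨ih, 2 * h, t, cs⟩ () ⟨ih, 2 * (h + 1), t', cs⟩ := by
  have h1 := exec_right (x := x) (m := m) (h := 2 * h) (t := t) (cs := cs) 1 hi (by omega)
  have h2 := exec_look (x := x) (m := m) (h := 2 * h) (t := t) (cs := cs) hi (by omega)
  rcases hf.lt_or_eq with hf | rfl
  · refine ⟨f, t, hf, ht, exec_bind h1 (exec_bind h2 ?_)⟩
    rw [ht.flag h hf, if_pos rfl]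
    exact exec_right (x := x) (m := m) (h := 2 * h + 1) (t := t) (cs := cs) 1 hi (by omega)
  · refine ⟨h + 1, Function.update (Function.update (Function.update t (2 * h) true) (2 * h + 1)
      false) (2 * h + 2) false, le_rfl, ⟨fun p hp => ?_, fun p hp => ?_, ?_, fun p hp => ?_⟩,
      exec_bind h1 (exec_bind h2 ?_)⟩
    · rw [Function.update_of_ne (by omega), Function.update_of_ne (by omega)]
      rcases (Nat.lt_succ_iff.1 hp).lt_or_eq with hp | rfl
      · rw [Function.update_of_ne (by omega), ht.flag p hp]
      · exact Function.update_self _ _ _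
    · rw [Function.update_of_ne (by omega)]
      rcases (Nat.lt_succ_iff.1 hp).lt_or_eq with hp | rfl
      · rw [Function.update_of_ne (by omega), Function.update_of_ne (by omega), ht.bit p hp]
      · rw [Function.update_self, ht.zero p le_rfl]
    · exact Function.update_self _ _ _
    · exact ht.zero p (by omega)
    · rw [ht.last, if_neg (by simp)]
      exact exec_bind (exec_write true .right hi (by omega) (by simp only [move]; omega))
        (exec_bind (exec_write false .right hi (by omega) (by simp only [move]; omega))
        (exec_write false .left hi (by omega) (by simp only [move]; omega)))

theorem Rep.write {f : ℕ} {u : ℕ → Bool} (ht : Rep f u t) (hf : h ≤ f) (b : Bool) :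
    Rep f (writeTape u b h) (writeTape t b (2 * h)) := by
  cases h with
  | zero => exact ht
  | succ h =>
    rw [show 2 * (h + 1) = 2 * h + 1 + 1 by ring, writeTape, writeTape]
    refine ⟨fun p hp => ?_, fun p hp => ?_, ?_, fun p hp => ?_⟩
    · rw [Function.update_of_ne (by omega), ht.flag p hp]
    · by_cases hph : p = h
      · rw [hph, Function.update_self, Function.update_self]
      · rw [Function.update_of_ne (by omega), Function.update_of_ne hph, ht.bit p hp]
    · rw [Function.update_of_ne (by omega), ht.last]
    · rw [Function.update_of_ne (by omega), ht.zero p hp]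

theorem Rep.read {f : ℕ} {u : ℕ → Bool} (ht : Rep f u t) (hf : h ≤ f) :
    readTape t (2 * h) = readTape u h := by
  cases h with
  | zero => rfl
  | succ h =>
    rw [show 2 * (h + 1) = 2 * h + 1 + 1 by ring, readTape, readTape, ht.bit h hf]

/-- Moving the head by one represented cell. -/
def shift : Dir → Prog Unit
  | .left => moves .left 2
  | .stay => pure ()
  | .right => advance

/-- Simulating one step of a machine. -/
def simStep (M : Machine Unit) (q : M.State) : Prog (M.State ⊕ Bool) :=
  have := M.finite_state
  match M.output q with
  | some b => pure (.inr b)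
  | none => (act fun a s => (((M.next q a (fun _ => s) none).1,
      ((M.next q a (fun _ => s) none).2.2 ()).2), (M.next q a (fun _ => s) none).2.1,
      ((M.next q a (fun _ => s) none).2.2 ()).1, .stay)).bind fun (y : M.State × Dir) =>
      (shift y.2).bind fun _ => pure (.inl y.1)

/-- Simulating a machine. -/
def sim (M : Machine Unit) (q : M.State) : Prog Bool :=
  have := M.finite_state
  loop (simStep M) q

/-- Positions double, and the clearing of the next flag needs one cell more; hence `2 * S + 1`. -/
theorem exec_sim {M : Machine Unit} (hM : ∀ q, M.tosses q = false) {C D : M.Config} {b : Bool}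
    {S : ℕ} (hD : M.HaltsIn x C D b) (hS : M.InSpace x C fun _ => S) (hi : C.inputHead ≤ x.length + 1)
    {f : ℕ} (hf : C.head () ≤ f) (ht : Rep f (C.tape ()) t) : ∃ B,
      (sim M C.state).Exec x (2 * S + 1) ⟨C.inputHead, 2 * C.head (), t, cs⟩ b B := by
  have := M.finite_state
  obtain ⟨hD, hb⟩ := hD
  induction hD using Relation.ReflTransGen.head_induction_on generalizing t f with
  | refl =>
    refine ⟨⟨D.inputHead, 2 * D.head (), t, cs⟩, exec_loop_exit ?_⟩
    rw [simStep, hb]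
    exact exec_pure _ hi (by have : D.head () ≤ S := hS D .refl (); omega)
  | @head C E hE hr ihr =>
    have ho : M.output C.state = none := by
      by_contra h
      simp [step, Option.isSome_iff_ne_none, h] at hE
    have hE' : E = M.applyNext x C none C.coins := by
      simpa [step, ho, hM, eq_comm] using hE
    have hSE : M.InSpace x E fun _ => S := fun F hF => hS F (hF.head hE)
    have hhE := hSE E .refl ()
    have hh := hS C .refl ()
    have hiE : E.inputHead ≤ x.length + 1 := by rw [hE']; exact min_le_right _ _
    dsimp only at hhE hh
    set y := M.next C.state (readInput x C.inputHead) (fun i => readTape (C.tape i) (C.head i)) none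
      with hy
    have hE1 : E.head () = move (C.head ()) (y.2.2 ()).2 := by rw [hE']; rfl
    have hE2 : E.tape () = writeTape (C.tape ()) (y.2.2 ()).1 (C.head ()) := by rw [hE']; rfl
    have hE3 : E.inputHead = min (move C.inputHead y.2.1) (x.length + 1) := by rw [hE']; rfl
    have hE4 : E.state = y.1 := by rw [hE']; rfl
    have hw := ht.write hf (y.2.2 ()).1
    rw [← hE2] at hw
    obtain ⟨f', t', hf', ht', hs⟩ : ∃ f' t', E.head () ≤ f' ∧ Rep f' (E.tape ()) t' ∧
        (shift (y.2.2 ()).2).Exec x (2 * S + 1) ⟨E.inputHead, 2 * C.head (),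
          writeTape t (y.2.2 ()).1 (2 * C.head ()), cs⟩ () ⟨E.inputHead, 2 * E.head (), t', cs⟩ := by
      rw [hE1] at hhE ⊢
      cases hd : (y.2.2 ()).2 with
      | left =>
        refine ⟨f, _, by simp only [move]; omega, hw, ?_⟩
        have := exec_left (x := x) (m := 2 * S + 1) (h := 2 * C.head ())
          (t := writeTape t (y.2.2 ()).1 (2 * C.head ())) (cs := cs) 2 hiE (by omega)
        rwa [show 2 * C.head () - 2 = 2 * move (C.head ()) .left by simp only [move]; omega] at this
      | stay => exact ⟨f, _, hf, hw, exec_pure () hiE (by omega)⟩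
      | right =>
        rw [hd] at hhE
        simp only [move] at hhE
        exact exec_advance hiE (by omega) hf hw
    obtain ⟨B, hB⟩ := ihr hSE hiE hf' ht'
    refine ⟨B, exec_loop_cons (s' := E.state) (B := ⟨E.inputHead, 2 * E.head (), t', cs⟩) ?_ hB⟩
    rw [simStep, ho]
    have hact := exec_act (f := fun a s => (((M.next C.state a (fun _ => s) none).1,
      ((M.next C.state a (fun _ => s) none).2.2 ()).2), (M.next C.state a (fun _ => s) none).2.1,
      ((M.next C.state a (fun _ => s) none).2.2 ()).1, Dir.stay)) (x := x) (m := 2 * S + 1)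
      (A := ⟨C.inputHead, 2 * C.head (), t, cs⟩) (by simp only; omega) (by simp only [move]; omega)
    simp only [Mem.act, ht.read hf] at hact
    change Exec _ _ _ _ (y.1, (y.2.2 ()).2) ⟨min (move C.inputHead y.2.1) (x.length + 1),
      2 * C.head (), writeTape t (y.2.2 ()).1 (2 * C.head ()), cs⟩ at hact
    rw [← hE3] at hact
    rw [hE4]
    exact exec_bind hact (exec_bind hs (exec_pure _ hiE (by omega)))

/-- Simulating a machine from its initial configuration, on an arbitrary tape. -/
def simulate (M : Machine Unit) : Prog Bool :=
  (moves .right 1).bind fun _ => (write false .left).bind fun _ => sim M M.start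

theorem exec_simulate {M : Machine Unit} (hM : ∀ q, M.tosses q = false) {D : M.Config} {b : Bool}
    {S : ℕ} (hD : M.HaltsIn x (M.init (fun _ _ => false) []) D b)
    (hS : M.InSpace x (M.init (fun _ _ => false) []) fun _ => S) : ∃ B,
      (simulate M).Exec x (2 * S + 1) ⟨0, 0, t, cs⟩ b B := by
  -- Clearing the first flag turns any content into a representation of the empty tape with `f = 0`.
  obtain ⟨B, hB⟩ := exec_sim (cs := cs) (t := Function.update t 0 false) hM hD hS (Nat.zero_le _)
    (f := 0) le_rfl ⟨by simp, by simp, by simp, fun _ _ => rfl⟩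
  exact ⟨B, exec_bind (exec_right 1 (Nat.zero_le _) (by omega))
    (exec_bind (exec_write false .left (Nat.zero_le _) (by omega) (by simp [move])) hB)⟩

/-! ### Biased coins -/

/-- Reading `j` random bits, to be compared with the number `a`. -/
def biased (a : ℕ) : ℕ → ℕ → Prog Bool
  | 0, v => pure (decide (v < a))
  | j + 1, v => toss.bind fun b => biased a j (2 * v + b.toNat)

/-- The result of the comparison and the remaining random bits. -/
def flip (a : ℕ) : ℕ → ℕ → List Bool → Bool × List Bool
  | 0, v, l => (decide (v < a), l)
  | _ + 1, _, [] => (false, [])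
  | j + 1, v, b :: l => flip a j (2 * v + b.toNat) l

theorem exec_biased {a j v : ℕ} (hi : ih ≤ x.length + 1) (hm : h ≤ m) (hc : j ≤ cs.length) :
    (biased a j v).Exec x m ⟨ih, h, t, cs⟩ (flip a j v cs).1 ⟨ih, h, t, (flip a j v cs).2⟩ := by
  induction j generalizing v cs with
  | zero => exact exec_pure _ hi hm
  | succ j IH =>
    cases cs with
    | nil => simp at hc
    | cons b cs => exact exec_bind (exec_toss hm hi) (IH (by simpa using hc))

theorem length_flip {a j v : ℕ} (hc : j ≤ cs.length) :
    (flip a j v cs).2.length + j = cs.length := by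
  induction j generalizing v cs with
  | zero => rfl
  | succ j IH =>
    cases cs with
    | nil => simp at hc
    | cons b cs =>
      have := IH (v := 2 * v + b.toNat) (cs := cs) (by simpa using hc)
      simp only [flip, List.length_cons]
      omega

/-- With prefix `v` read, `j` more bits give the numbers from `v * 2 ^ j` to `v * 2 ^ j + 2 ^ j -
1`, of which `min (2 ^ j) (a - v * 2 ^ j)` are below `a`, by truncated subtraction. The bits left
over are independent of the comparison. -/
theorem prob_flip (a j v n : ℕ) (Q : Bool → List Bool → Prop) :
    (prob fun r : Fin (n + j) → Bool => Q (flip a j v (List.ofFn r)).1 (flip a j v (List.ofFn r)).2) =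
    (min (2 ^ j) (a - v * 2 ^ j) : ℕ) / 2 ^ j * (prob fun r : Fin n → Bool => Q true (List.ofFn r)) +
    (1 - (min (2 ^ j) (a - v * 2 ^ j) : ℕ) / 2 ^ j) *
      prob fun r : Fin n → Bool => Q false (List.ofFn r) := by
  induction j generalizing v with
  | zero =>
    simp only [flip, pow_zero, mul_one, div_one]
    by_cases h : v < a
    · rw [show min 1 (a - v) = 1 by omega]
      simp [h]
    · rw [show min 1 (a - v) = 0 by omega]
      simp [h]
  | succ j IH =>
    have h1 : min (2 ^ (j + 1)) (a - v * 2 ^ (j + 1)) =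
        min (2 ^ j) (a - (2 * v + 0) * 2 ^ j) + min (2 ^ j) (a - (2 * v + 1) * 2 ^ j) := by
      rw [show v * 2 ^ (j + 1) = 2 * (v * 2 ^ j) by ring,
        show (2 * v + 0) * 2 ^ j = 2 * (v * 2 ^ j) by ring,
        show (2 * v + 1) * 2 ^ j = 2 * (v * 2 ^ j) + 2 ^ j by ring, pow_succ]
      omega
    change (prob fun r : Fin (n + j + 1) → Bool => _) = _
    rw [prob_succ]
    simp only [List.ofFn_cons, flip, Bool.toNat_false, Bool.toNat_true]
    rw [IH, IH, h1]
    push_cast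
    rw [pow_succ]
    field_simp
    ring

end Prog

theorem prob_head (n : ℕ) (b : Bool) :
    (prob fun r : Fin (n + 1) → Bool => (List.ofFn r).headD false = b) = 1 / 2 := by
  rw [prob_succ]
  simp only [List.ofFn_cons, List.headD_cons]
  cases b
  · rw [prob_true (fun _ => rfl), prob_false (fun _ => by simp)]
    norm_num
  · rw [prob_false (fun _ => by simp), prob_true (fun _ => rfl)]
    norm_num

/-- A dyadic number between two given numbers. -/
theorem exists_dyadic {y z : ℝ} (hy : 0 ≤ y) (hyz : y < z) :
    ∃ a j : ℕ, y ≤ a / 2 ^ j ∧ (a : ℝ) / 2 ^ j ≤ z := by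
  obtain ⟨j, hj⟩ := pow_unbounded_of_one_lt (1 / (z - y)) (one_lt_two : (1 : ℝ) < 2)
  rw [div_lt_iff₀ (by linarith)] at hj
  refine ⟨⌈y * 2 ^ j⌉₊, j, ?_, ?_⟩
  · rw [le_div_iff₀ (by positivity)]
    exact Nat.le_ceil _
  · rw [div_le_iff₀ (by positivity)]
    have := Nat.ceil_lt_add_one (show 0 ≤ y * 2 ^ j by positivity)
    nlinarith

end Catalytic

namespace Catalytic

open Machine Prog

/-! ### Catalytic machines that destroy the catalytic tape -/

/-- Running a program with the given probability, and else guessing the answer. -/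
def gamble (a j : ℕ) (P : Prog Bool) : Prog Bool :=
  (biased a j 0).bind fun b => if b then P else toss

theorem exec_gamble {x : List Bool} {m a j : ℕ} {t : ℕ → Bool} {cs : List Bool} {P : Prog Bool}
    {b : Bool} (hP : ∀ cs, ∃ B, P.Exec x m ⟨0, 0, t, cs⟩ b B) (hc : j + 1 ≤ cs.length) :
    ∃ b' B, (gamble a j P).Exec x m ⟨0, 0, t, cs⟩ b' B ∧ ((flip a j 0 cs).1 = true → b' = b) ∧
      ((flip a j 0 cs).1 = false → b' = (flip a j 0 cs).2.headD false ∧ B.tape = t) := by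
  have h1 := exec_biased (a := a) (j := j) (v := 0) (x := x) (m := m) (ih := 0) (h := 0) (t := t)
    (cs := cs) (Nat.zero_le _) (Nat.zero_le _) (by omega)
  have h2 := length_flip (a := a) (j := j) (v := 0) (cs := cs) (by omega)
  cases hf : (flip a j 0 cs).1 with
  | true =>
    obtain ⟨B, hB⟩ := hP (flip a j 0 cs).2
    rw [hf] at h1
    exact ⟨b, B, exec_bind h1 (by rwa [if_pos rfl]), fun _ => rfl, nofun⟩
  | false =>
    rw [hf] at h1
    cases hr : (flip a j 0 cs).2 with
    | nil => rw [hr, List.length_nil] at h2; omega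
    | cons b' rest =>
      rw [hr] at h1
      refine ⟨b', ⟨0, 0, t, rest⟩, exec_bind h1 ?_, nofun, fun _ => ⟨rfl, rfl⟩⟩
      rw [if_neg (by simp)]
      exact exec_toss (Nat.zero_le _) (Nat.zero_le _)

/-- The probability of a correct answer. -/
theorem le_prob_answer {ε : ℝ} {a j n : ℕ} (hn : j + 1 ≤ n) (ha : 2 * ε ≤ a / 2 ^ j)
    (ha' : (a : ℝ) / 2 ^ j ≤ 1) (b : Bool) :
    1 / 2 + ε ≤ prob fun r : Fin n → Bool => (flip a j 0 (List.ofFn r)).1 = false →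
      (flip a j 0 (List.ofFn r)).2.headD false = b := by
  obtain ⟨n, rfl⟩ : ∃ n', n = n' + 1 + j := ⟨n - (j + 1), by omega⟩
  have ha1 : a ≤ 2 ^ j := by
    rw [div_le_one (by positivity)] at ha'
    exact_mod_cast ha'
  -- With `p = a / 2 ^ j` the probability is `p + (1 - p) / 2 = 1 / 2 + p / 2`.
  rw [prob_flip a j 0 (n + 1) fun g l => g = false → l.headD false = b, zero_mul, Nat.sub_zero,
    min_eq_right ha1, prob_true (by simp)]
  simp only [true_implies, prob_head]
  linarith

/-- The probability of an unchanged tape. -/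
theorem le_prob_unchanged {δ : ℝ} {a j n : ℕ} (hn : j + 1 ≤ n) (ha : (a : ℝ) / 2 ^ j ≤ δ)
    (ha' : (a : ℝ) / 2 ^ j ≤ 1) :
    1 - δ ≤ prob fun r : Fin n → Bool => (flip a j 0 (List.ofFn r)).1 = false := by
  obtain ⟨n, rfl⟩ : ∃ n', n = n' + 1 + j := ⟨n - (j + 1), by omega⟩
  have ha1 : a ≤ 2 ^ j := by
    rw [div_le_one (by positivity)] at ha'
    exact_mod_cast ha'
  rw [prob_flip a j 0 (n + 1) fun g l => g = false, zero_mul, Nat.sub_zero,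
    min_eq_right ha1, prob_false (by simp), prob_true (fun _ => rfl)]
  linarith

theorem catInit_eq_cfg (P : Prog Bool) {c n : ℕ} (τ : Fin c → Bool) (r : Fin n → Bool) :
    catInit (P.toMachine CatTape.cat) τ r = P.cfg CatTape.cat (catTapes τ) (.inl P.start)
      ⟨0, 0, catTapes τ .cat, List.ofFn r⟩ :=
  init_eq_cfg P _ _ _

/-- The program lives on the catalytic tape alone; the head of the work tape stays on its left-end
marker, so any `s` will do. -/
theorem exec_catInit {P : Prog Bool} {x : List Bool} {s c n : ℕ} {τ : Fin c → Bool}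
    {r : Fin n → Bool} {b : Bool} {B : Mem}
    (h : P.Exec x c ⟨0, 0, catTapes τ .cat, List.ofFn r⟩ b B) :
    (∃ D, (P.toMachine CatTape.cat).HaltsIn x (catInit (P.toMachine CatTape.cat) τ r) D b ∧
      D.tape .cat = B.tape) ∧
    (P.toMachine CatTape.cat).InSpace x (catInit (P.toMachine CatTape.cat) τ r) (catSpace s c) := by
  rw [catInit_eq_cfg]
  have := Run.halts CatTape.cat (catTapes τ) h (m' := catSpace s c) le_rfl
  exact ⟨⟨_, this.1, by simp [cfg]⟩, this.2⟩

theorem catTapes_apply {c : ℕ} (τ : Fin c → Bool) (i : Fin c) : catTapes τ .cat i = τ i := by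
  simp [catTapes]

/-- The permitted failures of restoration, of probability `δ > 2 * ε`, are spent on runs that use
the catalytic tape as ordinary memory. -/
theorem SPACE_subset_BPCSPACE {ε δ : ℝ} (hε : 0 < ε) (hδ : δ < 1) (hεδ : 2 * ε < δ) {s c : ℕ → ℕ}
    (hs : ∀ n, Nat.clog 2 n ≤ s n) (hc : ∀ n, s n ≤ c n) (k : ℕ) :
    SPACE (fun n => (s n + c n) ^ k) ⊆
      ⋃ k : ℕ, BPCSPACE ε δ (fun n => k * s n) (fun n => c n ^ k) := by
  classical
  rintro L ⟨M, hM, hL⟩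
  obtain ⟨a, j, ha, ha'⟩ := exists_dyadic (by linarith) hεδ
  have ha1 : (a : ℝ) / 2 ^ j ≤ 1 := by linarith
  set P := shortcut (fun x => decide (x ∈ L)) 3 (gamble a j (simulate M)) with hP
  have hans : ∀ x b, IsAnswer L x b ↔ b = decide (x ∈ L) := by
    intro x b
    cases b <;> simp [IsAnswer]
  -- The part `2 * k + 2` provides the space, by `2 * (s + c) ^ k + 1 ≤ 4 * c ^ (2 * k) ≤ c ^ (2 * k
  -- + 2)`; the part `j` ensures that at least `j + 1` coins are available.
  refine Set.mem_iUnion.2 ⟨2 * k + 2 + j, P.toMachine CatTape.cat, fun x τ => ?_⟩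
  -- Length `3` is the first at which `Nat.clog 2` reaches `2`, and so forces `c ≥ 2`. Shorter
  -- inputs are answered without coins and without touching the tape.
  rcases lt_or_ge x.length 3 with hx | hx
  · have h1 := fun r : Fin (2 ^ c x.length ^ (2 * k + 2 + j)) → Bool =>
      exec_catInit (s := (2 * k + 2 + j) * s x.length) (τ := τ) (r := r)
        (exec_shortcut_of_lt (ans := fun x => decide (x ∈ L)) (gamble a j (simulate M))
          (Nat.zero_le _) hx)
    refine ⟨fun r => ?_, ?_, ?_⟩
    · obtain ⟨⟨D, hD, -⟩, h2⟩ := h1 r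
      exact ⟨⟨D, _, hD⟩, h2⟩
    · rw [prob_true fun r => ?_]
      · linarith
      · obtain ⟨⟨D, hD, -⟩, -⟩ := h1 r
        exact ⟨D, _, hD, (hans x _).2 rfl⟩
    · rw [prob_true fun r => ?_]
      · linarith
      · obtain ⟨⟨D, hD, h3⟩, -⟩ := h1 r
        exact ⟨D, _, hD, fun i => by rw [h3]; exact catTapes_apply τ i⟩
  · have hs2 : 2 ≤ s x.length := (show 2 ≤ Nat.clog 2 3 by decide).trans
      ((Nat.clog_mono_right 2 hx).trans (hs _))
    have hc2 : 2 ≤ c x.length := hs2.trans (hc _)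
    have hsp : 2 * (s x.length + c x.length) ^ k + 1 ≤ c x.length ^ (2 * k + 2 + j) := by
      have h1 : s x.length + c x.length ≤ c x.length ^ 2 := by
        have := Nat.mul_le_mul_right (c x.length) hc2
        have := hc x.length
        rw [pow_two]
        omega
      have h2 := Nat.pow_le_pow_left h1 k
      rw [← pow_mul] at h2
      have h3 : c x.length ^ (2 * k + 2) ≤ c x.length ^ (2 * k + 2 + j) :=
        Nat.pow_le_pow_right (by omega) (by omega)
      have h4 : c x.length ^ (2 * k) * 4 ≤ c x.length ^ (2 * k + 2) := by
        rw [pow_add]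
        exact Nat.mul_le_mul_left _ (Nat.pow_le_pow_left hc2 2)
      have h5 : 1 ≤ c x.length ^ (2 * k) := Nat.one_le_pow _ _ (by omega)
      omega
    have hj : j + 1 ≤ 2 ^ c x.length ^ (2 * k + 2 + j) := by
      have h1 : 2 * k + 2 + j < c x.length ^ (2 * k + 2 + j) := Nat.lt_pow_self (by omega)
      have h2 : c x.length ^ (2 * k + 2 + j) < 2 ^ c x.length ^ (2 * k + 2 + j) :=
        Nat.lt_two_pow_self
      omega
    obtain ⟨⟨D, b, hD, hb⟩, hS⟩ := hL x
    rw [hans] at hb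
    subst hb
    have h1 : ∀ r : Fin (2 ^ c x.length ^ (2 * k + 2 + j)) → Bool, _ := fun r =>
      exec_gamble (a := a) (j := j) (t := catTapes τ .cat) (cs := List.ofFn r)
        (fun cs => (exec_simulate (t := catTapes τ .cat) (cs := cs) hM hD hS).imp
          fun B hB => hB.mono hsp) (by rw [List.length_ofFn]; exact hj)
    have h2 : ∀ r : Fin (2 ^ c x.length ^ (2 * k + 2 + j)) → Bool, ∃ D b,
        (P.toMachine CatTape.cat).HaltsIn x (catInit (P.toMachine CatTape.cat) τ r) D b ∧
        (P.toMachine CatTape.cat).InSpace x (catInit (P.toMachine CatTape.cat) τ r)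
          (catSpace ((2 * k + 2 + j) * s x.length) (c x.length ^ (2 * k + 2 + j))) ∧
        ((flip a j 0 (List.ofFn r)).1 = true → b = decide (x ∈ L)) ∧
        ((flip a j 0 (List.ofFn r)).1 = false → b = (flip a j 0 (List.ofFn r)).2.headD false ∧
          ∀ i, D.tape .cat (Fin.val i) = τ i) := by
      intro r
      obtain ⟨b, B, hB, h3, h4⟩ := h1 r
      obtain ⟨⟨D, hD, h5⟩, h6⟩ := exec_catInit (s := (2 * k + 2 + j) * s x.length)
        (exec_shortcut (ans := fun x => decide (x ∈ L)) (Nat.zero_le _) hx hB)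
      refine ⟨D, b, hD, h6, h3, fun h => ⟨(h4 h).1, fun i => ?_⟩⟩
      rw [h5, (h4 h).2]
      exact catTapes_apply τ i
    refine ⟨fun r => ?_, ?_, ?_⟩
    · obtain ⟨D, b, hD, h3, -⟩ := h2 r
      exact ⟨⟨D, b, hD⟩, h3⟩
    · refine (le_prob_answer hj ha ha1 (decide (x ∈ L))).trans (prob_mono fun r hr => ?_)
      obtain ⟨D, b, hD, -, h3, h4⟩ := h2 r
      refine ⟨D, b, hD, (hans x b).2 ?_⟩
      cases hf : (flip a j 0 (List.ofFn r)).1 with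
      | true => exact h3 hf
      | false => exact (h4 hf).1.trans (hr hf)
    · refine (le_prob_unchanged hj ha' ha1).trans (prob_mono fun r hr => ?_)
      obtain ⟨D, b, hD, -, -, h4⟩ := h2 r
      exact ⟨D, b, hD, (h4 hr).2⟩

/-! ### Polynomial space and conclusion -/

theorem SPACE_mono {S S' : ℕ → ℕ} (h : ∀ n, S n ≤ S' n) : SPACE S ⊆ SPACE S' := by
  rintro L ⟨M, hM, hL⟩
  exact ⟨M, hM, fun x => ⟨(hL x).1, fun D hD i => ((hL x).2 D hD i).trans (h _)⟩⟩

/-- From `n = 2` on, `Nat.clog 2 n + n ≤ 2 * n ≤ n ^ 2`; for `n ≤ 1` the logarithm vanishes. -/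
theorem iUnion_SPACE_clog : ⋃ k : ℕ, SPACE (fun n => (Nat.clog 2 n + n) ^ k) = PSPACE := by
  refine Set.Subset.antisymm (Set.iUnion_subset fun k => ?_) (Set.iUnion_subset fun k => ?_)
  · refine Set.subset_iUnion_of_subset (2 * k) (SPACE_mono fun n => ?_)
    rw [pow_mul]
    refine Nat.pow_le_pow_left ?_ k
    rcases n with _ | _ | n
    · simp
    · simp
    · have h1 : Nat.clog 2 (n + 1 + 1) ≤ n + 1 + 1 :=
        (Nat.clog_le_iff_le_pow (by omega)).2 Nat.lt_two_pow_self.le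
      have := Nat.mul_le_mul_right (n + 1 + 1) (show 2 ≤ n + 1 + 1 by omega)
      rw [pow_two]
      omega
  · exact Set.subset_iUnion_of_subset k (SPACE_mono fun n => Nat.pow_le_pow_left (by omega) k)

end Catalytic

theorem mainTheorem3 (ε δ : ℝ) (hε : 0 < ε) (hδ : δ < 1) (hεδ : 2 * ε < δ) :
    (∀ s c : ℕ → ℕ, (∀ n, Nat.clog 2 n ≤ s n) → (∀ n, s n ≤ c n) → (∀ n, c n ≤ 2 ^ s n) →
      (⋃ k : ℕ, Catalytic.BPCSPACE ε δ (fun n => k * s n) (fun n => c n ^ k)) =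
        ⋃ k : ℕ, Catalytic.SPACE (fun n => (s n + c n) ^ k)) ∧
    Catalytic.BPCL ε δ = Catalytic.PSPACE := by
  have main : ∀ s c : ℕ → ℕ, (∀ n, Nat.clog 2 n ≤ s n) → (∀ n, s n ≤ c n) →
      (⋃ k : ℕ, Catalytic.BPCSPACE ε δ (fun n => k * s n) (fun n => c n ^ k)) =
        ⋃ k : ℕ, Catalytic.SPACE (fun n => (s n + c n) ^ k) := fun s c hs hc =>
    Set.Subset.antisymm
      (Set.iUnion_subset fun k => Catalytic.BPCSPACE_subset_SPACE hε hs hc k)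
      (Set.iUnion_subset fun k => Catalytic.SPACE_subset_BPCSPACE hε hδ hεδ hs hc k)
  refine ⟨fun s c hs hc _ => main s c hs hc, ?_⟩
  rw [← Catalytic.iUnion_SPACE_clog]
  -- `BPCL` is by definition the case of logarithmic `s` and `c n = n`.
  exact main (Nat.clog 2) id (fun _ => le_rfl) fun n =>
    (Nat.clog_le_iff_le_pow (by omega)).2 Nat.lt_two_pow_self.le
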